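/- **Setting.** Let $k,r,m\in\mathbb{Z}_{\ge 0}$ with $2r\le m$ and $k+r\ge 1$, put $n=2k+1$, and let $\lambda=(\lambda_1,\dots,\lambda_k)\in(\mathbb{C}^\times)^k$, $\kappa=(\kappa_1,\dots,\kappa_r)\in(\mathbb{C}^\times)^r$. The twisted Heisenberg superalgebra $L=H_{n,m}^{\lambda,\kappa}$ is the complex Lie superalgebra with homogeneous basis $$\{z,u,e_1,\widehat e_1,\dots,e_k,\widehat e_k \mid w_1,\widehat w_1,\dots,w_r,\widehat w_r,\eta_1,\dots,\eta_{m-2r}\}$$ (even elements before the bar, odd elements after it), whose only nonzero brackets, up to super skew-symmetry, are $$[e_i,\widehat e_i]=\lambda_i z,\quad [u,e_i]=\lambda_i\widehat e_i,\quad [u,\widehat e_i]=-\lambda_i e_i,\quad [u,w_j]=\kappa_j\widehat w_j,\quad [u,\widehat w_j]=-\kappa_j w_j,\quad [w_j,w_j]=[\widehat w_j,\widehat w_j]=[\eta_t,\eta_t]=z .$$ A grading $\Gamma$ of $L$ is a decomposition $L=\bigoplus_{g\in G}L_g$ into $\mathbb{Z}_2$-graded subspaces indexed by an abelian group $G$ with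 $[L_g,L_h]\subseteq L_{g+h}$; its components are the nonzero $L_g$. It is fine if every grading refining it (each $L_g$ being a sum of components of the refinement) has the same components. Two gradings are equivalent if an automorphism of the superalgebra $L$ maps the components of the first bijectively onto those of the second. The Weyl group $\mathcal W(\Gamma)$ is the group of self-equivalences of $\Gamma$ modulo the subgroup of those that leave every component invariant. $\Gamma$ is toral if the group $\mathrm{Diag}(\Gamma)$ of all automorphisms of $L$ that act as a scalar on each component is contained in a torus of the algebraic group $\mathrm{Aut}(L)$. For $0\le 2s\le m-2r$ put, with $\mathbf i=\sqrt{-1}$, for $1\le t\le s$, $1\le h\le m-2r-2s$, $1\le i\le k$, $1\le j\le r$, $$p_t=\tfrac1{\sqrt2}(\eta_{2t-1}+\mathbf i\eta_{2t}),\quad q_t=\tfrac1{\sqrt2}(\eta_{2t-1}-\mathbf i\eta_{2t}),\quad z_h=\eta_{2s+h},$$ $$u_i=\tfrac1{\sqrt{2\mathbf i}}(e_i+\mathbf i\widehat e_i),\quad v_i=\tfrac1{\sqrt{2\mathbf i}}(e_i-\mathbf i\widehat e_i),\quad f_j=\tfrac1{\sqrt2}(w_j+\mathbf i\widehat w_j),\quad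 g_j=\tfrac1{\sqrt2}(w_j-\mathbf i\widehat w_j).$$ Let $\epsilon_i$ denote the $i$-th unit vector of the relevant factor. $\Gamma_1^s$ is the grading by $\mathbb Z\times\mathbb Z_4\times\mathbb Z_2^{k}\times\mathbb Z_2^{r}\times\mathbb Z^s\times\mathbb Z_2^{m-2r-2s}$ in which $$\deg z=(2,\bar2,0,0,0,0),\ \deg u=(0,\bar2,0,0,0,0),\ \deg e_i=(1,\bar0,\epsilon_i,0,0,0),\ \deg\widehat e_i=(1,\bar2,\epsilon_i,0,0,0),$$ $$\deg w_j=(1,\bar1,0,\epsilon_j,0,0),\ \deg\widehat w_j=(1,\bar3,0,\epsilon_j,0,0),\ \deg p_t=(1,\bar1,0,0,\epsilon_t,0),\ \deg q_t=(1,\bar1,0,0,-\epsilon_t,0),\ \deg z_h=(1,\bar1,0,0,0,\epsilon_h).$$ $\Gamma_2^s$ is the grading by $\mathbb Z\times\mathbb Z^{k}\times\mathbb Z^{r}\times\mathbb Z^s\times\mathbb Z_2^{m-2r-2s}$ in which $$\deg z=(2,0,0,0,0),\ \deg u=0,\ \deg u_i=(1,\epsilon_i,0,0,0),\ \deg v_i=(1,-\epsilon_i,0,0,0),\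 \deg f_j=(1,0,\epsilon_j,0,0),\ \deg g_j=(1,0,-\epsilon_j,0,0),$$ $$\deg p_t=(1,0,0,\epsilon_t,0),\ \deg q_t=(1,0,0,-\epsilon_t,0),\ \deg z_h=(1,0,0,0,\epsilon_h).$$ In both cases all components are one-dimensional. **Theorem.** Suppose that $\lambda_i/\lambda_j$ and $\kappa_i/\kappa_j$ are not roots of unity for all $i\ne j$. 1. A grading of $H_{n,m}^{\lambda,\kappa}$ is fine if and only if it is equivalent to $\Gamma_1^s$ or $\Gamma_2^s$ for some $s$ with $0\le 2s\le m-2r$. These gradings are pairwise inequivalent. Hence, up to equivalence, the number of fine gradings is $m-2r+2$ if $m$ is even and $m-2r+1$ if $m$ is odd. Among them only $\Gamma_2^{\lfloor m/2\rfloor-r}$ is toral. 2. For every such $s$, $$\mathcal W(\Gamma_1^s)\cong\mathbb Z_2^{k+r+s}\rtimes(S_s\times S_{m-2r-2s}),\qquad \mathcal W(\Gamma_2^s)\cong\mathbb Z_2^{1+s}\rtimes(S_s\times S_{m-2r-2s}),$$ where $S_s$ acts by permuting the last $s$ coordinates of $\mathbb Z_2^{k+r+s}$, respectively $\mathbb Z_2^{1+s}$,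 and $S_{m-2r-2s}$ acts trivially. -/

import Mathlib

universe u

noncomputable section

namespace TwistedHeisenberg

open Complex Submodule

/-! ### Superalgebras, gradings, fine gradings, Weyl groups -/

/-- A complex superalgebra structure on a vector space: a bilinear product and a
`ZMod 2`-grading compatible with it. -/
structure Superalgebra (A : Type*) [AddCommGroup A] [Module ℂ A] where
  mul : A →ₗ[ℂ] A →ₗ[ℂ] A
  parity : ZMod 2 → Submodule ℂ A
  parity_indep : iSupIndep parity
  parity_iSup : ⨆ i, parity i = ⊤
  mul_mem : ∀ i j x y, x ∈ parity i → y ∈ parity j → mul x y ∈ parity (i + j)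

/-- The axioms of a Lie superalgebra: super skew-symmetry and the super Jacobi identity. -/
structure Superalgebra.IsLie {A : Type*} [AddCommGroup A] [Module ℂ A]
    (S : Superalgebra A) : Prop where
  skew : ∀ i j x y, x ∈ S.parity i → y ∈ S.parity j →
    S.mul x y = -((-1 : ℂ) ^ (i.val * j.val) • S.mul y x)
  jacobi : ∀ i j x y w, x ∈ S.parity i → y ∈ S.parity j →
    S.mul x (S.mul y w) = S.mul (S.mul x y) w + (-1 : ℂ) ^ (i.val * j.val) • S.mul y (S.mul x w)

variable {A : Type*} [AddCommGroup A] [Module ℂ A]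

/-- The automorphism group of a superalgebra (automorphisms are even maps). -/
def Superalgebra.aut (S : Superalgebra A) : Subgroup (A ≃ₗ[ℂ] A) where
  carrier := {f | (∀ x y, f (S.mul x y) = S.mul (f x) (f y)) ∧
    ∀ i, (S.parity i).map (f : A →ₗ[ℂ] A) = S.parity i}
  one_mem' := ⟨fun _ _ => rfl, fun i => Submodule.map_id _⟩
  mul_mem' := by
    rintro f g ⟨hf, hf'⟩ ⟨hg, hg'⟩
    refine ⟨fun x y => ?_, fun i => ?_⟩
    · simp [hf, hg]
    · have : ((f * g : A ≃ₗ[ℂ] A) : A →ₗ[ℂ] A) = (f : A →ₗ[ℂ] A) ∘ₗ (g : A →ₗ[ℂ] A) := rfl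
      rw [this, Submodule.map_comp, hg', hf']
  inv_mem' := by
    rintro f ⟨hf, hf'⟩
    refine ⟨fun x y => ?_, fun i => ?_⟩
    · apply f.injective
      rw [hf]
      simp
    · conv_lhs => rw [← hf' i]
      rw [← Submodule.map_comp]
      have : ((f⁻¹ : A ≃ₗ[ℂ] A) : A →ₗ[ℂ] A) ∘ₗ (f : A →ₗ[ℂ] A) = LinearMap.id := by
        ext x; simp [← LinearEquiv.mul_apply]
      rw [this, Submodule.map_id]

/-- A grading of a superalgebra by an abelian group `G` (written additively): a decomposition
into `ZMod 2`-graded subspaces indexed by `G`, compatible with the product. -/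
structure Grading (S : Superalgebra A) (G : Type*) [AddCommGroup G] where
  comp : G → Submodule ℂ A
  indep : iSupIndep comp
  iSup_eq_top : ⨆ g, comp g = ⊤
  super : ∀ g, comp g = ⨆ i, comp g ⊓ S.parity i
  mul_mem : ∀ g h x y, x ∈ comp g → y ∈ comp h → S.mul x y ∈ comp (g + h)

namespace Grading

variable {S : Superalgebra A} {G H K : Type*} [AddCommGroup G] [AddCommGroup H] [AddCommGroup K]

/-- The support of a grading. -/
def support (Γ : Grading S G) : Set G := {g | Γ.comp g ≠ ⊥}

/-- The set of (nonzero) homogeneous components. -/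
def components (Γ : Grading S G) : Set (Submodule ℂ A) := Γ.comp '' Γ.support

/-- `φ` is an equivalence between two gradings of the same superalgebra. -/
def IsEquivalence (Γ : Grading S G) (Γ' : Grading S H) (φ : A ≃ₗ[ℂ] A) : Prop :=
  φ ∈ S.aut ∧ ∃ σ : Γ.support ≃ Γ'.support,
    ∀ g : Γ.support, (Γ.comp g).map (φ : A →ₗ[ℂ] A) = Γ'.comp (σ g)

/-- Equivalence of gradings. -/
def Equivalent (Γ : Grading S G) (Γ' : Grading S H) : Prop :=
  ∃ φ : A ≃ₗ[ℂ] A, Γ.IsEquivalence Γ' φ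

theorem IsEquivalence.one (Γ : Grading S G) : Γ.IsEquivalence Γ 1 :=
  ⟨S.aut.one_mem, Equiv.refl _, fun _ => Submodule.map_id _⟩

theorem IsEquivalence.mul {Γ : Grading S G} {Γ' : Grading S H} {Γ'' : Grading S K}
    {φ ψ : A ≃ₗ[ℂ] A} (hψ : Γ'.IsEquivalence Γ'' ψ) (hφ : Γ.IsEquivalence Γ' φ) :
    Γ.IsEquivalence Γ'' (ψ * φ) := by
  obtain ⟨h1, σ, hσ⟩ := hφ
  obtain ⟨h2, τ, hτ⟩ := hψ
  refine ⟨S.aut.mul_mem h2 h1, σ.trans τ, fun g => ?_⟩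
  have : ((ψ * φ : A ≃ₗ[ℂ] A) : A →ₗ[ℂ] A) = (ψ : A →ₗ[ℂ] A) ∘ₗ (φ : A →ₗ[ℂ] A) := rfl
  rw [this, Submodule.map_comp, hσ, hτ]
  rfl

theorem IsEquivalence.inv {Γ : Grading S G} {Γ' : Grading S H} {φ : A ≃ₗ[ℂ] A}
    (hφ : Γ.IsEquivalence Γ' φ) : Γ'.IsEquivalence Γ φ⁻¹ := by
  obtain ⟨h1, σ, hσ⟩ := hφ
  refine ⟨S.aut.inv_mem h1, σ.symm, fun g => ?_⟩
  have h := hσ (σ.symm g)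
  rw [Equiv.apply_symm_apply] at h
  rw [← h, ← Submodule.map_comp]
  have : ((φ⁻¹ : A ≃ₗ[ℂ] A) : A →ₗ[ℂ] A) ∘ₗ (φ : A →ₗ[ℂ] A) = LinearMap.id := by
    ext x; simp [← LinearEquiv.mul_apply]
  rw [this, Submodule.map_id]

/-- `Γ` is a refinement of `Γ'`: each component of `Γ'` is a sum of components of `Γ`. -/
def Refines (Γ : Grading S G) (Γ' : Grading S H) : Prop :=
  ∀ h, ∃ T : Set G, Γ'.comp h = ⨆ g ∈ T, Γ.comp g

/-- A grading is fine if it has no proper refinement, i.e. every refinement has the same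
homogeneous components. -/
def IsFine {G : Type u} [AddCommGroup G] (Γ : Grading S G) : Prop :=
  ∀ (H : Type u) [AddCommGroup H] (Γ' : Grading S H),
    Γ'.Refines Γ → Γ'.components = Γ.components

/-- The group of self-equivalences of a grading. -/
def aut (Γ : Grading S G) : Subgroup (A ≃ₗ[ℂ] A) where
  carrier := {φ | Γ.IsEquivalence Γ φ}
  one_mem' := IsEquivalence.one Γ
  mul_mem' := fun hf hg => IsEquivalence.mul hf hg
  inv_mem' := fun hf => IsEquivalence.inv hf

/-- The automorphisms leaving each component invariant, as a subgroup of `Aut(Γ)`. -/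
def stab (Γ : Grading S G) : Subgroup Γ.aut where
  carrier := {φ | ∀ g, (Γ.comp g).map ((φ : A ≃ₗ[ℂ] A) : A →ₗ[ℂ] A) = Γ.comp g}
  one_mem' := fun _ => Submodule.map_id _
  mul_mem' := by
    intro f g hf hg a
    have : (((f * g : Γ.aut) : A ≃ₗ[ℂ] A) : A →ₗ[ℂ] A) =
      ((f : A ≃ₗ[ℂ] A) : A →ₗ[ℂ] A) ∘ₗ ((g : A ≃ₗ[ℂ] A) : A →ₗ[ℂ] A) := rfl
    rw [this, Submodule.map_comp, hg, hf]
  inv_mem' := by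
    intro f hf a
    conv_lhs => rw [← hf a]
    rw [← Submodule.map_comp]
    have : (((f⁻¹ : Γ.aut) : A ≃ₗ[ℂ] A) : A →ₗ[ℂ] A) ∘ₗ ((f : A ≃ₗ[ℂ] A) : A →ₗ[ℂ] A)
        = LinearMap.id := by
      ext x; simp [← LinearEquiv.mul_apply]
    rw [this, Submodule.map_id]

instance stab_normal (Γ : Grading S G) : Γ.stab.Normal where
  conj_mem := by
    intro n hn f a
    have hf : Γ.IsEquivalence Γ ((f⁻¹ : Γ.aut) : A ≃ₗ[ℂ] A) := (f⁻¹).2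
    obtain ⟨-, σ, hσ⟩ := hf
    have e : (((f * n * f⁻¹ : Γ.aut) : A ≃ₗ[ℂ] A) : A →ₗ[ℂ] A) =
      (((f : A ≃ₗ[ℂ] A) : A →ₗ[ℂ] A) ∘ₗ ((n : A ≃ₗ[ℂ] A) : A →ₗ[ℂ] A)) ∘ₗ
        (((f⁻¹ : Γ.aut) : A ≃ₗ[ℂ] A) : A →ₗ[ℂ] A) := rfl
    by_cases ha : Γ.comp a = ⊥
    · rw [ha, Submodule.map_bot]
    · have h := hσ ⟨a, ha⟩
      have e2 : (((f : Γ.aut) : A ≃ₗ[ℂ] A) : A →ₗ[ℂ] A) ∘ₗ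
          (((f⁻¹ : Γ.aut) : A ≃ₗ[ℂ] A) : A →ₗ[ℂ] A) = LinearMap.id := by
        ext x; simp
      have h2 := congrArg (Submodule.map (((f : Γ.aut) : A ≃ₗ[ℂ] A) : A →ₗ[ℂ] A)) h
      rw [← Submodule.map_comp, e2, Submodule.map_id] at h2
      rw [e, Submodule.map_comp, h, Submodule.map_comp, hn]
      exact h2.symm

/-- The Weyl group `Aut(Γ) / Stab(Γ)`. -/
abbrev WeylGroup (Γ : Grading S G) : Type _ := Γ.aut ⧸ Γ.stab

/-- The diagonal group: automorphisms acting as a scalar on each component. -/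
def diag (Γ : Grading S G) : Set (A ≃ₗ[ℂ] A) :=
  {φ | φ ∈ S.aut ∧ ∀ g, ∃ c : ℂ, ∀ x ∈ Γ.comp g, φ x = c • x}

end Grading

/-- A torus in the general linear group of a finite-dimensional space: the image of an injective
homomorphism from `(ℂˣ)^d` whose matrix coefficients are Laurent polynomials (such an image is
Zariski closed and, in characteristic zero, isomorphic to `(ℂˣ)^d` as an algebraic group). -/
def IsTorus (T : Subgroup (A ≃ₗ[ℂ] A)) : Prop :=
  ∃ (d : ℕ) (χ : (Fin d → ℂˣ) →* (A ≃ₗ[ℂ] A)), Function.Injective χ ∧ χ.range = T ∧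
    ∀ (x : A) (f : Module.Dual ℂ A), ∃ P : (Fin d → ℤ) →₀ ℂ, ∀ t : Fin d → ℂˣ,
      f (χ t x) = P.sum fun a c => c * ((∏ i, t i ^ a i : ℂˣ) : ℂ)

/-- A grading is toral if its diagonal group lies in a torus of the automorphism group. -/
def Grading.IsToral {S : Superalgebra A} {G : Type*} [AddCommGroup G] (Γ : Grading S G) : Prop :=
  ∃ T : Subgroup (A ≃ₗ[ℂ] A), T ≤ S.aut ∧ IsTorus T ∧ Γ.diag ⊆ T

/-- Fine gradings (over arbitrary abelian groups) of a superalgebra. -/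
structure FineGrading (S : Superalgebra A) where
  G : Type u
  [group : AddCommGroup G]
  grading : Grading S G
  fine : grading.IsFine

attribute [instance] FineGrading.group

/-- Equivalence of fine gradings, as an equivalence relation. -/
def fineSetoid (S : Superalgebra A) : Setoid (FineGrading.{u} S) where
  r Γ Γ' := Γ.grading.Equivalent Γ'.grading
  iseqv := ⟨fun Γ => ⟨1, .one Γ.grading⟩, fun ⟨φ, h⟩ => ⟨φ⁻¹, h.inv⟩,
    fun ⟨φ, h⟩ ⟨ψ, h'⟩ => ⟨ψ * φ, h'.mul h⟩⟩

/-! ### Gradings defined by a basis of homogeneous elements -/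

/-- The span of the basis vectors of degree `g`. -/
def degSpan {ι G : Type*} (b : Module.Basis ι ℂ A) (deg : ι → G) (g : G) : Submodule ℂ A :=
  span ℂ (b '' {i | deg i = g})

theorem basis_mem_degSpan {ι G : Type*} (b : Module.Basis ι ℂ A) (deg : ι → G) {i : ι} {g : G}
    (h : deg i = g) : b i ∈ degSpan b deg g :=
  subset_span ⟨i, h, rfl⟩

theorem degSpan_indep {ι G : Type*} (b : Module.Basis ι ℂ A) (deg : ι → G) :
    iSupIndep (degSpan b deg) := by
  intro g
  refine Disjoint.mono_right (c := span ℂ (b '' {i | deg i ≠ g})) ?_ ?_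
  · refine iSup₂_le fun h hh => span_mono (Set.image_mono ?_)
    rintro i rfl
    exact hh
  · apply b.linearIndependent.disjoint_span_image
    rw [Set.disjoint_left]
    intro i h1 h2
    exact h2 h1

theorem degSpan_iSup {ι G : Type*} (b : Module.Basis ι ℂ A) (deg : ι → G) :
    ⨆ g, degSpan b deg g = ⊤ := by
  rw [eq_top_iff, ← b.span_eq, span_le]
  rintro _ ⟨i, rfl⟩
  exact mem_iSup_of_mem (deg i) (basis_mem_degSpan b deg rfl)

theorem mul_mem_degSpan {ι G : Type*} [Add G] (b : Module.Basis ι ℂ A) (deg : ι → G)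
    (mul : A →ₗ[ℂ] A →ₗ[ℂ] A)
    (hmul : ∀ i j, mul (b i) (b j) ∈ degSpan b deg (deg i + deg j)) (g h : G) (x y : A)
    (hx : x ∈ degSpan b deg g) (hy : y ∈ degSpan b deg h) :
    mul x y ∈ degSpan b deg (g + h) := by
  have key : degSpan b deg g ≤ ((degSpan b deg (g + h)).comap (mul.flip y)) := by
    refine span_le.2 ?_
    rintro _ ⟨i, rfl, rfl⟩
    have key' : degSpan b deg h ≤ (degSpan b deg (deg i + h)).comap (mul (b i)) := by
      refine span_le.2 ?_
      rintro _ ⟨j, rfl, rfl⟩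
      exact hmul i j
    exact key' hy
  exact key hx

/-- The grading for which the basis vector `b i` is homogeneous of degree `deg i`. -/
def Grading.ofBasis {S : Superalgebra A} {ι G : Type*} [AddCommGroup G] (b : Module.Basis ι ℂ A)
    (deg : ι → G) (hpar : ∀ i, ∃ p, b i ∈ S.parity p)
    (hmul : ∀ i j, S.mul (b i) (b j) ∈ degSpan b deg (deg i + deg j)) : Grading S G where
  comp := degSpan b deg
  indep := degSpan_indep b deg
  iSup_eq_top := degSpan_iSup b deg
  super := by
    intro g
    refine le_antisymm (span_le.2 ?_) (iSup_le fun _ => inf_le_left)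
    rintro _ ⟨i, hi, rfl⟩
    obtain ⟨p, hp⟩ := hpar i
    exact mem_iSup_of_mem p ⟨basis_mem_degSpan b deg hi, hp⟩
  mul_mem := mul_mem_degSpan b deg S.mul hmul

/-! ### Twisted Heisenberg superalgebras -/

/-- Labels of the defining basis
`z, u, e_i, ê_i | w_j, ŵ_j, η_t` of a twisted Heisenberg superalgebra. -/
inductive Idx (k r m : ℕ) : Type
  | z : Idx k r m
  | u : Idx k r m
  | e (i : Fin k) : Idx k r m
  | e' (i : Fin k) : Idx k r m
  | w (j : Fin r) : Idx k r m
  | w' (j : Fin r) : Idx k r m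
  | eta (t : Fin (m - 2 * r)) : Idx k r m
  deriving DecidableEq, Fintype

/-- The parity of the elements of the defining basis. -/
def Idx.par {k r m : ℕ} : Idx k r m → ZMod 2
  | .z => 0
  | .u => 0
  | .e _ => 0
  | .e' _ => 0
  | .w _ => 1
  | .w' _ => 1
  | .eta _ => 1

/-- The underlying vector space. -/
abbrev Space (k r m : ℕ) : Type := Idx k r m → ℂ

/-- The defining basis. -/
abbrev bas (k r m : ℕ) : Module.Basis (Idx k r m) ℂ (Space k r m) := Pi.basisFun ℂ (Idx k r m)

/-- The brackets of the elements of the defining basis. -/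
def table {k r m : ℕ} (lam : Fin k → ℂˣ) (kap : Fin r → ℂˣ) :
    Idx k r m → Idx k r m → Space k r m
  | .e i, .e' j => if i = j then (lam i : ℂ) • bas k r m .z else 0
  | .e' i, .e j => if i = j then -(lam i : ℂ) • bas k r m .z else 0
  | .u, .e i => (lam i : ℂ) • bas k r m (.e' i)
  | .e i, .u => -(lam i : ℂ) • bas k r m (.e' i)
  | .u, .e' i => -(lam i : ℂ) • bas k r m (.e i)
  | .e' i, .u => (lam i : ℂ) • bas k r m (.e i)
  | .u, .w j => (kap j : ℂ) • bas k r m (.w' j)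
  | .w j, .u => -(kap j : ℂ) • bas k r m (.w' j)
  | .u, .w' j => -(kap j : ℂ) • bas k r m (.w j)
  | .w' j, .u => (kap j : ℂ) • bas k r m (.w j)
  | .w i, .w j => if i = j then bas k r m .z else 0
  | .w' i, .w' j => if i = j then bas k r m .z else 0
  | .eta i, .eta j => if i = j then bas k r m .z else 0
  | _, _ => 0

/-- The bilinear extension of the table of brackets. -/
def bracket {k r m : ℕ} (lam : Fin k → ℂˣ) (kap : Fin r → ℂˣ) :
    Space k r m →ₗ[ℂ] Space k r m →ₗ[ℂ] Space k r m :=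
  (bas k r m).constr ℂ fun a => (bas k r m).constr ℂ fun b => table lam kap a b

theorem bracket_bas {k r m : ℕ} (lam : Fin k → ℂˣ) (kap : Fin r → ℂˣ) (a b : Idx k r m) :
    bracket lam kap (bas k r m a) (bas k r m b) = table lam kap a b := by
  rw [bracket, Module.Basis.constr_basis, Module.Basis.constr_basis]

theorem table_mem {k r m : ℕ} (lam : Fin k → ℂˣ) (kap : Fin r → ℂˣ) (a b : Idx k r m) :
    table lam kap a b ∈ degSpan (bas k r m) Idx.par (a.par + b.par) := by
  have h2 : (1 : ZMod 2) + 1 = 0 := rfl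
  cases a <;> cases b <;> simp only [table, Idx.par] <;> (try split_ifs) <;>
    first
    | exact zero_mem _
    | exact smul_mem _ _ (basis_mem_degSpan _ _ (by simp [Idx.par]))
    | exact basis_mem_degSpan _ _ (by simp [Idx.par, h2])

/-- The twisted Heisenberg superalgebra `H_{n,m}^{λ,κ}` with `n = 2k + 1`. -/
def heis (k r m : ℕ) (lam : Fin k → ℂˣ) (kap : Fin r → ℂˣ) : Superalgebra (Space k r m) where
  mul := bracket lam kap
  parity := degSpan (bas k r m) Idx.par
  parity_indep := degSpan_indep _ _
  parity_iSup := degSpan_iSup _ _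
  mul_mem := mul_mem_degSpan _ _ _ fun a b => by
    rw [bracket_bas]
    exact table_mem lam kap a b

theorem table_skew {k r m : ℕ} (lam : Fin k → ℂˣ) (kap : Fin r → ℂˣ) (a b : Idx k r m) :
    table lam kap a b = -((-1 : ℂ) ^ (a.par.val * b.par.val) • table lam kap b a) := by
  cases a <;> cases b <;> simp [table, Idx.par, ZMod.val_one] <;> grind

theorem table_jacobi {k r m : ℕ} (lam : Fin k → ℂˣ) (kap : Fin r → ℂˣ) (a b c : Idx k r m) :
    bracket lam kap (bas k r m a) (table lam kap b c) =
      bracket lam kap (table lam kap a b) (bas k r m c) +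
      (-1 : ℂ) ^ (a.par.val * b.par.val) •
        bracket lam kap (bas k r m b) (table lam kap a c) := by
  cases a <;> cases b <;> cases c <;>
    simp only [table, Idx.par, ZMod.val_one, ZMod.val_zero] <;> (try split_ifs) <;>
    simp only [map_smul, map_zero, LinearMap.zero_apply, LinearMap.smul_apply, bracket_bas,
      table] <;> (try split_ifs) <;> try simp_all

theorem heis_isLie (k r m : ℕ) (lam : Fin k → ℂˣ) (kap : Fin r → ℂˣ) :
    (heis k r m lam kap).IsLie where
  skew := by
    intro i j x y hx hy
    simp only [heis] at *
    refine span_induction (p := fun x _ => bracket lam kap x y =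
      -((-1 : ℂ) ^ (i.val * j.val) • bracket lam kap y x)) ?_ ?_ ?_ ?_ hx
    · rintro _ ⟨a, rfl, rfl⟩
      refine span_induction (p := fun y _ => bracket lam kap (bas k r m a) y =
        -((-1 : ℂ) ^ (a.par.val * j.val) • bracket lam kap y (bas k r m a))) ?_ ?_ ?_ ?_ hy
      · rintro _ ⟨b, rfl, rfl⟩
        rw [bracket_bas, bracket_bas]
        exact table_skew lam kap a b
      · simp
      · intro x y _ _ h1 h2
        rw [map_add, h1, h2, map_add, LinearMap.add_apply]
        module
      · intro c x _ h1
        rw [map_smul, h1, map_smul, LinearMap.smul_apply]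
        module
    · simp
    · intro x y _ _ h1 h2
      rw [map_add, LinearMap.add_apply, h1, h2, map_add]
      module
    · intro c x _ h1
      rw [map_smul, LinearMap.smul_apply, h1, map_smul]
      module
  jacobi := by
    intro i j x y w hx hy
    simp only [heis] at *
    refine span_induction (p := fun x _ => bracket lam kap x (bracket lam kap y w) =
      bracket lam kap (bracket lam kap x y) w +
      (-1 : ℂ) ^ (i.val * j.val) • bracket lam kap y (bracket lam kap x w)) ?_ ?_ ?_ ?_ hx
    · rintro _ ⟨a, rfl, rfl⟩
      refine span_induction (p := fun y _ =>
        bracket lam kap (bas k r m a) (bracket lam kap y w) =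
        bracket lam kap (bracket lam kap (bas k r m a) y) w +
        (-1 : ℂ) ^ (a.par.val * j.val) •
          bracket lam kap y (bracket lam kap (bas k r m a) w)) ?_ ?_ ?_ ?_ hy
      · rintro _ ⟨b, rfl, rfl⟩
        refine span_induction (p := fun w _ =>
          bracket lam kap (bas k r m a) (bracket lam kap (bas k r m b) w) =
          bracket lam kap (bracket lam kap (bas k r m a) (bas k r m b)) w +
          (-1 : ℂ) ^ (a.par.val * b.par.val) •
            bracket lam kap (bas k r m b) (bracket lam kap (bas k r m a) w)) ?_ ?_ ?_ ?_
          ((bas k r m).mem_span w)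
        · rintro _ ⟨c, rfl⟩
          simp only [bracket_bas]
          exact table_jacobi lam kap a b c
        · simp
        · intro x y _ _ h1 h2
          simp only [map_add, h1, h2]
          module
        · intro c x _ h1
          simp only [map_smul, h1]
          module
      · simp
      · intro x y _ _ h1 h2
        simp only [map_add, LinearMap.add_apply, h1, h2]
        module
      · intro c x _ h1
        simp only [map_smul, LinearMap.smul_apply, h1]
        module
    · simp
    · intro x y _ _ h1 h2
      simp only [map_add, LinearMap.add_apply, h1, h2]
      module
    · intro c x _ h1
      simp only [map_smul, LinearMap.smul_apply, h1]
      module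

/-! ### The gradings `Γ₁^s` and `Γ₂^s` -/

/-- Labels of the bases adapted to the gradings `Γ₁^s` (`a_i = e_i`, `a'_i = ê_i`, `c_j = w_j`,
`c'_j = ŵ_j`) and `Γ₂^s` (`a_i = u_i`, `a'_i = v_i`, `c_j = f_j`, `c'_j = g_j`). -/
inductive Idx2 (k r s t : ℕ) : Type
  | z : Idx2 k r s t
  | u : Idx2 k r s t
  | a (i : Fin k) : Idx2 k r s t
  | a' (i : Fin k) : Idx2 k r s t
  | c (j : Fin r) : Idx2 k r s t
  | c' (j : Fin r) : Idx2 k r s t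
  | p (i : Fin s) : Idx2 k r s t
  | q (i : Fin s) : Idx2 k r s t
  | y (h : Fin t) : Idx2 k r s t
  deriving DecidableEq, Fintype

section Bases

variable {k r m s : ℕ} (hs : 2 * s ≤ m - 2 * r)

/-- `p_i = (η_{2i-1} + 𝐢 η_{2i}) / √2` (with indices starting from one). -/
def pVec (i : Fin s) : Space k r m :=
  (1 / (Real.sqrt 2 : ℂ)) • (bas k r m (.eta ⟨2 * i, by omega⟩) +
    I • bas k r m (.eta ⟨2 * i + 1, by omega⟩))

/-- `q_i = (η_{2i-1} - 𝐢 η_{2i}) / √2` (with indices starting from one). -/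
def qVec (i : Fin s) : Space k r m :=
  (1 / (Real.sqrt 2 : ℂ)) • (bas k r m (.eta ⟨2 * i, by omega⟩) -
    I • bas k r m (.eta ⟨2 * i + 1, by omega⟩))

/-- `z_h = η_{h+2s}`. -/
def yVec (h : Fin (m - 2 * r - 2 * s)) : Space k r m :=
  bas k r m (.eta ⟨h + 2 * s, by omega⟩)

/-- The homogeneous basis of `Γ₁^s`. -/
def vec1 : Idx2 k r s (m - 2 * r - 2 * s) → Space k r m
  | .z => bas k r m .z
  | .u => bas k r m .u
  | .a i => bas k r m (.e i)
  | .a' i => bas k r m (.e' i)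
  | .c j => bas k r m (.w j)
  | .c' j => bas k r m (.w' j)
  | .p i => pVec hs i
  | .q i => qVec hs i
  | .y h => yVec (k := k) hs h

/-- The homogeneous basis of `Γ₂^s`; here `1 + 𝐢` is a square root of `2𝐢`. -/
def vec2 : Idx2 k r s (m - 2 * r - 2 * s) → Space k r m
  | .z => bas k r m .z
  | .u => bas k r m .u
  | .a i => (1 / (1 + I)) • (bas k r m (.e i) + I • bas k r m (.e' i))
  | .a' i => (1 / (1 + I)) • (bas k r m (.e i) - I • bas k r m (.e' i))
  | .c j => (1 / (Real.sqrt 2 : ℂ)) • (bas k r m (.w j) + I • bas k r m (.w' j))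
  | .c' j => (1 / (Real.sqrt 2 : ℂ)) • (bas k r m (.w j) - I • bas k r m (.w' j))
  | .p i => pVec hs i
  | .q i => qVec hs i
  | .y h => yVec (k := k) hs h

theorem mem_of_add_sub {A : Type*} [AddCommGroup A] [Module ℂ A] (P : Submodule ℂ A) {α : ℂ}
    (hα : α ≠ 0) {x y : A} (h1 : α • (x + I • y) ∈ P) (h2 : α • (x - I • y) ∈ P) :
    x ∈ P ∧ y ∈ P := by
  rw [P.smul_mem_iff hα] at h1 h2
  have h3 : (2 : ℂ) • x ∈ P := by
    convert P.add_mem h1 h2 using 1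
    module
  have h4 : (2 * I) • y ∈ P := by
    convert P.sub_mem h1 h2 using 1
    module
  exact ⟨(P.smul_mem_iff two_ne_zero).1 h3,
    (P.smul_mem_iff (mul_ne_zero two_ne_zero I_ne_zero)).1 h4⟩

theorem inv_sqrt_two_ne_zero : (1 / (Real.sqrt 2 : ℂ)) ≠ 0 := by
  simp

theorem inv_one_add_I_ne_zero : (1 / (1 + I)) ≠ 0 := by
  apply one_div_ne_zero
  intro h
  simpa using congrArg Complex.re h

theorem eta_mem (P : Submodule ℂ (Space k r m)) (hp : ∀ i, pVec hs i ∈ P) (hq : ∀ i, qVec hs i ∈ P)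
    (hy : ∀ h, yVec (k := k) hs h ∈ P) (t : Fin (m - 2 * r)) :
    bas k r m (.eta t) ∈ P := by
  obtain ⟨t, ht⟩ := t
  by_cases h : t < 2 * s
  · have key := fun i => mem_of_add_sub P inv_sqrt_two_ne_zero (hp i) (hq i)
    rcases Nat.even_or_odd' t with ⟨c, rfl | rfl⟩
    · exact (key ⟨c, by omega⟩).1
    · exact (key ⟨c, by omega⟩).2
  · have e : bas k r m (.eta ⟨t, ht⟩) = yVec (k := k) hs ⟨t - 2 * s, by omega⟩ := by
      have e' : t - 2 * s + 2 * s = t := by omega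
      simp only [yVec, e']
    rw [e]
    exact hy _

theorem vec1_span : ⊤ ≤ span ℂ (Set.range (vec1 (k := k) hs)) := by
  have H : ∀ a, vec1 (k := k) hs a ∈ span ℂ (Set.range (vec1 (k := k) hs)) :=
    fun a => subset_span ⟨a, rfl⟩
  rw [← (bas k r m).span_eq, span_le]
  rintro _ ⟨a, rfl⟩
  cases a with
  | z => exact H .z
  | u => exact H .u
  | e i => exact H (.a i)
  | e' i => exact H (.a' i)
  | w i => exact H (.c i)
  | w' i => exact H (.c' i)
  | eta t => exact eta_mem hs _ (fun i => H (.p i)) (fun i => H (.q i)) (fun h => H (.y h)) t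

theorem vec2_span : ⊤ ≤ span ℂ (Set.range (vec2 (k := k) hs)) := by
  have H : ∀ a, vec2 (k := k) hs a ∈ span ℂ (Set.range (vec2 (k := k) hs)) :=
    fun a => subset_span ⟨a, rfl⟩
  rw [← (bas k r m).span_eq, span_le]
  rintro _ ⟨a, rfl⟩
  cases a with
  | z => exact H .z
  | u => exact H .u
  | e i => exact (mem_of_add_sub _ inv_one_add_I_ne_zero (H (.a i)) (H (.a' i))).1
  | e' i => exact (mem_of_add_sub _ inv_one_add_I_ne_zero (H (.a i)) (H (.a' i))).2
  | w i => exact (mem_of_add_sub _ inv_sqrt_two_ne_zero (H (.c i)) (H (.c' i))).1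
  | w' i => exact (mem_of_add_sub _ inv_sqrt_two_ne_zero (H (.c i)) (H (.c' i))).2
  | eta t => exact eta_mem hs _ (fun i => H (.p i)) (fun i => H (.q i)) (fun h => H (.y h)) t

theorem card_idx2 (k r m s : ℕ) (hs : 2 * s ≤ m - 2 * r) : Fintype.card (Idx2 k r s (m - 2 * r - 2 * s)) =
    Module.finrank ℂ (Space k r m) := by
  rw [Module.finrank_fintype_fun_eq_card, ← Fintype.card_congr (proxy_equiv% (Idx k r m)),
    ← Fintype.card_congr (proxy_equiv% (Idx2 k r s (m - 2 * r - 2 * s)))]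
  simp
  omega

/-- The brackets of the elements of the basis of `Γ₁^s`. -/
def table1 {t : ℕ} (lam : Fin k → ℂˣ) (kap : Fin r → ℂˣ) :
    Idx2 k r s t → Idx2 k r s t → Space k r m
  | .p i, .q j => if i = j then bas k r m .z else 0
  | .q i, .p j => if i = j then bas k r m .z else 0
  | .y i, .y j => if i = j then bas k r m .z else 0
  | .a i, .a' j => if i = j then (lam i : ℂ) • bas k r m .z else 0
  | .a' i, .a j => if i = j then -(lam i : ℂ) • bas k r m .z else 0
  | .u, .a i => (lam i : ℂ) • bas k r m (.e' i)
  | .a i, .u => -(lam i : ℂ) • bas k r m (.e' i)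
  | .u, .a' i => -(lam i : ℂ) • bas k r m (.e i)
  | .a' i, .u => (lam i : ℂ) • bas k r m (.e i)
  | .u, .c j => (kap j : ℂ) • bas k r m (.w' j)
  | .c j, .u => -(kap j : ℂ) • bas k r m (.w' j)
  | .u, .c' j => -(kap j : ℂ) • bas k r m (.w j)
  | .c' j, .u => (kap j : ℂ) • bas k r m (.w j)
  | .c i, .c j => if i = j then bas k r m .z else 0
  | .c' i, .c' j => if i = j then bas k r m .z else 0
  | _, _ => 0

/-- The brackets of the elements of the basis of `Γ₂^s`. -/
def table2 (lam : Fin k → ℂˣ) (kap : Fin r → ℂˣ) :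
    Idx2 k r s (m - 2 * r - 2 * s) → Idx2 k r s (m - 2 * r - 2 * s) → Space k r m
  | .p i, .q j => if i = j then bas k r m .z else 0
  | .q i, .p j => if i = j then bas k r m .z else 0
  | .y i, .y j => if i = j then bas k r m .z else 0
  | .a i, .a' j => if i = j then -(lam i : ℂ) • bas k r m .z else 0
  | .a' i, .a j => if i = j then (lam i : ℂ) • bas k r m .z else 0
  | .u, .a i => (-I * lam i : ℂ) • vec2 hs (.a i)
  | .a i, .u => (I * lam i : ℂ) • vec2 hs (.a i)
  | .u, .a' i => (I * lam i : ℂ) • vec2 hs (.a' i)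
  | .a' i, .u => (-I * lam i : ℂ) • vec2 hs (.a' i)
  | .u, .c j => (-I * kap j : ℂ) • vec2 hs (.c j)
  | .c j, .u => (I * kap j : ℂ) • vec2 hs (.c j)
  | .u, .c' j => (I * kap j : ℂ) • vec2 hs (.c' j)
  | .c' j, .u => (-I * kap j : ℂ) • vec2 hs (.c' j)
  | .c i, .c' j => if i = j then bas k r m .z else 0
  | .c' i, .c j => if i = j then bas k r m .z else 0
  | _, _ => 0

theorem sqrt_two_aux : (1 / (Real.sqrt 2 : ℂ)) * (1 / (Real.sqrt 2 : ℂ)) = 1 / 2 := by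
  rw [div_mul_div_comm, one_mul, ← Complex.ofReal_mul, Real.mul_self_sqrt zero_le_two]
  simp

theorem one_add_I_aux : (1 / (1 + I)) * (1 / (1 + I)) = -I / 2 := by
  have h : (1 : ℂ) + I ≠ 0 := fun h => by simpa using congrArg Complex.re h
  field_simp
  linear_combination (2 + I) * I_sq

theorem bracket_vec1 (lam : Fin k → ℂˣ) (kap : Fin r → ℂˣ)
    (a b : Idx2 k r s (m - 2 * r - 2 * s)) :
    bracket lam kap (vec1 hs a) (vec1 hs b) = table1 lam kap a b := by
  have h1 : ∀ i j : ℕ, ¬ (2 * i + 1 = 2 * j) := by omega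
  have h2 : ∀ i j : ℕ, ¬ (2 * i = 2 * j + 1) := by omega
  have h3 : ∀ i j : ℕ, (2 * i + 1 = 2 * j + 1) = (i = j) := by intros; simp
  have h4 : ∀ i j : ℕ, (2 * i = 2 * j) = (i = j) := by intros; simp
  have h5 : ∀ (i : Fin s) (j : ℕ), ¬ (2 * i.val = j + 2 * s) := by omega
  have h6 : ∀ (i : Fin s) (j : ℕ), ¬ (2 * i.val + 1 = j + 2 * s) := by omega
  have h5' : ∀ (i : Fin s) (j : ℕ), ¬ (j + 2 * s = 2 * i.val) := by omega
  have h6' : ∀ (i : Fin s) (j : ℕ), ¬ (j + 2 * s = 2 * i.val + 1) := by omega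
  have hc := sqrt_two_aux
  have hI := I_mul_I
  generalize hcc : (1 / (Real.sqrt 2 : ℂ)) = c at hc
  cases a <;> cases b <;>
    simp only [vec1, pVec, qVec, yVec, hcc, map_add, map_sub, map_smul, LinearMap.add_apply,
      LinearMap.sub_apply, LinearMap.smul_apply, bracket_bas, table, table1,
      Fin.ext_iff, h1, h2, h3, h4, h5, h6, h5', h6', if_false, smul_zero, add_zero,
      zero_add, sub_zero, zero_sub, Nat.add_right_cancel_iff] <;>
    (try split_ifs) <;> (try simp only [smul_zero, add_zero, sub_zero, neg_zero]) <;>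
    try (match_scalars; grind)

theorem bracket_vec2 (lam : Fin k → ℂˣ) (kap : Fin r → ℂˣ)
    (a b : Idx2 k r s (m - 2 * r - 2 * s)) :
    bracket lam kap (vec2 hs a) (vec2 hs b) = table2 hs lam kap a b := by
  have h1 : ∀ i j : ℕ, ¬ (2 * i + 1 = 2 * j) := by omega
  have h2 : ∀ i j : ℕ, ¬ (2 * i = 2 * j + 1) := by omega
  have h3 : ∀ i j : ℕ, (2 * i + 1 = 2 * j + 1) = (i = j) := by intros; simp
  have h4 : ∀ i j : ℕ, (2 * i = 2 * j) = (i = j) := by intros; simp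
  have h5 : ∀ (i : Fin s) (j : ℕ), ¬ (2 * i.val = j + 2 * s) := by omega
  have h6 : ∀ (i : Fin s) (j : ℕ), ¬ (2 * i.val + 1 = j + 2 * s) := by omega
  have h5' : ∀ (i : Fin s) (j : ℕ), ¬ (j + 2 * s = 2 * i.val) := by omega
  have h6' : ∀ (i : Fin s) (j : ℕ), ¬ (j + 2 * s = 2 * i.val + 1) := by omega
  have hc := sqrt_two_aux
  have hd := one_add_I_aux
  have hI := I_mul_I
  generalize hcc : (1 / (Real.sqrt 2 : ℂ)) = c at hc
  generalize hdd : (1 / (1 + I)) = d at hd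
  cases a <;> cases b <;>
    simp only [vec2, pVec, qVec, yVec, hcc, hdd, map_add, map_sub, map_smul, LinearMap.add_apply,
      LinearMap.sub_apply, LinearMap.smul_apply, bracket_bas, table, table2,
      Fin.ext_iff, h1, h2, h3, h4, h5, h6, h5', h6', if_false, smul_zero, add_zero,
      zero_add, sub_zero, zero_sub, Nat.add_right_cancel_iff] <;>
    (try split_ifs) <;> (try simp only [smul_zero, add_zero, sub_zero, neg_zero]) <;>
    try (subst_vars; match_scalars <;> grind)

/-- The homogeneous basis of `Γ₁^s`, as a basis. -/
def basis1 : Module.Basis (Idx2 k r s (m - 2 * r - 2 * s)) ℂ (Space k r m) :=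
  basisOfTopLeSpanOfCardEqFinrank (vec1 hs) (vec1_span hs) (card_idx2 k r m s hs)

/-- The homogeneous basis of `Γ₂^s`, as a basis. -/
def basis2 : Module.Basis (Idx2 k r s (m - 2 * r - 2 * s)) ℂ (Space k r m) :=
  basisOfTopLeSpanOfCardEqFinrank (vec2 hs) (vec2_span hs) (card_idx2 k r m s hs)

theorem basis1_apply (a : Idx2 k r s (m - 2 * r - 2 * s)) :
    basis1 (k := k) hs a = vec1 hs a := by
  rw [basis1, coe_basisOfTopLeSpanOfCardEqFinrank]

theorem basis2_apply (a : Idx2 k r s (m - 2 * r - 2 * s)) :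
    basis2 (k := k) hs a = vec2 hs a := by
  rw [basis2, coe_basisOfTopLeSpanOfCardEqFinrank]

theorem vec1_mem {G : Type*} (deg : Idx2 k r s (m - 2 * r - 2 * s) → G)
    (a : Idx2 k r s (m - 2 * r - 2 * s)) {g : G} (h : deg a = g) :
    vec1 hs a ∈ degSpan (basis1 (k := k) hs) deg g := by
  rw [← basis1_apply]
  exact basis_mem_degSpan _ _ h

theorem vec2_mem {G : Type*} (deg : Idx2 k r s (m - 2 * r - 2 * s) → G)
    (a : Idx2 k r s (m - 2 * r - 2 * s)) {g : G} (h : deg a = g) :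
    vec2 hs a ∈ degSpan (basis2 (k := k) hs) deg g := by
  rw [← basis2_apply]
  exact basis_mem_degSpan _ _ h

/-- The parity of the elements of the adapted bases. -/
def Idx2.par {k r s t : ℕ} : Idx2 k r s t → ZMod 2
  | .z => 0
  | .u => 0
  | .a _ => 0
  | .a' _ => 0
  | .c _ => 1
  | .c' _ => 1
  | .p _ => 1
  | .q _ => 1
  | .y _ => 1

theorem vec1_par (a : Idx2 k r s (m - 2 * r - 2 * s)) :
    vec1 hs a ∈ degSpan (bas k r m) Idx.par a.par := by
  have H0 : ∀ i : Idx k r m, i.par = 0 → bas k r m i ∈ degSpan (bas k r m) Idx.par 0 :=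
    fun i h => basis_mem_degSpan _ _ h
  have H1 : ∀ i : Idx k r m, i.par = 1 → bas k r m i ∈ degSpan (bas k r m) Idx.par 1 :=
    fun i h => basis_mem_degSpan _ _ h
  have Hp : ∀ (x : ℂ) (i j : Idx k r m), i.par = 1 → j.par = 1 →
      x • (bas k r m i + I • bas k r m j) ∈ degSpan (bas k r m) Idx.par 1 :=
    fun x i j hi hj => smul_mem _ _ (add_mem (H1 i hi) (smul_mem _ _ (H1 j hj)))
  have Hm : ∀ (x : ℂ) (i j : Idx k r m), i.par = 1 → j.par = 1 →
      x • (bas k r m i - I • bas k r m j) ∈ degSpan (bas k r m) Idx.par 1 :=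
    fun x i j hi hj => smul_mem _ _ (sub_mem (H1 i hi) (smul_mem _ _ (H1 j hj)))
  cases a <;> simp only [vec1, Idx2.par, pVec, qVec, yVec] <;>
    first
    | with_reducible refine H0 _ ?_
    | with_reducible refine H1 _ ?_
    | with_reducible refine Hp _ _ _ ?_ ?_
    | with_reducible refine Hm _ _ _ ?_ ?_
  all_goals simp only [Idx.par]

theorem vec2_par (a : Idx2 k r s (m - 2 * r - 2 * s)) :
    vec2 hs a ∈ degSpan (bas k r m) Idx.par a.par := by
  have H0 : ∀ i : Idx k r m, i.par = 0 → bas k r m i ∈ degSpan (bas k r m) Idx.par 0 :=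
    fun i h => basis_mem_degSpan _ _ h
  have H1 : ∀ i : Idx k r m, i.par = 1 → bas k r m i ∈ degSpan (bas k r m) Idx.par 1 :=
    fun i h => basis_mem_degSpan _ _ h
  have Hp : ∀ (x : ℂ) (i j : Idx k r m), i.par = 1 → j.par = 1 →
      x • (bas k r m i + I • bas k r m j) ∈ degSpan (bas k r m) Idx.par 1 :=
    fun x i j hi hj => smul_mem _ _ (add_mem (H1 i hi) (smul_mem _ _ (H1 j hj)))
  have Hm : ∀ (x : ℂ) (i j : Idx k r m), i.par = 1 → j.par = 1 →
      x • (bas k r m i - I • bas k r m j) ∈ degSpan (bas k r m) Idx.par 1 :=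
    fun x i j hi hj => smul_mem _ _ (sub_mem (H1 i hi) (smul_mem _ _ (H1 j hj)))
  have Hp0 : ∀ (x : ℂ) (i j : Idx k r m), i.par = 0 → j.par = 0 →
      x • (bas k r m i + I • bas k r m j) ∈ degSpan (bas k r m) Idx.par 0 :=
    fun x i j hi hj => smul_mem _ _ (add_mem (H0 i hi) (smul_mem _ _ (H0 j hj)))
  have Hm0 : ∀ (x : ℂ) (i j : Idx k r m), i.par = 0 → j.par = 0 →
      x • (bas k r m i - I • bas k r m j) ∈ degSpan (bas k r m) Idx.par 0 :=
    fun x i j hi hj => smul_mem _ _ (sub_mem (H0 i hi) (smul_mem _ _ (H0 j hj)))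
  cases a <;> simp only [vec2, Idx2.par, pVec, qVec, yVec] <;>
    first
    | with_reducible refine H0 _ ?_
    | with_reducible refine H1 _ ?_
    | with_reducible refine Hp _ _ _ ?_ ?_
    | with_reducible refine Hm _ _ _ ?_ ?_
    | with_reducible refine Hp0 _ _ _ ?_ ?_
    | with_reducible refine Hm0 _ _ _ ?_ ?_
  all_goals simp only [Idx.par]

/-- The degrees of the grading `Γ₁^s`. -/
def deg1 {k r s t : ℕ} : Idx2 k r s t →
    ℤ × ZMod 4 × (Fin k → ZMod 2) × (Fin r → ZMod 2) × (Fin s → ℤ) × (Fin t → ZMod 2)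
  | .z => (2, 2, 0, 0, 0, 0)
  | .u => (0, 2, 0, 0, 0, 0)
  | .a i => (1, 0, Pi.single i 1, 0, 0, 0)
  | .a' i => (1, 2, Pi.single i 1, 0, 0, 0)
  | .c j => (1, 1, 0, Pi.single j 1, 0, 0)
  | .c' j => (1, 3, 0, Pi.single j 1, 0, 0)
  | .p i => (1, 1, 0, 0, Pi.single i 1, 0)
  | .q i => (1, 1, 0, 0, Pi.single i (-1), 0)
  | .y h => (1, 1, 0, 0, 0, Pi.single h 1)

/-- The degrees of the grading `Γ₂^s`. -/
def deg2 {k r s t : ℕ} : Idx2 k r s t →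
    ℤ × (Fin k → ℤ) × (Fin r → ℤ) × (Fin s → ℤ) × (Fin t → ZMod 2)
  | .z => (2, 0, 0, 0, 0)
  | .u => (0, 0, 0, 0, 0)
  | .a i => (1, Pi.single i 1, 0, 0, 0)
  | .a' i => (1, Pi.single i (-1), 0, 0, 0)
  | .c j => (1, 0, Pi.single j 1, 0, 0)
  | .c' j => (1, 0, Pi.single j (-1), 0, 0)
  | .p i => (1, 0, 0, Pi.single i 1, 0)
  | .q i => (1, 0, 0, Pi.single i (-1), 0)
  | .y h => (1, 0, 0, 0, Pi.single h 1)

theorem single_two {n : ℕ} (i : Fin n) :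
    (Pi.single i 1 + Pi.single i 1 : Fin n → ZMod 2) = 0 := by
  rw [← Pi.single_add]
  exact Pi.single_zero i

theorem single_cancel {n : ℕ} (i : Fin n) :
    (Pi.single i 1 + Pi.single i (-1) : Fin n → ℤ) = 0 := by
  rw [← Pi.single_add]
  exact Pi.single_zero i

theorem single_cancel' {n : ℕ} (i : Fin n) :
    (Pi.single i (-1) + Pi.single i 1 : Fin n → ℤ) = 0 := by
  rw [← Pi.single_add]
  exact Pi.single_zero i

theorem table1_mem (lam : Fin k → ℂˣ) (kap : Fin r → ℂˣ)
    (a b : Idx2 k r s (m - 2 * r - 2 * s)) :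
    (table1 lam kap a b : Space k r m) ∈ degSpan (basis1 (k := k) hs) deg1 (deg1 a + deg1 b) := by
  have f1 : (2 : ZMod 4) + 2 = 0 := rfl
  have f2 : (1 : ZMod 4) + 1 = 2 := rfl
  have f3 : (3 : ZMod 4) + 3 = 2 := rfl
  have f4 : (2 : ZMod 4) + 1 = 3 := rfl
  have f5 : (1 : ZMod 4) + 2 = 3 := rfl
  have f6 : (2 : ZMod 4) + 3 = 1 := rfl
  have f7 : (3 : ZMod 4) + 2 = 1 := rfl
  have f8 : (1 : ℤ) + 1 = 2 := rfl
  have Mz : ∀ g, deg1 .z = g → bas k r m .z ∈ degSpan (basis1 (k := k) hs) deg1 g :=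
    fun g h => vec1_mem hs deg1 .z h
  have Me : ∀ i g, deg1 (.a i) = g → bas k r m (.e i) ∈ degSpan (basis1 (k := k) hs) deg1 g :=
    fun i g h => vec1_mem hs deg1 (.a i) h
  have Me' : ∀ i g, deg1 (.a' i) = g → bas k r m (.e' i) ∈ degSpan (basis1 (k := k) hs) deg1 g :=
    fun i g h => vec1_mem hs deg1 (.a' i) h
  have Mw : ∀ i g, deg1 (.c i) = g → bas k r m (.w i) ∈ degSpan (basis1 (k := k) hs) deg1 g :=
    fun i g h => vec1_mem hs deg1 (.c i) h
  have Mw' : ∀ i g, deg1 (.c' i) = g → bas k r m (.w' i) ∈ degSpan (basis1 (k := k) hs) deg1 g :=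
    fun i g h => vec1_mem hs deg1 (.c' i) h
  cases a <;> cases b <;> simp only [table1] <;> (try split_ifs) <;> (try subst_vars) <;>
    (try exact zero_mem _) <;> (try refine smul_mem _ _ ?_) <;>
    first
    | with_reducible refine Mz _ ?_
    | with_reducible refine Me _ _ ?_
    | with_reducible refine Me' _ _ ?_
    | with_reducible refine Mw _ _ ?_
    | with_reducible refine Mw' _ _ ?_
  all_goals simp [deg1, single_two, single_cancel, single_cancel', f1, f2, f3, f4, f5, f6, f7, f8]

theorem table2_mem (lam : Fin k → ℂˣ) (kap : Fin r → ℂˣ)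
    (a b : Idx2 k r s (m - 2 * r - 2 * s)) :
    table2 hs lam kap a b ∈ degSpan (basis2 (k := k) hs) deg2 (deg2 a + deg2 b) := by
  have f8 : (1 : ℤ) + 1 = 2 := rfl
  have M := vec2_mem (k := k) hs deg2
  have Mz : ∀ g, deg2 .z = g → bas k r m .z ∈ degSpan (basis2 (k := k) hs) deg2 g :=
    fun g h => vec2_mem hs deg2 .z h
  cases a <;> cases b <;> simp only [table2] <;> (try split_ifs) <;> (try subst_vars) <;>
    (try exact zero_mem _) <;> (try refine smul_mem _ _ ?_) <;>
    first
    | with_reducible refine Mz _ ?_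
    | with_reducible refine M _ ?_
  all_goals simp [deg2, single_two, single_cancel, single_cancel', f8]

/-- The grading `Γ₁^s`. -/
def gamma1 (lam : Fin k → ℂˣ) (kap : Fin r → ℂˣ) : Grading (heis k r m lam kap)
    (ℤ × ZMod 4 × (Fin k → ZMod 2) × (Fin r → ZMod 2) × (Fin s → ℤ) ×
      (Fin (m - 2 * r - 2 * s) → ZMod 2)) :=
  Grading.ofBasis (basis1 hs) deg1
    (fun a => ⟨a.par, by rw [basis1_apply]; exact vec1_par hs a⟩)
    (fun a b => by
      rw [basis1_apply, basis1_apply]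
      exact (bracket_vec1 hs lam kap a b).symm ▸ table1_mem hs lam kap a b)

/-- The grading `Γ₂^s`. -/
def gamma2 (lam : Fin k → ℂˣ) (kap : Fin r → ℂˣ) : Grading (heis k r m lam kap)
    (ℤ × (Fin k → ℤ) × (Fin r → ℤ) × (Fin s → ℤ) × (Fin (m - 2 * r - 2 * s) → ZMod 2)) :=
  Grading.ofBasis (basis2 hs) deg2
    (fun a => ⟨a.par, by rw [basis2_apply]; exact vec2_par hs a⟩)
    (fun a b => by
      rw [basis2_apply, basis2_apply]
      exact (bracket_vec2 hs lam kap a b).symm ▸ table2_mem hs lam kap a b)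

end Bases

/-! ### The abstract form of the Weyl groups -/

/-- The action of `S_s × S_t` on `Z_2^{d+s} = Z_2^d × Z_2^s`: the factor `S_s` permutes the last
`s` coordinates, the factor `S_t` acts trivially. -/
def permHom (d s t : ℕ) : Equiv.Perm (Fin s) × Equiv.Perm (Fin t) →*
    MulAut (Fin d ⊕ Fin s → Multiplicative (ZMod 2)) :=
  (mulAutArrow (G := Equiv.Perm (Fin d ⊕ Fin s)) (A := Fin d ⊕ Fin s)
      (M := Multiplicative (ZMod 2))).comp
    ((Equiv.Perm.sumCongrHom (Fin d) (Fin s)).comp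
      ((MonoidHom.inr (Equiv.Perm (Fin d)) (Equiv.Perm (Fin s))).comp
        (MonoidHom.fst (Equiv.Perm (Fin s)) (Equiv.Perm (Fin t)))))

/-- The semidirect product `Z_2^{d+s} ⋊ (S_s × S_t)`. -/
abbrev SignedPerm (d s t : ℕ) : Type :=
  (Fin d ⊕ Fin s → Multiplicative (ZMod 2)) ⋊[permHom d s t]
    (Equiv.Perm (Fin s) × Equiv.Perm (Fin t))

end TwistedHeisenberg

end

noncomputable section

namespace TwistedHeisenberg

open Complex Submodule

/-! ### Gradings of an arbitrary superalgebra: projections, components, equivalences. -/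

section

variable {A : Type*} [AddCommGroup A] [Module ℂ A]

namespace Grading

variable {S : Superalgebra A} {G H K : Type*} [AddCommGroup G] [AddCommGroup H] [AddCommGroup K]

/-! Everything depends on how `u` sits in a grading `Γ`. Some homogeneous even element has
`u`-coordinate 1 (`exists_homogeneous_u`), and an automorphism carries `u` to it (`exists_aut_u`),
so one may assume `u` homogeneous, of degree `d`. Then `ad u` is homogeneous of degree `d`, and its
square is diagonal in the defining basis with eigenvalues `-λ_i²`, `-κ_j²` and 0. As the support is
finite, `2d` has some finite order `N` (`exists_nsmul_eq_zero`), so `(ad u)^(2N)` commutes with the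
projections of `Γ`. Since ratios of frequencies are not roots of unity, its nonzero eigenvalues
still separate the planes `⟨e_i, ê_i⟩` from one another, and likewise the planes `⟨w_j, ŵ_j⟩`; with
parity this makes each plane graded (`proj_eq_pair`). If `d = 0`, the two eigenvectors of `ad u` in
a plane are homogeneous; if `d ≠ 0`, a homogeneous vector and its image under `ad u` form, after
scaling, a rotated copy of the standard basis. The span of the `η_t` is the odd part of the kernel
of `ad u`, and its bilinear form splits homogeneously into hyperbolic pairs and orthonormal vectors
(`exists_hyperbolicSystem`). Thus every grading is a coarsening of an automorphic image of some
`Γ₁^s` or `Γ₂^s`; these have one-dimensional components, hence are fine, and `isFine_iff` follows.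

An equivalence between listed gradings is an automorphism permuting the basis lines. It fixes the
labels `z` and `u`, say `u ↦ c u`. Comparing eigenvalues of `(ad u)²` along an orbit in the finite
set of pairs shows that `c²` is a root of unity; the hypothesis then forces `c² = 1` and every pair
to be preserved (`pair_rigidity`). The other labels are permuted compatibly with the duality `p ↔
q`, so the number of self-dual labels `y` is an invariant, which determines `s`. The two families
differ because `ad u` exchanges the lines of a pair in `Γ₁^s` and preserves them in `Γ₂^s`. For the
same reason the pairs flip independently in `Γ₁^s`, by quarter turns, and only all together in
`Γ₂^s`, when `c = -1`; this gives the two Weyl groups.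

For torality, every element of a torus has a square root commuting with the torus
(`IsTorus.exists_sq`). A suitable diagonal automorphism of `Γ₁^s`, or of `Γ₂^s` with at least two
labels `y`, has no such root in the automorphism group. With at most one `y`, the relations among
diagonal scalars of `Γ₂^s` are solved by free parameters, which exhibits a torus. -/

open Classical in
theorem isInternal (Γ : Grading S G) :
    Function.Bijective (DirectSum.coeLinearMap Γ.comp) :=
  DirectSum.isInternal_submodule_of_iSupIndep_of_iSup_eq_top Γ.indep Γ.iSup_eq_top

open Classical in
/-- The projection of the algebra onto a homogeneous component. -/
def proj (Γ : Grading S G) (g : G) : A →ₗ[ℂ] A :=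
  (Γ.comp g).subtype ∘ₗ DirectSum.component ℂ G (fun g => Γ.comp g) g ∘ₗ
    ((LinearEquiv.ofBijective (DirectSum.coeLinearMap Γ.comp) Γ.isInternal).symm :
      A →ₗ[ℂ] DirectSum G fun g => Γ.comp g)

theorem proj_mem (Γ : Grading S G) (g : G) (x : A) : Γ.proj g x ∈ Γ.comp g :=
  Subtype.property _

open Classical in
theorem ofBijective_symm_of_mem (Γ : Grading S G) {g : G} {x : A} (hx : x ∈ Γ.comp g) :
    (LinearEquiv.ofBijective (DirectSum.coeLinearMap Γ.comp) Γ.isInternal).symm x =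
      DirectSum.lof ℂ G (fun g => Γ.comp g) g ⟨x, hx⟩ := by
  rw [LinearEquiv.symm_apply_eq, LinearEquiv.ofBijective_apply, DirectSum.coeLinearMap_lof]

theorem proj_of_mem (Γ : Grading S G) {g : G} {x : A} (hx : x ∈ Γ.comp g) : Γ.proj g x = x := by
  classical
  simp only [proj, LinearMap.comp_apply, LinearEquiv.coe_coe, Γ.ofBijective_symm_of_mem hx,
    DirectSum.component.lof_self, Submodule.subtype_apply]

theorem proj_of_mem_ne (Γ : Grading S G) {g h : G} {x : A} (hx : x ∈ Γ.comp h) (hgh : h ≠ g) :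
    Γ.proj g x = 0 := by
  classical
  simp only [proj, LinearMap.comp_apply, LinearEquiv.coe_coe, Γ.ofBijective_symm_of_mem hx]
  rw [DirectSum.component.of, dif_neg hgh]
  simp

theorem mem_induction (Γ : Grading S G) {p : A → Prop} (h : ∀ g, ∀ x ∈ Γ.comp g, p x)
    (h0 : p 0) (hadd : ∀ x y, p x → p y → p (x + y)) (x : A) : p x :=
  Submodule.iSup_induction Γ.comp (motive := p) (by rw [Γ.iSup_eq_top]; trivial) h h0 hadd

/-- Asking for all larger finite sets makes the claim additive, by taking unions, without any
finiteness of the support. -/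
theorem exists_sum_proj (Γ : Grading S G) (x : A) :
    ∃ F : Finset G, ∀ F' : Finset G, F ⊆ F' → ∑ g ∈ F', Γ.proj g x = x := by
  classical
  refine Γ.mem_induction (p := fun x => ∃ F : Finset G, ∀ F' : Finset G, F ⊆ F' →
    ∑ g ∈ F', Γ.proj g x = x) (fun g x hx => ⟨{g}, fun F' hF => ?_⟩)
    ⟨∅, fun F' _ => by simp⟩ ?_ x
  · rw [Finset.sum_eq_single g, Γ.proj_of_mem hx]
    · intro h _ hh
      exact Γ.proj_of_mem_ne hx hh.symm
    · intro h
      exact absurd (hF (Finset.mem_singleton_self g)) h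
  · rintro x y ⟨F, hF⟩ ⟨F', hF'⟩
    refine ⟨F ∪ F', fun F'' h => ?_⟩
    simp only [map_add, Finset.sum_add_distrib]
    rw [hF _ (Finset.union_subset_left h), hF' _ (Finset.union_subset_right h)]

theorem exists_map_proj_ne_zero (Γ : Grading S G) {M : Type*} [AddCommGroup M] [Module ℂ M]
    (f : A →ₗ[ℂ] M) {x : A} (hx : f x ≠ 0) : ∃ g, f (Γ.proj g x) ≠ 0 := by
  by_contra! h
  obtain ⟨F, hF⟩ := Γ.exists_sum_proj x
  apply hx
  rw [← hF F subset_rfl, map_sum]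
  exact Finset.sum_eq_zero fun g _ => h g

theorem eq_of_mem_of_mem (Γ : Grading S G) {g h : G} {x : A} (hx : x ≠ 0) (hg : x ∈ Γ.comp g)
    (hh : x ∈ Γ.comp h) : g = h := by
  by_contra hne
  exact hx ((Γ.proj_of_mem hh).symm.trans (Γ.proj_of_mem_ne hg hne))

/-- The main tool for showing that kernels and eigenspaces of homogeneous operators are graded
subspaces. -/
theorem map_proj (Γ : Grading S G) {f : A →ₗ[ℂ] A} {d : G}
    (hf : ∀ g, ∀ x ∈ Γ.comp g, f x ∈ Γ.comp (g + d)) (g : G) (x : A) :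
    f (Γ.proj g x) = Γ.proj (g + d) (f x) := by
  refine Γ.mem_induction (p := fun x => f (Γ.proj g x) = Γ.proj (g + d) (f x)) ?_ (by simp) ?_ x
  · intro h x hx
    by_cases hh : h = g
    · subst hh
      rw [Γ.proj_of_mem hx, Γ.proj_of_mem (hf _ _ hx)]
    · rw [Γ.proj_of_mem_ne hx hh, Γ.proj_of_mem_ne (hf _ _ hx) (by simpa using hh), map_zero]
  · intro x y hx hy
    simp only [map_add, hx, hy]

/-- The grading of a superalgebra by parity. -/
def ofParity (S : Superalgebra A) : Grading S (ZMod 2) where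
  comp := S.parity
  indep := S.parity_indep
  iSup_eq_top := S.parity_iSup
  super g := le_antisymm (le_iSup_of_le g (le_inf le_rfl le_rfl)) (iSup_le fun _ => inf_le_left)
  mul_mem := S.mul_mem

/-- Components are `ZMod 2`-graded, so the parity projection preserves each of them and therefore
commutes with `Γ.proj g`. -/
theorem proj_mem_parity (Γ : Grading S G) {i : ZMod 2} {x : A} (hx : x ∈ S.parity i) (g : G) :
    Γ.proj g x ∈ S.parity i := by
  have key : ∀ g, ∀ x ∈ Γ.comp g, (ofParity S).proj i x ∈ Γ.comp (g + 0) := by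
    intro g x hx
    rw [add_zero]
    rw [Γ.super g] at hx
    refine Submodule.iSup_induction _ (motive := fun x => (ofParity S).proj i x ∈ Γ.comp g) hx
      ?_ (by simp) ?_
    · rintro j y ⟨hy, hyj⟩
      by_cases hij : j = i
      · subst hij
        rwa [(ofParity S).proj_of_mem hyj]
      · rw [(ofParity S).proj_of_mem_ne hyj hij]
        exact zero_mem _
    · intro x y hx hy
      rw [map_add]
      exact add_mem hx hy
  have h := Γ.map_proj key g x
  rw [(ofParity S).proj_of_mem hx, add_zero] at h
  rw [← h]
  exact (ofParity S).proj_mem i _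

/-- Some projection of `x` is nonzero, and it is a nonzero multiple of `x`. -/
theorem exists_mem_of_proj_mem_span (Γ : Grading S G) {x : A} (hx : x ≠ 0)
    (h : ∀ g, Γ.proj g x ∈ span ℂ {x}) : ∃ g, x ∈ Γ.comp g := by
  obtain ⟨g, hg⟩ := Γ.exists_map_proj_ne_zero LinearMap.id hx
  refine ⟨g, ?_⟩
  obtain ⟨c, hc⟩ := mem_span_singleton.1 (h g)
  have hc0 : c ≠ 0 := by
    rintro rfl
    apply hg
    rw [LinearMap.id_apply, ← hc, zero_smul]
  have := Γ.proj_mem g x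
  rw [← hc] at this
  exact ((Γ.comp g).smul_mem_iff hc0).1 this

theorem mul_mem' (Γ : Grading S G) {g h k : G} {x y : A} (hx : x ∈ Γ.comp g) (hy : y ∈ Γ.comp h)
    (hk : g + h = k) : S.mul x y ∈ Γ.comp k :=
  hk ▸ Γ.mul_mem g h x y hx hy

/-- The image of a grading under an automorphism. -/
def transport (Γ : Grading S G) (φ : A ≃ₗ[ℂ] A) (hφ : φ ∈ S.aut) : Grading S G where
  comp g := (Γ.comp g).map (φ : A →ₗ[ℂ] A)
  indep := Γ.indep.map_orderIso (Submodule.orderIsoMapComap φ)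
  iSup_eq_top := by
    rw [← Submodule.map_iSup, Γ.iSup_eq_top, Submodule.map_top, LinearEquiv.range]
  super g := by
    conv_lhs => rw [Γ.super g, Submodule.map_iSup]
    refine iSup_congr fun i => ?_
    rw [Submodule.map_inf _ φ.injective, hφ.2 i]
  mul_mem := by
    rintro g h _ _ ⟨x, hx, rfl⟩ ⟨y, hy, rfl⟩
    exact ⟨S.mul x y, Γ.mul_mem g h x y hx hy, hφ.1 x y⟩

/-- A grading, with its group lifted to a larger universe. -/
def ulift (Γ : Grading S G) : Grading S (ULift.{u} G) where
  comp g := Γ.comp g.down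
  indep := Γ.indep.comp ULift.down_injective
  iSup_eq_top := by rw [← Γ.iSup_eq_top]; exact Equiv.ulift.iSup_comp (g := Γ.comp)
  super g := Γ.super g.down
  mul_mem g h := Γ.mul_mem g.down h.down

theorem components_ulift (Γ : Grading S G) : (ulift.{u} Γ).components = Γ.components := by
  ext C
  constructor
  · rintro ⟨g, hg, rfl⟩
    exact ⟨g.down, hg, rfl⟩
  · rintro ⟨g, hg, rfl⟩
    exact ⟨⟨g⟩, hg, rfl⟩

theorem components_transport (Γ : Grading S G) (φ : A ≃ₗ[ℂ] A) (hφ : φ ∈ S.aut) :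
    (Γ.transport φ hφ).components = Submodule.map (φ : A →ₗ[ℂ] A) '' Γ.components := by
  have h : (Γ.transport φ hφ).support = Γ.support := by
    ext g
    simp only [support, transport, Set.mem_ofPred_eq, ne_eq, Submodule.map_eq_bot_iff]
  rw [components, components, h, Set.image_image]
  rfl

theorem comp_injOn (Γ : Grading S G) : Set.InjOn Γ.comp Γ.support := by
  intro g hg h _ e
  obtain ⟨x, hx, hx0⟩ := (Submodule.ne_bot_iff _).1 hg
  exact Γ.eq_of_mem_of_mem hx0 hx (e ▸ hx)

/-- The support of a grading is in bijection with its set of components. -/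
def supportEquiv (Γ : Grading S G) : Γ.support ≃ Γ.components :=
  Equiv.Set.imageOfInjOn _ _ Γ.comp_injOn

theorem comp_supportEquiv_symm (Γ : Grading S G) (C : Γ.components) :
    Γ.comp (Γ.supportEquiv.symm C) = C :=
  congrArg Subtype.val (Γ.supportEquiv.apply_symm_apply C)

/-- A nonzero component determines its degree, so the bijection of supports can be recovered from
the sets of components, and the grading groups play no role. -/
theorem isEquivalence_iff (Γ : Grading S G) (Γ' : Grading S H) (φ : A ≃ₗ[ℂ] A) :
    Γ.IsEquivalence Γ' φ ↔
      φ ∈ S.aut ∧ Submodule.map (φ : A →ₗ[ℂ] A) '' Γ.components = Γ'.components := by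
  refine and_congr_right fun hφ => ⟨?_, fun h => ?_⟩
  · rintro ⟨σ, hσ⟩
    ext C
    constructor
    · rintro ⟨_, ⟨g, hg, rfl⟩, rfl⟩
      rw [hσ ⟨g, hg⟩]
      exact ⟨_, (σ _).2, rfl⟩
    · rintro ⟨g, hg, rfl⟩
      obtain ⟨a, ha⟩ := σ.surjective ⟨g, hg⟩
      refine ⟨_, ⟨a, a.2, rfl⟩, ?_⟩
      rw [hσ, ha]
  · have hinj : Function.Injective (Submodule.map (φ : A →ₗ[ℂ] A)) :=
      Submodule.map_injective_of_injective φ.injective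
    refine ⟨(Γ.supportEquiv.trans ((Equiv.Set.image _ Γ.components hinj).trans
      (Equiv.setCongr h))).trans Γ'.supportEquiv.symm, fun g => ?_⟩
    rw [Equiv.trans_apply, comp_supportEquiv_symm]
    rfl

theorem Equivalent.symm {Γ : Grading S G} {Γ' : Grading S H} (h : Γ.Equivalent Γ') :
    Γ'.Equivalent Γ :=
  let ⟨_, hφ⟩ := h
  ⟨_, hφ.inv⟩

theorem Equivalent.trans {Γ : Grading S G} {Γ' : Grading S H} {Γ'' : Grading S K}
    (h : Γ.Equivalent Γ') (h' : Γ'.Equivalent Γ'') : Γ.Equivalent Γ'' :=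
  let ⟨_, hφ⟩ := h
  let ⟨_, hψ⟩ := h'
  ⟨_, hψ.mul hφ⟩

theorem equivalent_of_components_eq {Γ : Grading S G} {Γ' : Grading S H}
    (h : Γ.components = Γ'.components) : Γ.Equivalent Γ' :=
  ⟨1, (isEquivalence_iff _ _ _).2 ⟨S.aut.one_mem, by
    rw [← h]
    convert Set.image_id _
    funext C
    exact Submodule.map_id C⟩⟩

/-- A grading whose components are atoms, i.e. one-dimensional, is fine. -/
theorem isFine_of_isAtom {G : Type u} [AddCommGroup G] (Γ : Grading S G)
    (h : ∀ C ∈ Γ.components, IsAtom C) : Γ.IsFine := by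
  intro H _ Γ' href
  choose T hT using href
  have hle : ∀ g, ∀ h ∈ T g, Γ'.comp h ≤ Γ.comp g := by
    intro g h hh
    rw [hT g]
    exact le_iSup₂_of_le h hh le_rfl
  have heq : ∀ g, ∀ h ∈ T g, Γ'.comp h ≠ ⊥ → Γ'.comp h = Γ.comp g := by
    intro g k hk hne
    have hg : Γ.comp g ≠ ⊥ := fun e => hne (le_bot_iff.1 (e ▸ hle g k hk))
    exact ((h _ ⟨g, hg, rfl⟩).le_iff.1 (hle g k hk)).resolve_left hne
  ext C
  constructor
  · rintro ⟨k, hk, rfl⟩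
    have : ∃ g, k ∈ T g := by
      -- Otherwise the components other than the `k`-th already span everything, and independence
      -- makes the `k`-th one zero.
      by_contra! hcon
      have h1 : (⊤ : Submodule ℂ A) ≤ ⨆ j, ⨆ (_ : j ≠ k), Γ'.comp j := by
        rw [← Γ.iSup_eq_top]
        refine iSup_le fun g => ?_
        rw [hT g]
        refine iSup₂_le fun j hj => le_iSup₂_of_le j ?_ le_rfl
        rintro rfl
        exact hcon g hj
      have h2 := Γ'.indep k
      rw [top_le_iff.1 h1, disjoint_top] at h2
      exact hk h2
    obtain ⟨g, hg⟩ := this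
    have e := heq g k hg hk
    rw [e]
    exact ⟨g, by rw [support, Set.mem_ofPred_eq, ← e]; exact hk, rfl⟩
  · rintro ⟨g, hg, rfl⟩
    have : ∃ k ∈ T g, Γ'.comp k ≠ ⊥ := by
      by_contra! hcon
      apply hg
      rw [hT g]
      exact le_bot_iff.1 (iSup₂_le fun j hj => (hcon j hj).le)
    obtain ⟨k, hk, hne⟩ := this
    exact ⟨k, hne, heq g k hk hne⟩

theorem isAtom_of_equivalent {Γ : Grading S G} {Γ' : Grading S H} (h : Γ.Equivalent Γ')
    (hΓ : ∀ C ∈ Γ.components, IsAtom C) : ∀ C ∈ Γ'.components, IsAtom C := by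
  obtain ⟨φ, hφ⟩ := h
  rw [isEquivalence_iff] at hφ
  rw [← hφ.2]
  rintro _ ⟨C, hC, rfl⟩
  exact ((Submodule.orderIsoMapComap φ).isAtom_iff C).2 (hΓ C hC)

/-! ### Gradings with one-dimensional components -/

/-- The components are the lines spanned by the elements of the basis `b`. -/
def IsLineGrading (Γ : Grading S G) {ι : Type*} (b : Module.Basis ι ℂ A) : Prop :=
  Γ.components = Set.range fun a => span ℂ {b a}

theorem isLineGrading_ofBasis {ι : Type*} (b : Module.Basis ι ℂ A)
    (deg : ι → G) (hpar : ∀ i, ∃ p, b i ∈ S.parity p)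
    (hmul : ∀ i j, S.mul (b i) (b j) ∈ degSpan b deg (deg i + deg j))
    (hdeg : Function.Injective deg) : (Grading.ofBasis b deg hpar hmul).IsLineGrading b := by
  have key : ∀ a, degSpan b deg (deg a) = span ℂ {b a} := by
    intro a
    have : {i | deg i = deg a} = {a} := by
      ext i
      exact hdeg.eq_iff
    rw [degSpan, this, Set.image_singleton]
  ext C
  constructor
  · rintro ⟨g, hg, rfl⟩
    have : ∃ a, deg a = g := by
      by_contra! hcon
      apply hg
      have : {i | deg i = g} = ∅ := by
        ext i
        simp [hcon i]
      change degSpan b deg g = ⊥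
      rw [degSpan, this, Set.image_empty, span_empty]
    obtain ⟨a, rfl⟩ := this
    exact ⟨a, (key a).symm⟩
  · rintro ⟨a, rfl⟩
    refine ⟨deg a, ?_, key a⟩
    change degSpan b deg (deg a) ≠ ⊥
    rw [key a, Ne, span_singleton_eq_bot]
    exact b.ne_zero a

theorem IsLineGrading.isAtom {Γ : Grading S G} {ι : Type*} {b : Module.Basis ι ℂ A}
    (h : Γ.IsLineGrading b) : ∀ C ∈ Γ.components, IsAtom C := by
  rw [h]
  rintro _ ⟨a, rfl⟩
  exact nonzero_span_atom _ (b.ne_zero a)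

theorem span_basis_injective {ι : Type*} (b : Module.Basis ι ℂ A) :
    Function.Injective fun a => span ℂ {b a} := by
  intro a a' h
  have h' : b a ∈ span ℂ {b a'} := (show span ℂ {b a} = span ℂ {b a'} from h) ▸ mem_span_singleton_self _
  obtain ⟨c, hc⟩ := mem_span_singleton.1 h'
  by_contra hne
  have := congrArg (fun x => b.repr x a) hc
  simp [Ne.symm hne] at this

/-- Equivalences become monomial maps between the bases, so classifying them amounts to finding the
possible relabellings `σ`. -/
theorem IsLineGrading.isEquivalence_iff {Γ : Grading S G} {Γ' : Grading S H} {ι ι' : Type*}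
    {b : Module.Basis ι ℂ A} {b' : Module.Basis ι' ℂ A} (h : Γ.IsLineGrading b)
    (h' : Γ'.IsLineGrading b') (φ : A ≃ₗ[ℂ] A) :
    Γ.IsEquivalence Γ' φ ↔
      φ ∈ S.aut ∧ ∃ σ : ι ≃ ι', ∀ a, ∃ c : ℂ, c ≠ 0 ∧ φ (b a) = c • b' (σ a) := by
  rw [Grading.isEquivalence_iff, h, h']
  refine and_congr_right fun hφ => ?_
  have hmap : ∀ a, (span ℂ {b a}).map (φ : A →ₗ[ℂ] A) = span ℂ {φ (b a)} := by
    intro a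
    rw [Submodule.map_span, Set.image_singleton, LinearEquiv.coe_coe]
  rw [← Set.range_comp]
  constructor
  · intro e
    have e1 : ∀ a, ∃ a', span ℂ {b' a'} = span ℂ {φ (b a)} := by
      intro a
      have : span ℂ {φ (b a)} ∈ Set.range fun a => span ℂ {b' a} := by
        rw [← e, ← hmap]
        exact ⟨a, rfl⟩
      exact this
    choose σ hσ using e1
    have hinj : Function.Injective σ := by
      intro a a' haa
      apply span_basis_injective b
      apply Submodule.map_injective_of_injective (f := (φ : A →ₗ[ℂ] A)) φ.injective
      simp only [hmap, ← hσ, haa]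
    have hsurj : Function.Surjective σ := by
      intro a'
      have : span ℂ {b' a'} ∈ Set.range fun a => span ℂ {b' a} := ⟨a', rfl⟩
      rw [← e] at this
      obtain ⟨a, ha⟩ := this
      refine ⟨a, span_basis_injective b' ?_⟩
      simp only [Function.comp_apply, hmap] at ha
      simp only [hσ, ha]
    refine ⟨Equiv.ofBijective σ ⟨hinj, hsurj⟩, fun a => ?_⟩
    have : φ (b a) ∈ span ℂ {b' (σ a)} := hσ a ▸ mem_span_singleton_self _
    obtain ⟨c, hc⟩ := mem_span_singleton.1 this
    refine ⟨c, ?_, hc.symm⟩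
    rintro rfl
    rw [zero_smul] at hc
    exact b.ne_zero a (φ.map_eq_zero_iff.1 hc.symm)
  · rintro ⟨σ, hσ⟩
    have : (Submodule.map (φ : A →ₗ[ℂ] A) ∘ fun a => span ℂ {b a}) =
        (fun a => span ℂ {b' a}) ∘ σ := by
      funext a
      obtain ⟨c, hc, hc'⟩ := hσ a
      simp only [Function.comp_apply, hmap, hc']
      exact span_singleton_smul_eq hc.isUnit _
    rw [this, σ.surjective.range_comp]

theorem index_unique {ι : Type*} {b : Module.Basis ι ℂ A} {c c' : ℂ} {a a' : ι} (hc : c ≠ 0)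
    (h : c • b a = c' • b a') : a = a' := by
  by_contra hne
  have := congrArg (fun x => b.repr x a) h
  simp [Ne.symm hne, hc] at this

section Perm

variable {Γ : Grading S G} {ι : Type*} {b : Module.Basis ι ℂ A}

/-- The permutation of the components induced by a self-equivalence, as a function. -/
def IsLineGrading.permFun (h : Γ.IsLineGrading b) (φ : Γ.aut) : ι → ι :=
  (((h.isEquivalence_iff h (φ : A ≃ₗ[ℂ] A)).1 φ.2).2.choose : ι → ι)

theorem IsLineGrading.permFun_spec (h : Γ.IsLineGrading b) (φ : Γ.aut) (a : ι) :
    ∃ c : ℂ, c ≠ 0 ∧ (φ : A ≃ₗ[ℂ] A) (b a) = c • b (h.permFun φ a) :=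
  ((h.isEquivalence_iff h (φ : A ≃ₗ[ℂ] A)).1 φ.2).2.choose_spec a

theorem IsLineGrading.permFun_eq (h : Γ.IsLineGrading b) (φ : Γ.aut) {a a' : ι} {c : ℂ}
    (e : (φ : A ≃ₗ[ℂ] A) (b a) = c • b a') : h.permFun φ a = a' := by
  obtain ⟨c', hc', e'⟩ := h.permFun_spec φ a
  exact index_unique hc' (e'.symm.trans e)

/-- The action of the self-equivalences on the components. -/
def IsLineGrading.perm (h : Γ.IsLineGrading b) : Γ.aut →* Equiv.Perm ι :=
  MonoidHom.toHomPerm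
    { toFun := h.permFun
      map_one' := by
        funext a
        exact h.permFun_eq (c := 1) 1 (one_smul ℂ _).symm
      map_mul' := by
        intro φ ψ
        funext a
        obtain ⟨c, hc, e⟩ := h.permFun_spec ψ a
        obtain ⟨c', hc', e'⟩ := h.permFun_spec φ (h.permFun ψ a)
        refine h.permFun_eq (c := c * c') (φ * ψ) ?_
        change (φ : A ≃ₗ[ℂ] A) ((ψ : A ≃ₗ[ℂ] A) (b a)) = _
        rw [e, map_smul, e', smul_smul]
        rfl }

theorem IsLineGrading.perm_spec (h : Γ.IsLineGrading b) (φ : Γ.aut) (a : ι) :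
    ∃ c : ℂ, c ≠ 0 ∧ (φ : A ≃ₗ[ℂ] A) (b a) = c • b (h.perm φ a) :=
  h.permFun_spec φ a

theorem IsLineGrading.perm_eq (h : Γ.IsLineGrading b) (φ : Γ.aut) {a a' : ι} {c : ℂ}
    (e : (φ : A ≃ₗ[ℂ] A) (b a) = c • b a') : h.perm φ a = a' :=
  h.permFun_eq φ e

/-- Hence the Weyl group is the group of permutations of labels realised by self-equivalences. -/
theorem IsLineGrading.ker_perm (h : Γ.IsLineGrading b) : h.perm.ker = Γ.stab := by
  have hmap : ∀ (φ : Γ.aut) a, (span ℂ {b a}).map ((φ : A ≃ₗ[ℂ] A) : A →ₗ[ℂ] A) =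
      span ℂ {b (h.perm φ a)} := by
    intro φ a
    obtain ⟨c, hc, e⟩ := h.perm_spec φ a
    rw [Submodule.map_span, Set.image_singleton, LinearEquiv.coe_coe, e]
    exact span_singleton_smul_eq hc.isUnit _
  ext φ
  rw [MonoidHom.mem_ker]
  constructor
  · intro hφ g
    by_cases hg : Γ.comp g = ⊥
    · rw [hg, Submodule.map_bot]
    · have : Γ.comp g ∈ Γ.components := ⟨g, hg, rfl⟩
      rw [h] at this
      obtain ⟨a, ha⟩ := this
      rw [← ha]
      simp only
      rw [hmap, hφ]
      rfl
  · intro hφ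
    ext a
    have : span ℂ {b a} ∈ Γ.components := by
      rw [h]
      exact ⟨a, rfl⟩
    obtain ⟨g, -, hg⟩ := this
    have e := hφ g
    rw [hg, hmap] at e
    exact span_basis_injective b e

/-- The Weyl group of a grading into lines is the group of induced permutations. -/
def IsLineGrading.weylEquiv (h : Γ.IsLineGrading b) {W : Type*} [Group W]
    (R : W →* Equiv.Perm ι) (hR : Function.Injective R) (hrange : h.perm.range = R.range) :
    Γ.WeylGroup ≃* W :=
  ((QuotientGroup.quotientMulEquivOfEq h.ker_perm.symm).trans
    (QuotientGroup.quotientKerEquivRange h.perm)).trans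
    ((MulEquiv.subgroupCongr hrange).trans (MonoidHom.ofInjective hR).symm)

end Perm

end Grading

end

/-! ### Refinement by a homogeneous basis, the bracket in coordinates, construction of
automorphisms. -/

section

variable {A : Type*} [AddCommGroup A] [Module ℂ A]

/-- When the basis is homogeneous for `Γ`, the projection to degree `g` keeps the basis vectors of
degree `g` and kills the others, so `Γ.comp g` is spanned by the lines it contains. -/
theorem Grading.refines_of_basis {S : Superalgebra A} {G H : Type*} [AddCommGroup G]
    [AddCommGroup H] {Γ : Grading S G} {Γ' : Grading S H} {ι : Type*} {b : Module.Basis ι ℂ A}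
    (h : Γ'.IsLineGrading b) (hb : ∀ a, ∃ g, b a ∈ Γ.comp g) : Γ'.Refines Γ := by
  intro g
  refine ⟨{j | Γ'.comp j ≤ Γ.comp g}, le_antisymm ?_ (iSup₂_le fun j hj => hj)⟩
  have key : ∀ y, Γ.proj g y ∈ ⨆ j ∈ {j | Γ'.comp j ≤ Γ.comp g}, Γ'.comp j := by
    intro y
    refine span_induction (p := fun y _ => Γ.proj g y ∈
      ⨆ j ∈ {j | Γ'.comp j ≤ Γ.comp g}, Γ'.comp j) ?_ (by simp) ?_ ?_ (b.mem_span y)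
    · rintro _ ⟨a, rfl⟩
      obtain ⟨g', hg'⟩ := hb a
      by_cases e : g' = g
      · subst e
        rw [Γ.proj_of_mem hg']
        have : span ℂ {b a} ∈ Γ'.components := by
          rw [h]
          exact ⟨a, rfl⟩
        obtain ⟨j, -, hj⟩ := this
        refine mem_iSup_of_mem j (mem_iSup_of_mem ?_ ?_)
        · change Γ'.comp j ≤ Γ.comp g'
          rw [hj, span_singleton_le_iff_mem]
          exact hg'
        · rw [hj]
          exact mem_span_singleton_self _
      · rw [Γ.proj_of_mem_ne hg' e]
        exact zero_mem _
    · intro x y _ _ hx hy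
      rw [map_add]
      exact add_mem hx hy
    · intro c x _ hx
      rw [map_smul]
      exact smul_mem _ _ hx
  intro x hx
  rw [← Γ.proj_of_mem hx]
  exact key x

variable {k r m : ℕ}

theorem bas_apply (a b : Idx k r m) : bas k r m a b = if b = a then 1 else 0 := by
  rw [Pi.basisFun_apply, Pi.single_apply]

/-- The bracket in coordinates. -/
def coordBracket (lam : Fin k → ℂˣ) (kap : Fin r → ℂˣ) (x y : Space k r m) : Space k r m
  | .z => ∑ i, (lam i : ℂ) * (x (.e i) * y (.e' i) - x (.e' i) * y (.e i)) +
      ∑ j, (x (.w j) * y (.w j) + x (.w' j) * y (.w' j)) + ∑ t, x (.eta t) * y (.eta t)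
  | .u => 0
  | .e i => (lam i : ℂ) * (x (.e' i) * y .u - x .u * y (.e' i))
  | .e' i => (lam i : ℂ) * (x .u * y (.e i) - x (.e i) * y .u)
  | .w i => (kap i : ℂ) * (x (.w' i) * y .u - x .u * y (.w' i))
  | .w' i => (kap i : ℂ) * (x .u * y (.w i) - x (.w i) * y .u)
  | .eta _ => 0

theorem coordBracket_add_left (lam : Fin k → ℂˣ) (kap : Fin r → ℂˣ) (x x' y : Space k r m) :
    coordBracket lam kap (x + x') y = coordBracket lam kap x y + coordBracket lam kap x' y := by
  funext c
  cases c <;> simp only [coordBracket, Pi.add_apply]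
  case z =>
    rw [add_add_add_comm, add_add_add_comm (∑ i, _), ← Finset.sum_add_distrib,
      ← Finset.sum_add_distrib, ← Finset.sum_add_distrib]
    congr 1
    · congr 1 <;> exact Finset.sum_congr rfl fun i _ => by ring
    · exact Finset.sum_congr rfl fun i _ => by ring
  all_goals ring

theorem coordBracket_add_right (lam : Fin k → ℂˣ) (kap : Fin r → ℂˣ) (x y y' : Space k r m) :
    coordBracket lam kap x (y + y') = coordBracket lam kap x y + coordBracket lam kap x y' := by
  funext c
  cases c <;> simp only [coordBracket, Pi.add_apply]
  case z =>
    rw [add_add_add_comm, add_add_add_comm (∑ i, _), ← Finset.sum_add_distrib,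
      ← Finset.sum_add_distrib, ← Finset.sum_add_distrib]
    congr 1
    · congr 1 <;> exact Finset.sum_congr rfl fun i _ => by ring
    · exact Finset.sum_congr rfl fun i _ => by ring
  all_goals ring

theorem coordBracket_smul_left (lam : Fin k → ℂˣ) (kap : Fin r → ℂˣ) (c : ℂ)
    (x y : Space k r m) : coordBracket lam kap (c • x) y = c • coordBracket lam kap x y := by
  funext i
  cases i <;> simp only [coordBracket, Pi.smul_apply, smul_eq_mul]
  case z =>
    rw [mul_add, mul_add, Finset.mul_sum, Finset.mul_sum, Finset.mul_sum]
    congr 1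
    · congr 1 <;> exact Finset.sum_congr rfl fun i _ => by ring
    · exact Finset.sum_congr rfl fun i _ => by ring
  all_goals ring

theorem coordBracket_smul_right (lam : Fin k → ℂˣ) (kap : Fin r → ℂˣ) (c : ℂ)
    (x y : Space k r m) : coordBracket lam kap x (c • y) = c • coordBracket lam kap x y := by
  funext i
  cases i <;> simp only [coordBracket, Pi.smul_apply, smul_eq_mul]
  case z =>
    rw [mul_add, mul_add, Finset.mul_sum, Finset.mul_sum, Finset.mul_sum]
    congr 1
    · congr 1 <;> exact Finset.sum_congr rfl fun i _ => by ring
    · exact Finset.sum_congr rfl fun i _ => by ring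
  all_goals ring

theorem bracket_eq_coordBracket (lam : Fin k → ℂˣ) (kap : Fin r → ℂˣ) (x y : Space k r m) :
    bracket lam kap x y = coordBracket lam kap x y := by
  have h : bracket lam kap = LinearMap.mk₂ ℂ (coordBracket (m := m) lam kap)
      (coordBracket_add_left lam kap) (coordBracket_smul_left lam kap)
      (coordBracket_add_right lam kap) (coordBracket_smul_right lam kap) := by
    refine (bas k r m).ext fun a => (bas k r m).ext fun b => ?_
    rw [bracket_bas, LinearMap.mk₂_apply]
    funext c
    cases a <;> cases b <;> cases c <;>
      simp only [table, coordBracket, bas_apply, reduceCtorEq, if_false, mul_zero, zero_mul,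
        sub_zero, zero_sub, add_zero, zero_add, Finset.sum_const_zero, Pi.zero_apply, if_true,
        Idx.e.injEq, Idx.e'.injEq, Idx.w.injEq, Idx.w'.injEq, Idx.eta.injEq, Pi.smul_apply,
        smul_eq_mul, mul_one, mul_neg, Finset.sum_neg_distrib] <;>
      (try split_ifs) <;> simp_all [bas_apply, eq_comm]
  rw [h, LinearMap.mk₂_apply]

section

variable (lam : Fin k → ℂˣ) (kap : Fin r → ℂˣ) (x y : Space k r m)

theorem bracket_z : bracket lam kap x y .z =
    ∑ i, (lam i : ℂ) * (x (.e i) * y (.e' i) - x (.e' i) * y (.e i)) +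
      ∑ j, (x (.w j) * y (.w j) + x (.w' j) * y (.w' j)) + ∑ t, x (.eta t) * y (.eta t) := by
  rw [bracket_eq_coordBracket]; rfl

theorem bracket_u : bracket lam kap x y .u = 0 := by
  rw [bracket_eq_coordBracket]; rfl

theorem bracket_e (i : Fin k) : bracket lam kap x y (.e i) =
    (lam i : ℂ) * (x (.e' i) * y .u - x .u * y (.e' i)) := by
  rw [bracket_eq_coordBracket]; rfl

theorem bracket_e' (i : Fin k) : bracket lam kap x y (.e' i) =
    (lam i : ℂ) * (x .u * y (.e i) - x (.e i) * y .u) := by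
  rw [bracket_eq_coordBracket]; rfl

theorem bracket_w (i : Fin r) : bracket lam kap x y (.w i) =
    (kap i : ℂ) * (x (.w' i) * y .u - x .u * y (.w' i)) := by
  rw [bracket_eq_coordBracket]; rfl

theorem bracket_w' (i : Fin r) : bracket lam kap x y (.w' i) =
    (kap i : ℂ) * (x .u * y (.w i) - x (.w i) * y .u) := by
  rw [bracket_eq_coordBracket]; rfl

theorem bracket_eta (t : Fin (m - 2 * r)) : bracket lam kap x y (.eta t) = 0 := by
  rw [bracket_eq_coordBracket]; rfl

variable {x y}

/-- The hyperplane of zero `u`-coordinate is a Heisenberg superalgebra: all its brackets lie in `ℂ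
z`. -/
theorem bracket_of_u_eq_zero (hx : x .u = 0) (hy : y .u = 0) :
    bracket lam kap x y = bracket lam kap x y .z • bas k r m .z := by
  funext c
  cases c <;> simp [bracket_u, bracket_e, bracket_e', bracket_w, bracket_w', bracket_eta, hx, hy]

variable (x)

theorem bracket_e_z (i : Fin k) :
    bracket lam kap x (bas k r m (.e i)) .z = -(lam i * x (.e' i)) := by
  simp [bracket_z, -Pi.basisFun_apply, bas_apply]

theorem bracket_e'_z (i : Fin k) :
    bracket lam kap x (bas k r m (.e' i)) .z = lam i * x (.e i) := by
  simp [bracket_z, -Pi.basisFun_apply, bas_apply]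

theorem bracket_w_z (i : Fin r) : bracket lam kap x (bas k r m (.w i)) .z = x (.w i) := by
  simp [bracket_z, -Pi.basisFun_apply, bas_apply]

theorem bracket_w'_z (i : Fin r) : bracket lam kap x (bas k r m (.w' i)) .z = x (.w' i) := by
  simp [bracket_z, -Pi.basisFun_apply, bas_apply]

theorem bracket_eta_z (t : Fin (m - 2 * r)) :
    bracket lam kap x (bas k r m (.eta t)) .z = x (.eta t) := by
  simp [bracket_z, -Pi.basisFun_apply, bas_apply]

/-- The elements which pair trivially with the whole algebra are the multiples of `z`. -/
theorem eq_smul_z (hu : x .u = 0) (h : ∀ y : Space k r m, y .u = 0 → bracket lam kap x y .z = 0) :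
    x = x .z • bas k r m .z := by
  funext c
  cases c with
  | z => simp
  | u => simp [hu]
  | e i => simpa [bracket_e'_z, -Pi.basisFun_apply, bas_apply] using h (bas k r m (.e' i)) (by simp)
  | e' i => simpa [bracket_e_z, -Pi.basisFun_apply, bas_apply] using h (bas k r m (.e i)) (by simp)
  | w i => simpa [bracket_w_z, -Pi.basisFun_apply, bas_apply] using h (bas k r m (.w i)) (by simp)
  | w' i => simpa [bracket_w'_z, -Pi.basisFun_apply, bas_apply] using h (bas k r m (.w' i)) (by simp)
  | eta i => simpa [bracket_eta_z, -Pi.basisFun_apply, bas_apply] using h (bas k r m (.eta i)) (by simp)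

/-- Every nonzero ideal contains the central element `z`. -/
theorem z_mem_of_ideal (hkr : 1 ≤ k + r) (K : Submodule ℂ (Space k r m))
    (hK : ∀ x ∈ K, ∀ y, bracket lam kap x y ∈ K) (hx : x ∈ K) (hx0 : x ≠ 0) :
    bas k r m .z ∈ K := by
  by_cases hu : x .u = 0
  · by_cases h : ∀ y : Space k r m, y .u = 0 → bracket lam kap x y .z = 0
    · have e := eq_smul_z lam kap x hu h
      rw [e] at hx
      refine (K.smul_mem_iff ?_).1 hx
      intro hz
      rw [hz, zero_smul] at e
      exact hx0 e
    · push Not at h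
      obtain ⟨y, hy, hy'⟩ := h
      have := hK x hx y
      rw [bracket_of_u_eq_zero lam kap hu hy] at this
      exact (K.smul_mem_iff hy').1 this
  -- With a nonzero `u`-coordinate, bracketing with `e_i` produces `ê_i`, and a second bracket with
  -- `e_i` gives a nonzero multiple of `z`; if `k = 0`, bracketing with `w_j` and then with `ŵ_j`
  -- does the same.
  · by_cases hk : 0 < k
    · set i : Fin k := ⟨0, hk⟩
      have := hK _ (hK x hx (bas k r m (.e i))) (bas k r m (.e i))
      rw [bracket_of_u_eq_zero lam kap (bracket_u _ _ _ _) (by simp), bracket_e_z,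
        bracket_e'] at this
      refine (K.smul_mem_iff ?_).1 this
      simpa using hu
    · set j : Fin r := ⟨0, by omega⟩
      have := hK _ (hK x hx (bas k r m (.w j))) (bas k r m (.w' j))
      rw [bracket_of_u_eq_zero lam kap (bracket_u _ _ _ _) (by simp), bracket_w'_z,
        bracket_w'] at this
      refine (K.smul_mem_iff ?_).1 this
      simpa using hu

end

theorem mem_degSpan_par {p : ZMod 2} {x : Space k r m} :
    x ∈ degSpan (bas k r m) Idx.par p ↔ ∀ i : Idx k r m, i.par ≠ p → x i = 0 := by
  rw [degSpan, Module.Basis.mem_span_image]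
  constructor
  · intro h i hi
    by_contra hx
    exact hi (h (by simpa using hx))
  · intro h i hi
    by_contra hne
    have : x i ≠ 0 := by simpa using hi
    exact this (h i hne)

/-- A basis, indexed by `ι`, is turned into a family with the same brackets by an automorphism,
as soon as the image of `z` does not vanish. -/
theorem exists_aut (hkr : 1 ≤ k + r) (lam : Fin k → ℂˣ) (kap : Fin r → ℂˣ) {ι : Type*}
    (b : Module.Basis ι ℂ (Space k r m)) (v : ι → Space k r m) (p : ι → ZMod 2)
    (hb : ∀ a, b a ∈ degSpan (bas k r m) Idx.par (p a))
    (hv : ∀ a, v a ∈ degSpan (bas k r m) Idx.par (p a))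
    (hz : b.constr ℂ v (bas k r m .z) ≠ 0)
    (hmul : ∀ a a', bracket lam kap (v a) (v a') =
      b.constr ℂ v (bracket lam kap (b a) (b a'))) :
    ∃ φ ∈ (heis k r m lam kap).aut, ∀ a, φ (b a) = v a := by
  set f : Space k r m →ₗ[ℂ] Space k r m := b.constr ℂ v with hf
  have hfb : ∀ a, f (b a) = v a := fun a => b.constr_basis ℂ v a
  have hfm : ∀ x y, f (bracket lam kap x y) = bracket lam kap (f x) (f y) := by
    have : (bracket lam kap).compr₂ f = (bracket lam kap).compl₁₂ f f := by
      refine b.ext fun a => b.ext fun a' => ?_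
      simp only [LinearMap.compr₂_apply, LinearMap.compl₁₂_apply, hfb, hmul]
    intro x y
    exact LinearMap.congr_fun₂ this x y
  -- The kernel is an ideal, so if it were nonzero it would contain `z`. Injectivity is enough in
  -- finite dimension.
  have hinj : Function.Injective f := by
    rw [← LinearMap.ker_eq_bot, eq_bot_iff]
    intro x hx
    by_contra hx0
    refine hz (LinearMap.mem_ker.1 (z_mem_of_ideal lam kap x hkr (LinearMap.ker f) ?_ hx hx0))
    intro x hx y
    rw [LinearMap.mem_ker] at hx ⊢
    rw [hfm, hx, map_zero, LinearMap.zero_apply]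
  let φ : Space k r m ≃ₗ[ℂ] Space k r m := LinearEquiv.ofInjectiveEndo f hinj
  have hφ : (φ : Space k r m →ₗ[ℂ] Space k r m) = f := rfl
  have hpar : ∀ q x, x ∈ degSpan (bas k r m) Idx.par q →
      f x ∈ degSpan (bas k r m) Idx.par q := by
    intro q x hx
    -- `f` commutes with the parity projection because it does so on the homogeneous basis `b`.
    let P : Space k r m →ₗ[ℂ] Space k r m := (Grading.ofParity (heis k r m lam kap)).proj q
    have hP : f ∘ₗ P = P ∘ₗ f := by
      refine b.ext fun a => ?_
      simp only [LinearMap.comp_apply, hfb, P]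
      by_cases h : p a = q
      · subst h
        rw [Grading.proj_of_mem _ (hb a), Grading.proj_of_mem _ (hv a), hfb]
      · rw [Grading.proj_of_mem_ne _ (hb a) h, Grading.proj_of_mem_ne _ (hv a) h, map_zero]
    have h2 : P x = x := Grading.proj_of_mem _ hx
    have h3 : f (P x) = P (f x) := LinearMap.congr_fun hP x
    rw [h2] at h3
    rw [h3]
    exact Grading.proj_mem (Grading.ofParity (heis k r m lam kap)) q (f x)
  refine ⟨φ, ⟨hfm, fun q => ?_⟩, hfb⟩
  refine Submodule.eq_of_le_of_finrank_eq ?_ (LinearEquiv.finrank_map_eq φ _)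
  rintro _ ⟨x, hx, rfl⟩
  exact hpar q x hx

end

section

variable {A : Type*} [AddCommGroup A] [Module ℂ A]

/-! ### Homogeneous bases for symmetric bilinear forms -/

/-- Homogeneous hyperbolic pairs `P i, Q i` and orthonormal vectors `Y h` in a subspace `W`. -/
structure HyperbolicSystem {S : Superalgebra A} {G : Type*} [AddCommGroup G] (Γ : Grading S G)
    (B : A →ₗ[ℂ] A →ₗ[ℂ] ℂ) (W : Submodule ℂ A) {s t : ℕ} (P Q : Fin s → A) (Y : Fin t → A) :
    Prop where
  memP : ∀ i, P i ∈ W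
  memQ : ∀ i, Q i ∈ W
  memY : ∀ h, Y h ∈ W
  homP : ∀ i, ∃ g, P i ∈ Γ.comp g
  homQ : ∀ i, ∃ g, Q i ∈ Γ.comp g
  homY : ∀ h, ∃ g, Y h ∈ Γ.comp g
  PP : ∀ i j, B (P i) (P j) = 0
  QQ : ∀ i j, B (Q i) (Q j) = 0
  PQ : ∀ i j, B (P i) (Q j) = if i = j then 1 else 0
  PY : ∀ i h, B (P i) (Y h) = 0
  QY : ∀ i h, B (Q i) (Y h) = 0
  YY : ∀ h h', B (Y h) (Y h') = if h = h' then 1 else 0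

/-- A vector of degree `g` pairs only with degree `gz - g`, so the other components of `w` do not
contribute. -/
theorem form_eq_form_proj {S : Superalgebra A} {G : Type*} [AddCommGroup G] (Γ : Grading S G)
    (B : A →ₗ[ℂ] A →ₗ[ℂ] ℂ) (gz : G) (W : Submodule ℂ A)
    (hB : ∀ g h x y, x ∈ W → y ∈ W → x ∈ Γ.comp g → y ∈ Γ.comp h → g + h ≠ gz → B x y = 0)
    (hW : ∀ x ∈ W, ∀ g, Γ.proj g x ∈ W) {g : G} {x w : A} (hx : x ∈ W) (hg : x ∈ Γ.comp g)
    (hw : w ∈ W) : B x (Γ.proj (gz - g) w) = B x w := by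
  classical
  obtain ⟨F, hF⟩ := Γ.exists_sum_proj w
  have e := congrArg (B x) (hF (insert (gz - g) F) (Finset.subset_insert _ _))
  rw [map_sum] at e
  rw [← e]
  symm
  apply Finset.sum_eq_single_of_mem (gz - g) (Finset.mem_insert_self _ _)
  intro h _ hne
  refine hB g h _ _ hx (hW w hw h) hg (Γ.proj_mem h w) fun e => hne ?_
  rw [← e, add_sub_cancel_left]

/-- This makes the orthogonal complement of a homogeneous vector a graded subspace, as the induction
below requires. -/
theorem form_proj_eq_zero {S : Superalgebra A} {G : Type*} [AddCommGroup G] (Γ : Grading S G)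
    (B : A →ₗ[ℂ] A →ₗ[ℂ] ℂ) (gz : G) (W : Submodule ℂ A)
    (hB : ∀ g h x y, x ∈ W → y ∈ W → x ∈ Γ.comp g → y ∈ Γ.comp h → g + h ≠ gz → B x y = 0)
    (hW : ∀ x ∈ W, ∀ g, Γ.proj g x ∈ W) {g : G} {x w : A} (hx : x ∈ W) (hg : x ∈ Γ.comp g)
    (hw : w ∈ W) (h0 : B x w = 0) (h : G) : B x (Γ.proj h w) = 0 := by
  by_cases e : g + h = gz
  · have : h = gz - g := by rw [← e, add_sub_cancel_left]
    rw [this, form_eq_form_proj Γ B gz W hB hW hx hg hw, h0]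
  · exact hB g h _ _ hx (hW w hw h) hg (Γ.proj_mem h w) e

/-- A graded Gram-Schmidt process. If some homogeneous vector is anisotropic, it is normalised and
split off as a `Y`. Otherwise a homogeneous vector has a homogeneous partner, and since both are
isotropic they span a hyperbolic plane. The orthogonal complement is graded and nondegenerate, so
induction applies. -/
theorem exists_hyperbolicSystem [FiniteDimensional ℂ A] {S : Superalgebra A} {G : Type*}
    [AddCommGroup G] (Γ : Grading S G) (B : A →ₗ[ℂ] A →ₗ[ℂ] ℂ) (gz : G) (n : ℕ) :
    ∀ W : Submodule ℂ A, Module.finrank ℂ W = n →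
    (∀ g h x y, x ∈ W → y ∈ W → x ∈ Γ.comp g → y ∈ Γ.comp h → g + h ≠ gz → B x y = 0) →
    (∀ x ∈ W, ∀ g, Γ.proj g x ∈ W) → (∀ x ∈ W, ∀ y ∈ W, B x y = B y x) →
    (∀ x ∈ W, (∀ y ∈ W, B x y = 0) → x = 0) →
    ∃ s t : ℕ, 2 * s + t = n ∧ ∃ (P Q : Fin s → A) (Y : Fin t → A),
      HyperbolicSystem Γ B W P Q Y := by
  induction n using Nat.strong_induction_on with
  | _ n ih =>
  intro W hn hB hW hsymm hnd
  rcases Nat.eq_zero_or_pos n with rfl | hpos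
  · exact ⟨0, 0, rfl, Fin.elim0, Fin.elim0, Fin.elim0, by constructor <;> intro i <;> exact i.elim0⟩
  obtain ⟨x₀, hx₀, hx₀0⟩ : ∃ x ∈ W, x ≠ 0 := by
    have : W ≠ ⊥ := by
      rintro rfl
      simp at hn
      omega
    exact (Submodule.ne_bot_iff _).1 this
  obtain ⟨g, hg⟩ := Γ.exists_map_proj_ne_zero LinearMap.id hx₀0
  rw [LinearMap.id_apply] at hg
  set x₁ := Γ.proj g x₀ with hx₁
  have hx₁W : x₁ ∈ W := hW _ hx₀ g
  have hx₁g : x₁ ∈ Γ.comp g := Γ.proj_mem g x₀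
  by_cases hiso : ∃ g, ∃ x ∈ W, x ∈ Γ.comp g ∧ B x x ≠ 0
  · obtain ⟨g, x', hx'W, hx'g, hx'⟩ := hiso
    obtain ⟨c, hc⟩ := IsAlgClosed.exists_pow_nat_eq (B x' x')⁻¹ (n := 2) (by norm_num)
    set x := c • x' with hxdef
    have hxW : x ∈ W := W.smul_mem c hx'W
    have hxg : x ∈ Γ.comp g := (Γ.comp g).smul_mem c hx'g
    have hxx : B x x = 1 := by
      simp only [hxdef, map_smul, LinearMap.smul_apply, smul_eq_mul]
      rw [← mul_assoc, ← sq, hc, inv_mul_cancel₀ hx']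
    clear_value x
    have hx0 : x ≠ 0 := by
      intro h
      rw [h, map_zero] at hxx
      simp at hxx
    set W' : Submodule ℂ A := W ⊓ LinearMap.ker (B x) with hW'
    have hdec : ∀ w ∈ W, w - B x w • x ∈ W' := by
      intro w hw
      refine ⟨sub_mem hw (W.smul_mem _ hxW), ?_⟩
      rw [SetLike.mem_coe, LinearMap.mem_ker, map_sub, map_smul, hxx, smul_eq_mul, mul_one, sub_self]
    have hsup : span ℂ {x} ⊔ W' = W := by
      refine le_antisymm (sup_le ?_ inf_le_left) fun w hw => ?_
      · rwa [span_singleton_le_iff_mem]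
      · rw [← add_sub_cancel (B x w • x) w]
        exact add_mem (mem_sup_left (smul_mem _ _ (mem_span_singleton_self x)))
          (mem_sup_right (hdec w hw))
    have hinf : span ℂ {x} ⊓ W' = ⊥ := by
      rw [eq_bot_iff]
      rintro y ⟨hy, -, hy'⟩
      obtain ⟨a, rfl⟩ := mem_span_singleton.1 hy
      rw [SetLike.mem_coe, LinearMap.mem_ker, map_smul, hxx, smul_eq_mul, mul_one] at hy'
      rw [hy', zero_smul]
      exact zero_mem _
    have hrank := finrank_sup_add_finrank_inf_eq (span ℂ {x}) W'
    rw [hsup, hinf, finrank_bot, finrank_span_singleton hx0, hn] at hrank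
    obtain ⟨s, t, hst, P, Q, Y, hsys⟩ := ih (n - 1) (by omega) W' (by omega)
      (fun g h x y hx hy => hB g h x y hx.1 hy.1)
      (fun w hw h => ⟨hW w hw.1 h,
        form_proj_eq_zero Γ B gz W hB hW hxW hxg hw.1 hw.2 h⟩)
      (fun x hx y hy => hsymm x hx.1 y hy.1)
      -- For `y` orthogonal to `x`, pairing with `w` equals pairing with the component of `w` in
      -- `W'`, so the form stays nondegenerate there.
      (fun y hy hy' => hnd y hy.1 fun w hw => by
        have h1 := hy' _ (hdec w hw)
        have h2 : B x y = 0 := hy.2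
        rwa [map_sub, map_smul, hsymm y hy.1 x hxW, h2, smul_zero, sub_zero] at h1)
    have hperp : ∀ w ∈ W', B x w = 0 := fun w hw => hw.2
    have hperp' : ∀ w ∈ W', B w x = 0 := fun w hw => by rw [hsymm w hw.1 x hxW, hperp w hw]
    refine ⟨s, t + 1, by omega, P, Q, Fin.cons x Y, ?_⟩
    constructor
    · exact fun i => (hsys.memP i).1
    · exact fun i => (hsys.memQ i).1
    · refine Fin.cases ?_ fun i => ?_
      · exact hxW
      · exact (hsys.memY i).1
    · exact hsys.homP
    · exact hsys.homQ
    · refine Fin.cases ?_ fun i => ?_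
      · exact ⟨g, hxg⟩
      · exact hsys.homY i
    · exact hsys.PP
    · exact hsys.QQ
    · exact hsys.PQ
    · intro i
      refine Fin.cases ?_ fun j => ?_
      · exact hperp' _ (hsys.memP i)
      · exact hsys.PY i j
    · intro i
      refine Fin.cases ?_ fun j => ?_
      · exact hperp' _ (hsys.memQ i)
      · exact hsys.QY i j
    · refine Fin.cases (Fin.cases ?_ fun j => ?_) fun i => Fin.cases ?_ fun j => ?_
      · simpa using hxx
      · simpa [(Fin.succ_ne_zero j).symm] using hperp _ (hsys.memY j)
      · simpa using hperp' _ (hsys.memY i)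
      · simpa using hsys.YY i j
  · push Not at hiso
    obtain ⟨y₀, hy₀, hxy₀⟩ : ∃ y ∈ W, B x₁ y ≠ 0 := by
      by_contra! hcon
      exact hg (hnd x₁ hx₁W hcon)
    -- Passing to the component of degree `gz - g` makes the partner homogeneous without changing
    -- the pairing.
    rw [← form_eq_form_proj Γ B gz W hB hW hx₁W hx₁g hy₀] at hxy₀
    set x := x₁
    set h := gz - g
    set y := (B x (Γ.proj h y₀))⁻¹ • Γ.proj h y₀ with hy
    have hyW : y ∈ W := W.smul_mem _ (hW _ hy₀ h)
    have hyh : y ∈ Γ.comp h := (Γ.comp h).smul_mem _ (Γ.proj_mem h y₀)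
    have hxy : B x y = 1 := by
      rw [hy, map_smul, smul_eq_mul, inv_mul_cancel₀ hxy₀]
    clear_value y
    have hyx : B y x = 1 := by rw [hsymm y hyW x hx₁W, hxy]
    have hxx : B x x = 0 := hiso g x hx₁W hx₁g
    have hyy : B y y = 0 := hiso h y hyW hyh
    set W' : Submodule ℂ A := W ⊓ (LinearMap.ker (B x) ⊓ LinearMap.ker (B y)) with hW'
    have hdec : ∀ w ∈ W, w - (B y w • x + B x w • y) ∈ W' := by
      intro w hw
      refine ⟨sub_mem hw (add_mem (W.smul_mem _ hx₁W) (W.smul_mem _ hyW)), ?_, ?_⟩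
      · simp [LinearMap.mem_ker, hxx, hxy]
      · simp [LinearMap.mem_ker, hyy, hyx]
    have hli : LinearIndependent ℂ ![x, y] := by
      rw [LinearIndependent.pair_iff]
      intro a b e
      have h1 := congrArg (B x) e
      have h2 := congrArg (B y) e
      simp only [map_add, map_smul, hxx, hxy, hyx, hyy, map_zero, smul_eq_mul, mul_zero, mul_one,
        zero_add, add_zero] at h1 h2
      exact ⟨h2, h1⟩
    have hsup : span ℂ (Set.range ![x, y]) ⊔ W' = W := by
      refine le_antisymm (sup_le ?_ inf_le_left) fun w hw => ?_
      · rw [span_le]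
        rintro _ ⟨i, rfl⟩
        fin_cases i
        · exact hx₁W
        · exact hyW
      · rw [← add_sub_cancel (B y w • x + B x w • y) w]
        refine add_mem (mem_sup_left (add_mem (smul_mem _ _ ?_) (smul_mem _ _ ?_)))
          (mem_sup_right (hdec w hw))
        · exact subset_span ⟨0, rfl⟩
        · exact subset_span ⟨1, rfl⟩
    have hinf : span ℂ (Set.range ![x, y]) ⊓ W' = ⊥ := by
      rw [eq_bot_iff]
      rintro v ⟨hv, -, hv1, hv2⟩
      rw [SetLike.mem_coe] at hv
      rw [Matrix.range_cons, Matrix.range_cons, Matrix.range_empty, Set.union_empty,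
        Set.singleton_union, mem_span_pair] at hv
      obtain ⟨a, b, rfl⟩ := hv
      rw [SetLike.mem_coe, LinearMap.mem_ker] at hv1 hv2
      simp only [map_add, map_smul, hxx, hxy, hyx, hyy, smul_eq_mul, mul_zero, mul_one,
        zero_add, add_zero] at hv1 hv2
      simp [hv1, hv2]
    have hrank := finrank_sup_add_finrank_inf_eq (span ℂ (Set.range ![x, y])) W'
    rw [hsup, hinf, finrank_bot, finrank_span_eq_card hli, hn, Fintype.card_fin] at hrank
    obtain ⟨s, t, hst, P, Q, Y, hsys⟩ := ih (n - 2) (by omega) W' (by omega)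
      (fun g h x y hx hy => hB g h x y hx.1 hy.1)
      (fun w hw h => ⟨hW w hw.1 h,
        form_proj_eq_zero Γ B gz W hB hW hx₁W hx₁g hw.1 hw.2.1 h,
        form_proj_eq_zero Γ B gz W hB hW hyW hyh hw.1 hw.2.2 h⟩)
      (fun x hx y hy => hsymm x hx.1 y hy.1)
      (fun v hv hv' => hnd v hv.1 fun w hw => by
        have h1 := hv' _ (hdec w hw)
        have h2 : B x v = 0 := hv.2.1
        have h3 : B y v = 0 := hv.2.2
        rwa [map_sub, map_add, map_smul, map_smul, hsymm v hv.1 x hx₁W, hsymm v hv.1 y hyW, h2,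
          h3, smul_zero, smul_zero, add_zero, sub_zero] at h1)
    have px : ∀ w ∈ W', B x w = 0 := fun w hw => hw.2.1
    have px' : ∀ w ∈ W', B w x = 0 := fun w hw => by rw [hsymm w hw.1 x hx₁W, px w hw]
    have py : ∀ w ∈ W', B y w = 0 := fun w hw => hw.2.2
    have py' : ∀ w ∈ W', B w y = 0 := fun w hw => by rw [hsymm w hw.1 y hyW, py w hw]
    refine ⟨s + 1, t, by omega, Fin.cons x P, Fin.cons y Q, Y, ?_⟩
    constructor
    · exact Fin.cases hx₁W fun i => (hsys.memP i).1
    · exact Fin.cases hyW fun i => (hsys.memQ i).1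
    · exact fun i => (hsys.memY i).1
    · exact Fin.cases ⟨g, hx₁g⟩ hsys.homP
    · exact Fin.cases ⟨h, hyh⟩ hsys.homQ
    · exact hsys.homY
    · refine Fin.cases (Fin.cases ?_ fun j => ?_) fun i => Fin.cases ?_ fun j => ?_
      · exact hxx
      · exact px _ (hsys.memP j)
      · exact px' _ (hsys.memP i)
      · exact hsys.PP i j
    · refine Fin.cases (Fin.cases ?_ fun j => ?_) fun i => Fin.cases ?_ fun j => ?_
      · exact hyy
      · exact py _ (hsys.memQ j)
      · exact py' _ (hsys.memQ i)
      · exact hsys.QQ i j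
    · refine Fin.cases (Fin.cases ?_ fun j => ?_) fun i => Fin.cases ?_ fun j => ?_
      · simpa using hxy
      · simpa [(Fin.succ_ne_zero j).symm] using px _ (hsys.memQ j)
      · simpa using py' _ (hsys.memP i)
      · simpa using hsys.PQ i j
    · exact Fin.cases (fun j => px _ (hsys.memY j)) hsys.PY
    · exact Fin.cases (fun j => py _ (hsys.memY j)) hsys.QY
    · exact hsys.YY

end

section

variable {k r m : ℕ}

/-! ### The operator `ad u` -/

/-- The first member of each of the pairs `e_i, ê_i` and `w_j, ŵ_j`. -/
def pairFst : Fin k ⊕ Fin r → Idx k r m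
  | .inl i => .e i
  | .inr j => .w j

/-- The second member of each of the pairs `e_i, ê_i` and `w_j, ŵ_j`. -/
def pairSnd : Fin k ⊕ Fin r → Idx k r m
  | .inl i => .e' i
  | .inr j => .w' j

/-- The parity of each of the pairs `e_i, ê_i` and `w_j, ŵ_j`. -/
def pairPar : Fin k ⊕ Fin r → ZMod 2
  | .inl _ => 0
  | .inr _ => 1

/-- The frequency with which `ad u` rotates each of the pairs. -/
def pairScale (lam : Fin k → ℂˣ) (kap : Fin r → ℂˣ) : Fin k ⊕ Fin r → ℂˣ
  | .inl i => lam i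
  | .inr j => kap j

/-- The absolute frequency with which `ad u` rotates each basis vector. -/
def freq (lam : Fin k → ℂˣ) (kap : Fin r → ℂˣ) : Idx k r m → ℂ
  | .e i => lam i
  | .e' i => lam i
  | .w i => kap i
  | .w' i => kap i
  | _ => 0

section

variable (lam : Fin k → ℂˣ) (kap : Fin r → ℂˣ)

/-- The operator `ad u`. -/
def adU : Space k r m →ₗ[ℂ] Space k r m := bracket lam kap (bas k r m .u)

theorem adU_fst (j : Fin k ⊕ Fin r) (x : Space k r m) :
    adU lam kap x (pairFst j) = -(pairScale lam kap j * x (pairSnd j)) := by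
  cases j <;> simp [adU, pairScale, pairFst, pairSnd, bracket_e, bracket_w, -Pi.basisFun_apply, bas_apply]

theorem adU_snd (j : Fin k ⊕ Fin r) (x : Space k r m) :
    adU lam kap x (pairSnd j) = pairScale lam kap j * x (pairFst j) := by
  cases j <;> simp [adU, pairScale, pairFst, pairSnd, bracket_e', bracket_w', -Pi.basisFun_apply, bas_apply]

theorem adU_z (x : Space k r m) : adU lam kap x .z = 0 := by
  simp [adU, bracket_z, -Pi.basisFun_apply, bas_apply]

theorem adU_u (x : Space k r m) : adU lam kap x .u = 0 := bracket_u _ _ _ _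

theorem adU_eta (x : Space k r m) (t : Fin (m - 2 * r)) : adU lam kap x (.eta t) = 0 :=
  bracket_eta _ _ _ _ _

theorem idx_cases (c : Idx k r m) : (∃ j, c = pairFst j) ∨ (∃ j, c = pairSnd j) ∨
    c = .z ∨ c = .u ∨ ∃ t, c = .eta t := by
  cases c with
  | z => simp
  | u => simp
  | e i => exact .inl ⟨.inl i, rfl⟩
  | e' i => exact .inr (.inl ⟨.inl i, rfl⟩)
  | w i => exact .inl ⟨.inr i, rfl⟩
  | w' i => exact .inr (.inl ⟨.inr i, rfl⟩)
  | eta t => simp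

theorem freq_fst (j : Fin k ⊕ Fin r) :
    freq lam kap (pairFst j : Idx k r m) = pairScale lam kap j := by
  cases j <;> rfl

theorem freq_snd (j : Fin k ⊕ Fin r) :
    freq lam kap (pairSnd j : Idx k r m) = pairScale lam kap j := by
  cases j <;> rfl

theorem par_fst (j : Fin k ⊕ Fin r) : (pairFst j : Idx k r m).par = pairPar j := by
  cases j <;> rfl

theorem par_snd (j : Fin k ⊕ Fin r) : (pairSnd j : Idx k r m).par = pairPar j := by
  cases j <;> rfl

theorem fst_ne_snd (j j' : Fin k ⊕ Fin r) : (pairFst j : Idx k r m) ≠ pairSnd j' := by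
  cases j <;> cases j' <;> simp [pairFst, pairSnd]

/-- `ad u` rotates each pair by a quarter turn and scales it, so its square is diagonal in the
defining basis. -/
theorem adU_adU (x : Space k r m) (c : Idx k r m) :
    adU lam kap (adU lam kap x) c = -freq lam kap c ^ 2 * x c := by
  rcases idx_cases c with ⟨j, rfl⟩ | ⟨j, rfl⟩ | rfl | rfl | ⟨t, rfl⟩
  · rw [adU_fst, adU_snd, freq_fst]
    ring
  · rw [adU_snd, adU_fst, freq_snd]
    ring
  · rw [adU_z]
    simp [freq]
  · rw [adU_u]
    simp [freq]
  · rw [adU_eta]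
    simp [freq]

/-- The square of `ad u`. -/
def adUSq : Module.End ℂ (Space k r m) := adU lam kap ∘ₗ adU lam kap

theorem adU_sq_pow (n : ℕ) (x : Space k r m) (c : Idx k r m) :
    (adUSq lam kap ^ n) x c = (-freq lam kap c ^ 2) ^ n * x c := by
  induction n generalizing x with
  | zero => simp
  | succ n ih =>
    rw [pow_succ, Module.End.mul_apply, ih, adUSq, LinearMap.comp_apply, adU_adU]
    ring

variable {lam kap} {G : Type*} [AddCommGroup G] {Γ : Grading (heis k r m lam kap) G} {d : G}

theorem adU_mem (hd : bas k r m .u ∈ Γ.comp d) (g : G) (x : Space k r m) (hx : x ∈ Γ.comp g) :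
    adU lam kap x ∈ Γ.comp (g + d) :=
  Γ.mul_mem' hd hx (add_comm d g)

theorem adU_sq_pow_mem (hd : bas k r m .u ∈ Γ.comp d) (n : ℕ) (g : G) (x : Space k r m)
    (hx : x ∈ Γ.comp g) :
    (adUSq lam kap ^ n) x ∈ Γ.comp (g + n • (d + d)) := by
  induction n generalizing g x with
  | zero => simpa using hx
  | succ n ih =>
    rw [pow_succ, Module.End.mul_apply]
    have := ih (g + d + d) _ (adU_mem hd _ _ (adU_mem hd _ _ hx))
    have e : g + (n + 1) • (d + d) = g + d + d + n • (d + d) := by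
      rw [succ_nsmul]
      abel
    rw [e]
    exact this

/-- Take a homogeneous vector with nonzero coordinate on some pair. Powers of `(ad u)²` multiply
that coordinate by nonzero scalars, so all degrees `g + n • (d + d)` occur in the support. The
support is finite, hence two of them coincide. -/
theorem exists_nsmul_eq_zero (hkr : 1 ≤ k + r) (hd : bas k r m .u ∈ Γ.comp d) :
    ∃ N : ℕ, 0 < N ∧ N • (d + d) = 0 := by
  obtain ⟨j⟩ : Nonempty (Fin k ⊕ Fin r) := by
    rw [← Fintype.card_pos_iff, Fintype.card_sum, Fintype.card_fin, Fintype.card_fin]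
    omega
  let c : Idx k r m := pairFst j
  obtain ⟨g, hg⟩ := Γ.exists_map_proj_ne_zero (LinearMap.proj c : Space k r m →ₗ[ℂ] ℂ)
    (x := bas k r m c) (by simp)
  rw [LinearMap.proj_apply] at hg
  have hfin : Γ.support.Finite := WellFoundedGT.finite_ne_bot_of_iSupIndep Γ.indep
  have hmaps : ∀ n : ℕ, g + n • (d + d) ∈ Γ.support := by
    intro n
    refine (Submodule.ne_bot_iff _).2 ⟨_, adU_sq_pow_mem hd n g _ (Γ.proj_mem g (bas k r m c)), ?_⟩
    intro h
    have := congrFun h c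
    rw [adU_sq_pow, freq_fst] at this
    simp only [Pi.zero_apply, mul_eq_zero, hg, or_false] at this
    have := eq_zero_of_pow_eq_zero this
    simp at this
  obtain ⟨a, -, b, -, hab, e⟩ := Set.infinite_univ.exists_ne_map_eq_of_mapsTo
    (fun n _ => hmaps n) hfin
  wlog hlt : a < b generalizing a b
  · exact this b a hab.symm e.symm (by omega)
  refine ⟨b - a, by omega, ?_⟩
  have e' := add_left_cancel e
  have : b • (d + d) = a • (d + d) + (b - a) • (d + d) := by
    rw [← add_nsmul]
    congr 1
    omega
  rw [this] at e'
  exact left_eq_add.1 e'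

variable (hlam : ∀ i j, i ≠ j → ¬ IsOfFinOrder (lam i / lam j))
  (hkap : ∀ i j, i ≠ j → ¬ IsOfFinOrder (kap i / kap j))

include hlam hkap in
theorem scale_ne {j j' : Fin k ⊕ Fin r} (hjj : j ≠ j') (hp : pairPar j = pairPar j') :
    ¬ IsOfFinOrder (pairScale lam kap j / pairScale lam kap j') := by
  cases j <;> cases j'
  · exact hlam _ _ fun h => hjj (congrArg _ h)
  · simp [pairPar] at hp
  · simp [pairPar] at hp
  · exact hkap _ _ fun h => hjj (congrArg _ h)

-- The root-of-unity hypothesis is used in this form: equal `N`-th powers would give a ratio of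
-- frequencies whose `2N`-th power is 1.
include hlam hkap in
theorem neg_sq_pow_ne {j j' : Fin k ⊕ Fin r} (hjj : j ≠ j') (hp : pairPar j = pairPar j') {N : ℕ}
    (hN : 0 < N) : (-(pairScale lam kap j : ℂ) ^ 2) ^ N ≠ (-(pairScale lam kap j' : ℂ) ^ 2) ^ N := by
  intro h
  apply scale_ne hlam hkap hjj hp
  rw [isOfFinOrder_iff_pow_eq_one]
  refine ⟨2 * N, by omega, ?_⟩
  rw [neg_pow, neg_pow (_ ^ 2)] at h
  have h2 := mul_left_cancel₀ (pow_ne_zero N (neg_ne_zero.2 one_ne_zero)) h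
  rw [← pow_mul, ← pow_mul] at h2
  rw [div_pow, div_eq_one]
  exact Units.ext (by push_cast; exact h2)

include hlam hkap in
/-- The plane spanned by a pair is a graded subspace. -/
theorem proj_eq_pair (hkr : 1 ≤ k + r) (hd : bas k r m .u ∈ Γ.comp d) (j : Fin k ⊕ Fin r)
    (a b : ℂ) (g : G) :
    ∃ a' b' : ℂ, Γ.proj g (a • bas k r m (pairFst j) + b • bas k r m (pairSnd j)) =
      a' • bas k r m (pairFst j) + b' • bas k r m (pairSnd j) := by
  obtain ⟨N, hN, hNd⟩ := exists_nsmul_eq_zero hkr hd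
  set x : Space k r m := a • bas k r m (pairFst j) + b • bas k r m (pairSnd j) with hx
  set y := Γ.proj g x with hy
  have hxp : x ∈ (heis k r m lam kap).parity (pairPar j) := by
    refine add_mem (smul_mem _ _ ?_) (smul_mem _ _ ?_)
    · exact basis_mem_degSpan _ _ (par_fst j)
    · exact basis_mem_degSpan _ _ (par_snd j)
  have hyp := mem_degSpan_par.1 (Γ.proj_mem_parity hxp g)
  have hDx : (adUSq lam kap ^ N) x = (-(pairScale lam kap j : ℂ) ^ 2) ^ N • x := by
    funext c
    rw [adU_sq_pow, Pi.smul_apply, smul_eq_mul]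
    by_cases h1 : c = pairFst j
    · rw [h1, freq_fst]
    by_cases h2 : c = pairSnd j
    · rw [h2, freq_snd]
    · have : x c = 0 := by simp [hx, h1, h2]
      rw [this, mul_zero, mul_zero]
  -- By the choice of `N` this operator has degree 0, so it commutes with `Γ.proj g` and `y` stays
  -- in the eigenspace of `x`.
  have hDy : (adUSq lam kap ^ N) y = (-(pairScale lam kap j : ℂ) ^ 2) ^ N • y := by
    rw [hy, Γ.map_proj (d := 0) (fun g x hx => by simpa [hNd] using adU_sq_pow_mem hd N g x hx),
      add_zero, hDx, map_smul]
  have key : ∀ c, c ≠ pairFst j → c ≠ pairSnd j → y c = 0 := by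
    intro c h1 h2
    -- Parity has to separate even from odd pairs, because nothing is assumed about the ratios `λ_i
    -- / κ_j`.
    by_cases hpar : c.par = pairPar j
    · have e := congrFun hDy c
      rw [adU_sq_pow, Pi.smul_apply, smul_eq_mul] at e
      by_contra hyc
      have e' := mul_right_cancel₀ hyc e
      have hne : ∀ j', j' ≠ j → c.par = pairPar j' → freq lam kap c = pairScale lam kap j' →
          False := by
        intro j' hj' hp hf
        rw [hf] at e'
        exact neg_sq_pow_ne hlam hkap hj' (hp.symm.trans hpar) hN e'
      have h0 : freq lam kap c ≠ 0 := by
        intro h0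
        rw [h0] at e'
        have h3 : (-(pairScale lam kap j : ℂ) ^ 2) ^ N ≠ 0 := by simp
        apply h3
        rw [← e']
        simp [hN.ne']
      rcases idx_cases c with ⟨j', rfl⟩ | ⟨j', rfl⟩ | rfl | rfl | ⟨t, rfl⟩
      · exact hne j' (fun h => h1 (by rw [h])) (par_fst j') (freq_fst _ _ j')
      · exact hne j' (fun h => h2 (by rw [h])) (par_snd j') (freq_snd _ _ j')
      · exact h0 rfl
      · exact h0 rfl
      · exact h0 rfl
    · exact hyp c hpar
  refine ⟨y (pairFst j), y (pairSnd j), ?_⟩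
  funext c
  by_cases h1 : c = pairFst j
  · subst h1
    simp [fst_ne_snd]
  by_cases h2 : c = pairSnd j
  · subst h2
    simp [(fst_ne_snd _ _).symm]
  · simp [key c h1 h2, h1, h2]

theorem adU_pair (j : Fin k ⊕ Fin r) (a b : ℂ) :
    adU lam kap (a • bas k r m (pairFst j) + b • bas k r m (pairSnd j)) =
      (pairScale lam kap j : ℂ) •
        ((-b) • bas k r m (pairFst j) + a • bas k r m (pairSnd j)) := by
  cases j <;> simp only [adU, pairScale, pairFst, pairSnd, map_add, map_smul, bracket_bas, table,
    pairScale] <;> module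

theorem pair_eq_zero {j : Fin k ⊕ Fin r} {a b : ℂ}
    (h : a • bas k r m (pairFst j) + b • bas k r m (pairSnd j) = 0) : a = 0 ∧ b = 0 := by
  have h1 := congrFun h (pairFst j)
  have h2 := congrFun h (pairSnd j)
  simp [fst_ne_snd, (fst_ne_snd _ _).symm] at h1 h2
  exact ⟨h1, h2⟩

include hlam hkap in
/-- There is a nonzero homogeneous element in the plane spanned by a pair. -/
theorem exists_homogeneous_pair (hkr : 1 ≤ k + r) (hd : bas k r m .u ∈ Γ.comp d)
    (j : Fin k ⊕ Fin r) : ∃ (a b : ℂ) (g : G),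
      a • bas k r m (pairFst j) + b • bas k r m (pairSnd j) ∈ Γ.comp g ∧
      a • bas k r m (pairFst j) + b • bas k r m (pairSnd j) ≠ (0 : Space k r m) := by
  obtain ⟨g, hg⟩ := Γ.exists_map_proj_ne_zero LinearMap.id
    (x := (1 : ℂ) • bas k r m (pairFst j) + (0 : ℂ) • bas k r m (pairSnd j)) fun h =>
      one_ne_zero (pair_eq_zero h).1
  obtain ⟨a, b, e⟩ := proj_eq_pair hlam hkap hkr hd j 1 0 g
  rw [LinearMap.id_apply, e] at hg
  exact ⟨a, b, g, e ▸ Γ.proj_mem g _, hg⟩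

-- For `d = 0`, `ad u` commutes with the projections, and these preserve the plane. In the plane the
-- eigenspace of the vector `(1, ε)`, with eigenvalue `-ε` times the frequency, is a line, so it is
-- graded.
include hlam hkap in
include hlam hkap in
theorem homogeneous_eigenvector (hkr : 1 ≤ k + r) (hd : bas k r m .u ∈ Γ.comp 0)
    (j : Fin k ⊕ Fin r) {ε : ℂ} (hε : ε * ε = -1) :
    ∃ g, (1 : ℂ) • bas k r m (pairFst j) + ε • bas k r m (pairSnd j) ∈ Γ.comp g := by
  refine Γ.exists_mem_of_proj_mem_span (fun h => one_ne_zero (pair_eq_zero h).1) fun g => ?_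
  obtain ⟨a, b, e⟩ := proj_eq_pair hlam hkap hkr hd j 1 ε g
  have h1 := Γ.map_proj (adU_mem hd) g
    ((1 : ℂ) • bas k r m (pairFst j) + ε • bas k r m (pairSnd j))
  have h2 : (-ε) • bas k r m (pairFst j) + (1 : ℂ) • bas k r m (pairSnd j) =
      (-ε) • ((1 : ℂ) • bas k r m (pairFst j) + ε • bas k r m (pairSnd j)) := by
    rw [smul_add, smul_smul, smul_smul, neg_mul ε ε, hε, neg_neg, mul_one]
  rw [e, adU_pair, adU_pair, map_smul, h2, map_smul, add_zero, e] at h1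
  have hs : (pairScale lam kap j : ℂ) ≠ 0 := Units.ne_zero _
  have h3 := congrFun (smul_right_injective _ hs h1) (pairSnd j)
  simp [(fst_ne_snd _ _).symm] at h3
  have h4 : b = a * ε := by
    rw [h3]
    linear_combination b * hε
  rw [e, mem_span_singleton]
  exact ⟨a, by rw [h4]; module⟩

-- A homogeneous vector `(a, b)` of the plane and its quarter turn `(-b, a)`, proportional to its
-- image under `ad u`, have degrees `g` and `g + d`. If `a² + b² = 0`, they would be proportional
-- and `d` would vanish; so the vector can be scaled to `a² + b² = 1`.
include hlam hkap in
theorem homogeneous_rotation (hkr : 1 ≤ k + r) (hd : bas k r m .u ∈ Γ.comp d) (hd0 : d ≠ 0)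
    (j : Fin k ⊕ Fin r) : ∃ a b : ℂ, a ^ 2 + b ^ 2 = 1 ∧
      (∃ g, a • bas k r m (pairFst j) + b • bas k r m (pairSnd j) ∈ Γ.comp g) ∧
      ∃ g, (-b) • bas k r m (pairFst j) + a • bas k r m (pairSnd j) ∈ Γ.comp g := by
  obtain ⟨a, b, g, hg, h0⟩ := exists_homogeneous_pair hlam hkap hkr hd j
  have h1 := adU_mem hd _ _ hg
  rw [adU_pair] at h1
  have hs : (pairScale lam kap j : ℂ) ≠ 0 := Units.ne_zero _
  have h2 := ((Γ.comp _).smul_mem_iff hs).1 h1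
  have hab : a ^ 2 + b ^ 2 ≠ 0 := by
    intro h
    have : ∃ ε : ℂ, ε * ε = -1 ∧ b = ε * a := by
      have : (b - I * a) * (b + I * a) = 0 := by
        linear_combination h - a ^ 2 * I_mul_I
      rcases mul_eq_zero.1 this with h | h
      · exact ⟨I, I_mul_I, by linear_combination h⟩
      · exact ⟨-I, by rw [neg_mul_neg, I_mul_I], by linear_combination h⟩
    obtain ⟨ε, hε, hb⟩ := this
    have e : -b • bas k r m (pairFst j) + a • bas k r m (pairSnd j) =
        (-ε) • (a • bas k r m (pairFst j) + b • bas k r m (pairSnd j)) := by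
      rw [smul_add, smul_smul, smul_smul, neg_mul, ← hb, neg_mul]
      congr 2
      rw [hb]
      linear_combination a * hε
    have hε0 : -ε ≠ 0 := by
      rintro h
      rw [neg_eq_zero.1 h] at hε
      norm_num at hε
    rw [e, (Γ.comp _).smul_mem_iff hε0] at h2
    exact hd0 (left_eq_add.1 (Γ.eq_of_mem_of_mem h0 hg h2))
  obtain ⟨c, hc⟩ := IsAlgClosed.exists_pow_nat_eq (a ^ 2 + b ^ 2)⁻¹ (n := 2) (by norm_num)
  refine ⟨c * a, c * b, ?_, ⟨g, ?_⟩, g + d, ?_⟩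
  · rw [mul_pow, mul_pow, ← mul_add, hc, inv_mul_cancel₀ hab]
  · convert (Γ.comp g).smul_mem c hg using 1
    module
  · convert (Γ.comp (g + d)).smul_mem c h2 using 1
    module

end

end

section

variable {k r m : ℕ}

/-! ### Homogeneity of the distinguished subspaces -/

section

variable {lam : Fin k → ℂˣ} {kap : Fin r → ℂˣ} {G : Type*} [AddCommGroup G]
  (Γ : Grading (heis k r m lam kap) G)

/-- Projections of a central element are again annihilated by bracketing, and the centre is the line
`ℂ z`. -/
theorem exists_z_mem (hkr : 1 ≤ k + r) : ∃ g, bas k r m .z ∈ Γ.comp g := by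
  have hz : ∀ y, bracket lam kap (bas k r m .z) y = 0 := by
    intro y
    refine LinearMap.congr_fun (f := bracket lam kap (bas k r m .z)) (g := 0) ?_ y
    refine (bas k r m).ext fun a => ?_
    rw [bracket_bas]
    cases a <;> rfl
  refine Γ.exists_mem_of_proj_mem_span ((bas k r m).ne_zero _) fun g => ?_
  have key : ∀ y, bracket lam kap (Γ.proj g (bas k r m .z)) y = 0 := by
    intro y
    refine Γ.mem_induction (p := fun y => bracket lam kap (Γ.proj g (bas k r m .z)) y = 0)
      ?_ (map_zero _) (fun x y hx hy => by rw [map_add, hx, hy, add_zero]) y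
    intro h y hy
    have := Γ.map_proj (f := (bracket lam kap).flip y) (d := h)
      (fun g x hx => Γ.mul_mem g h x y hx hy) g (bas k r m .z)
    rw [LinearMap.flip_apply, LinearMap.flip_apply, hz, map_zero] at this
    exact this
  set x := Γ.proj g (bas k r m .z)
  rw [mem_span_singleton]
  refine ⟨x .z, (eq_smul_z lam kap x ?_ fun y _ => by rw [key]; rfl).symm⟩
  -- A central element has no `u`-coordinate, since `u` acts nontrivially on at least one pair.
  obtain ⟨j⟩ : Nonempty (Fin k ⊕ Fin r) := by
    rw [← Fintype.card_pos_iff, Fintype.card_sum, Fintype.card_fin, Fintype.card_fin]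
    omega
  cases j with
  | inl i => simpa [bracket_e', -Pi.basisFun_apply, bas_apply] using
      congrFun (key (bas k r m (.e i))) (.e' i)
  | inr i => simpa [bracket_w', -Pi.basisFun_apply, bas_apply] using
      congrFun (key (bas k r m (.w i))) (.w' i)

theorem exists_homogeneous_u : ∃ (g : G) (x : Space k r m), x ∈ Γ.comp g ∧ x .u = 1 ∧
    ∀ i : Idx k r m, i.par ≠ 0 → x i = 0 := by
  obtain ⟨g, hg⟩ := Γ.exists_map_proj_ne_zero (LinearMap.proj .u : Space k r m →ₗ[ℂ] ℂ)
    (x := bas k r m .u) (by simp)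
  rw [LinearMap.proj_apply] at hg
  set x := Γ.proj g (bas k r m .u)
  refine ⟨g, (x .u)⁻¹ • x, smul_mem _ _ (Γ.proj_mem g _), ?_, ?_⟩
  · rw [Pi.smul_apply, smul_eq_mul, inv_mul_cancel₀ hg]
  · have h : x ∈ degSpan (bas k r m) Idx.par 0 :=
      Γ.proj_mem_parity (basis_mem_degSpan (bas k r m) Idx.par (i := .u) rfl) g
    intro i hi
    rw [Pi.smul_apply, mem_degSpan_par.1 h i hi, smul_zero]

/-- The images of the basis vectors under the automorphism which sends `u` to `x`. -/
def shiftVec (x : Space k r m) : Idx k r m → Space k r m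
  | .u => x
  | .e i => bas k r m (.e i) - x (.e i) • bas k r m .z
  | .e' i => bas k r m (.e' i) - x (.e' i) • bas k r m .z
  | a => bas k r m a

/-- Replacing `u` by `x` adds multiples of `z` to the brackets with `e_i` and `ê_i`. Subtracting
`x_{e_i} z` and `x_{ê_i} z` from these vectors restores the relations. The odd vectors need no
correction because `x` is even. -/
theorem exists_aut_u (hkr : 1 ≤ k + r) (lam : Fin k → ℂˣ) (kap : Fin r → ℂˣ) (x : Space k r m)
    (hu : x .u = 1) (hx : ∀ i : Idx k r m, i.par ≠ 0 → x i = 0) :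
    ∃ φ ∈ (heis k r m lam kap).aut, φ (bas k r m .u) = x := by
  have hw : ∀ j, x (.w j) = 0 := fun j => hx _ one_ne_zero
  have hw' : ∀ j, x (.w' j) = 0 := fun j => hx _ one_ne_zero
  have hη : ∀ j, x (.eta j) = 0 := fun j => hx _ one_ne_zero
  have hs : ∀ i : Idx k r m, bas k r m i ∈ degSpan (bas k r m) Idx.par i.par :=
    fun i => basis_mem_degSpan _ _ rfl
  refine (exists_aut hkr lam kap (bas k r m) (shiftVec x) Idx.par hs ?_ ?_ ?_).imp
    fun φ h => ⟨h.1, h.2 .u⟩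
  · intro a
    cases a with
    | u => exact mem_degSpan_par.2 hx
    | e i => exact sub_mem (hs (.e i)) (smul_mem _ _ (hs .z))
    | e' i => exact sub_mem (hs (.e' i)) (smul_mem _ _ (hs .z))
    | z => exact hs _
    | w i => exact hs _
    | w' i => exact hs _
    | eta i => exact hs _
  · rw [Module.Basis.constr_basis]
    exact (bas k r m).ne_zero _
  · intro a b
    rw [bracket_bas]
    set f := (bas k r m).constr ℂ (shiftVec x) with hf
    have hfb : ∀ a, f (bas k r m a) = shiftVec x a := fun a => (bas k r m).constr_basis ℂ _ a
    clear_value f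
    have rz : bracket lam kap x (bas k r m .z) = 0 := by
      funext c
      cases c <;> simp [bracket_z, bracket_u, bracket_e, bracket_e', bracket_w, bracket_w',
        bracket_eta, -Pi.basisFun_apply, bas_apply]
    have re : ∀ i, bracket lam kap x (bas k r m (.e i)) =
        (lam i : ℂ) • (bas k r m (.e' i) - x (.e' i) • bas k r m .z) := by
      intro i
      funext c
      cases c <;> simp [bracket_e_z, bracket_u, bracket_e, bracket_e', bracket_w, bracket_w',
        bracket_eta, -Pi.basisFun_apply, bas_apply, hu] <;> grind
    have re' : ∀ i, bracket lam kap x (bas k r m (.e' i)) =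
        -(lam i : ℂ) • (bas k r m (.e i) - x (.e i) • bas k r m .z) := by
      intro i
      funext c
      cases c <;> simp [bracket_e'_z, bracket_u, bracket_e, bracket_e', bracket_w, bracket_w',
        bracket_eta, -Pi.basisFun_apply, bas_apply, hu] <;> grind
    have rw₁ : ∀ i, bracket lam kap x (bas k r m (.w i)) = (kap i : ℂ) • bas k r m (.w' i) := by
      intro i
      funext c
      cases c <;> simp [bracket_w_z, bracket_u, bracket_e, bracket_e', bracket_w, bracket_w',
        bracket_eta, -Pi.basisFun_apply, bas_apply, hu, hw] <;> grind
    have rw₂ : ∀ i, bracket lam kap x (bas k r m (.w' i)) = -(kap i : ℂ) • bas k r m (.w i) := by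
      intro i
      funext c
      cases c <;> simp [bracket_w'_z, bracket_u, bracket_e, bracket_e', bracket_w, bracket_w',
        bracket_eta, -Pi.basisFun_apply, bas_apply, hu, hw'] <;> grind
    have rη : ∀ i, bracket lam kap x (bas k r m (.eta i)) = 0 := by
      intro i
      funext c
      cases c <;> simp [bracket_eta_z, bracket_u, bracket_e, bracket_e', bracket_w, bracket_w',
        bracket_eta, -Pi.basisFun_apply, bas_apply, hη]
    have rx : bracket lam kap x x = 0 := by
      funext c
      cases c <;> simp [bracket_z, bracket_u, bracket_e, bracket_e', bracket_w, bracket_w',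
        bracket_eta, hw, hw', hη, mul_comm]
    have skew : ∀ i, bracket lam kap (bas k r m i) x = -bracket lam kap x (bas k r m i) := by
      intro i
      have := (heis_isLie k r m lam kap).skew 0 i.par x (bas k r m i)
        (mem_degSpan_par.2 hx) (hs i)
      rw [ZMod.val_zero, zero_mul, pow_zero, one_smul] at this
      exact (neg_eq_iff_eq_neg.2 this).symm
    cases a <;> cases b <;>
      simp only [table, apply_ite f, map_zero, map_neg, map_smul, hfb, shiftVec, map_sub,
        LinearMap.sub_apply, LinearMap.smul_apply, bracket_bas, rz, re, re', rw₁, rw₂, rη, rx,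
        skew, smul_zero, sub_zero, neg_zero, neg_smul, neg_neg]

/-- The span of the vectors `η_t`. -/
def etaSpace (k r m : ℕ) : Submodule ℂ (Space k r m) :=
  span ℂ (Set.range fun t => bas k r m (.eta t))

theorem mem_etaSpace {x : Space k r m} :
    x ∈ etaSpace k r m ↔ ∀ c, (∀ t, c ≠ .eta t) → x c = 0 := by
  have : (Set.range fun t => bas k r m (.eta t)) = bas k r m '' (Set.range .eta) := by
    rw [← Set.range_comp]
    rfl
  rw [etaSpace, this, Module.Basis.mem_span_image]
  constructor
  · intro h c hc
    by_contra hx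
    obtain ⟨t, ht⟩ := h (show c ∈ _ by simpa using hx)
    exact hc t ht.symm
  · intro h c hc
    by_contra hne
    have : x c ≠ 0 := by simpa using hc
    exact this (h c fun t ht => hne ⟨t, ht.symm⟩)

theorem finrank_etaSpace : Module.finrank ℂ (etaSpace k r m) = m - 2 * r := by
  rw [etaSpace, finrank_span_eq_card, Fintype.card_fin]
  exact (bas k r m).linearIndependent.comp _ fun a b h => by simpa using h

theorem bracket_eta_bas {c : Idx k r m} (h : ∀ t, table lam kap (.eta t) c = 0)
    {x : Space k r m} (hx : x ∈ etaSpace k r m) : bracket lam kap x (bas k r m c) = 0 := by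
  have : etaSpace k r m ≤ LinearMap.ker ((bracket lam kap).flip (bas k r m c)) := by
    refine span_le.2 ?_
    rintro _ ⟨t, rfl⟩
    rw [SetLike.mem_coe, LinearMap.mem_ker, LinearMap.flip_apply, bracket_bas, h]
  exact this hx

theorem bracket_bas_eta {c : Idx k r m} (h : ∀ t, table lam kap c (.eta t) = 0)
    {x : Space k r m} (hx : x ∈ etaSpace k r m) : bracket lam kap (bas k r m c) x = 0 := by
  have : etaSpace k r m ≤ LinearMap.ker (bracket lam kap (bas k r m c)) := by
    refine span_le.2 ?_
    rintro _ ⟨t, rfl⟩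
    rw [SetLike.mem_coe, LinearMap.mem_ker, bracket_bas, h]
  exact this hx

variable (lam kap) in
theorem bracket_etaSpace_bas {x : Space k r m} (hx : x ∈ etaSpace k r m) :
    bracket lam kap x (bas k r m .z) = 0 ∧ bracket lam kap x (bas k r m .u) = 0 ∧
      (∀ i, bracket lam kap x (bas k r m (.e i)) = 0) ∧
      (∀ i, bracket lam kap x (bas k r m (.e' i)) = 0) ∧
      (∀ i, bracket lam kap x (bas k r m (.w i)) = 0) ∧
      ∀ i, bracket lam kap x (bas k r m (.w' i)) = 0 :=
  ⟨bracket_eta_bas (fun _ => rfl) hx, bracket_eta_bas (fun _ => rfl) hx,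
    fun _ => bracket_eta_bas (fun _ => rfl) hx, fun _ => bracket_eta_bas (fun _ => rfl) hx,
    fun _ => bracket_eta_bas (fun _ => rfl) hx, fun _ => bracket_eta_bas (fun _ => rfl) hx⟩

variable (lam kap) in
theorem bracket_bas_etaSpace {x : Space k r m} (hx : x ∈ etaSpace k r m) :
    bracket lam kap (bas k r m .z) x = 0 ∧ bracket lam kap (bas k r m .u) x = 0 ∧
      (∀ i, bracket lam kap (bas k r m (.e i)) x = 0) ∧
      (∀ i, bracket lam kap (bas k r m (.e' i)) x = 0) ∧
      (∀ i, bracket lam kap (bas k r m (.w i)) x = 0) ∧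
      ∀ i, bracket lam kap (bas k r m (.w' i)) x = 0 :=
  ⟨bracket_bas_eta (fun _ => rfl) hx, bracket_bas_eta (fun _ => rfl) hx,
    fun _ => bracket_bas_eta (fun _ => rfl) hx, fun _ => bracket_bas_eta (fun _ => rfl) hx,
    fun _ => bracket_bas_eta (fun _ => rfl) hx, fun _ => bracket_bas_eta (fun _ => rfl) hx⟩

theorem etaSpace_le_odd : etaSpace k r m ≤ degSpan (bas k r m) Idx.par 1 := by
  refine span_le.2 ?_
  rintro _ ⟨t, rfl⟩
  exact basis_mem_degSpan _ _ rfl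

/-- The `η`-space is the odd part of the kernel of `ad u`, and both parity and the kernel of a
homogeneous map are respected by projections. -/
theorem proj_mem_etaSpace {d : G} (hd : bas k r m .u ∈ Γ.comp d) {x : Space k r m}
    (hx : x ∈ etaSpace k r m) (g : G) : Γ.proj g x ∈ etaSpace k r m := by
  have h1 := mem_degSpan_par.1 (Γ.proj_mem_parity (etaSpace_le_odd hx) g)
  have h2 := Γ.map_proj (adU_mem hd) g x
  rw [show adU lam kap x = 0 from bracket_bas_eta (fun t => rfl) hx, map_zero] at h2
  rw [mem_etaSpace]
  intro c hc
  rcases idx_cases c with ⟨j, rfl⟩ | ⟨j, rfl⟩ | rfl | rfl | ⟨t, rfl⟩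
  · simpa [adU_snd] using congrFun h2 (pairSnd j)
  · simpa [adU_fst] using congrFun h2 (pairFst j)
  · exact h1 _ (by simp [Idx.par])
  · exact h1 _ (by simp [Idx.par])
  · exact absurd rfl (hc t)

variable (lam kap) in
/-- The coefficient of `z` in the bracket of two elements. -/
def zForm : Space k r m →ₗ[ℂ] Space k r m →ₗ[ℂ] ℂ :=
  (bracket lam kap).compr₂ (LinearMap.proj .z)

theorem zForm_apply (x y : Space k r m) : zForm lam kap x y = bracket lam kap x y .z := rfl

theorem u_eq_zero_of_mem_etaSpace {x : Space k r m} (hx : x ∈ etaSpace k r m) : x .u = 0 :=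
  mem_etaSpace.1 hx _ (by simp)

theorem bracket_etaSpace {x y : Space k r m} (hx : x ∈ etaSpace k r m) (hy : y ∈ etaSpace k r m) :
    bracket lam kap x y = zForm lam kap x y • bas k r m .z :=
  bracket_of_u_eq_zero lam kap (u_eq_zero_of_mem_etaSpace hx) (u_eq_zero_of_mem_etaSpace hy)

theorem zForm_etaSpace {x : Space k r m} (hx : x ∈ etaSpace k r m) (y : Space k r m) :
    zForm lam kap x y = ∑ t, x (.eta t) * y (.eta t) := by
  rw [mem_etaSpace] at hx
  rw [zForm_apply, bracket_z, Finset.sum_eq_zero, Finset.sum_eq_zero, zero_add, zero_add]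
  · intro j _
    rw [hx (.w j) (by simp), hx (.w' j) (by simp)]
    ring
  · intro j _
    rw [hx (.e j) (by simp), hx (.e' j) (by simp)]
    ring

/-- The brackets on the `η`-space define a nondegenerate symmetric form with values in `ℂ z`, so
homogeneous vectors pair nontrivially only if their degrees add up to that of `z`. -/
theorem exists_hyperbolicSystem_eta (hkr : 1 ≤ k + r) {d : G} (hd : bas k r m .u ∈ Γ.comp d) :
    ∃ s t : ℕ, 2 * s + t = m - 2 * r ∧
      ∃ (P Q : Fin s → Space k r m) (Y : Fin t → Space k r m),
        HyperbolicSystem Γ (zForm lam kap) (etaSpace k r m) P Q Y := by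
  obtain ⟨gz, hgz⟩ := exists_z_mem Γ hkr
  refine exists_hyperbolicSystem Γ (zForm lam kap) gz _ _ finrank_etaSpace ?_ ?_ ?_ ?_
  · intro g h x y hx hy hxg hyh hne
    by_contra h0
    apply hne
    have h1 : bracket lam kap x y ∈ Γ.comp (g + h) := Γ.mul_mem g h x y hxg hyh
    rw [bracket_etaSpace hx hy] at h1
    exact Γ.eq_of_mem_of_mem ((bas k r m).ne_zero _) (((Γ.comp _).smul_mem_iff h0).1 h1) hgz
  · exact fun x hx g => proj_mem_etaSpace Γ hd hx g
  · intro x hx y hy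
    rw [zForm_etaSpace hx, zForm_etaSpace hy]
    exact Finset.sum_congr rfl fun t _ => mul_comm _ _
  · intro x hx h
    have hx' := mem_etaSpace.1 hx
    funext c
    by_cases hc : ∃ t, c = .eta t
    · obtain ⟨t, rfl⟩ := hc
      have := h (bas k r m (.eta t)) (subset_span ⟨t, rfl⟩)
      rwa [zForm_apply, bracket_eta_z] at this
    · exact hx' c fun t ht => hc ⟨t, ht⟩

/-! ### Automorphisms adapted to a grading -/

/-- The images of the basis `vec1` under an automorphism which only moves the `η_t`. -/
def etaVec {s t : ℕ} (P Q : Fin s → Space k r m) (Y : Fin t → Space k r m) :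
    Idx2 k r s t → Space k r m
  | .z => bas k r m .z
  | .u => bas k r m .u
  | .a i => bas k r m (.e i)
  | .a' i => bas k r m (.e' i)
  | .c j => bas k r m (.w j)
  | .c' j => bas k r m (.w' j)
  | .p i => P i
  | .q i => Q i
  | .y h => Y h

variable {Γ}

/-- A hyperbolic system has the same brackets as `p, q, y`, and the `η`-space commutes with all the
other basis vectors, which are kept fixed. -/
theorem exists_aut_eta (hkr : 1 ≤ k + r) {s : ℕ} (hs : 2 * s ≤ m - 2 * r)
    {P Q : Fin s → Space k r m} {Y : Fin (m - 2 * r - 2 * s) → Space k r m}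
    (h : HyperbolicSystem Γ (zForm lam kap) (etaSpace k r m) P Q Y) :
    ∃ φ ∈ (heis k r m lam kap).aut, ∀ a, φ (vec1 hs a) = etaVec P Q Y a := by
  have hsp : ∀ i : Idx k r m, bas k r m i ∈ degSpan (bas k r m) Idx.par i.par :=
    fun i => basis_mem_degSpan _ _ rfl
  have hfb : ∀ a, (basis1 hs).constr ℂ (etaVec P Q Y) (vec1 (k := k) hs a) = etaVec P Q Y a := by
    intro a
    rw [← basis1_apply, Module.Basis.constr_basis]
  refine (exists_aut hkr lam kap (basis1 hs) (etaVec P Q Y) Idx2.par ?_ ?_ ?_ ?_).imp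
    fun φ h => ⟨h.1, fun a => by rw [← basis1_apply, h.2]⟩
  · intro a
    rw [basis1_apply]
    exact vec1_par hs a
  · intro a
    cases a with
    | z => exact hsp .z
    | u => exact hsp .u
    | a i => exact hsp (.e i)
    | a' i => exact hsp (.e' i)
    | c i => exact hsp (.w i)
    | c' i => exact hsp (.w' i)
    | p i => exact etaSpace_le_odd (h.memP i)
    | q i => exact etaSpace_le_odd (h.memQ i)
    | y i => exact etaSpace_le_odd (h.memY i)
  · rw [show bas k r m .z = vec1 hs .z from rfl, hfb]
    exact (bas k r m).ne_zero _
  · intro a b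
    rw [basis1_apply, basis1_apply, bracket_vec1]
    set f := (basis1 (k := k) hs).constr ℂ (etaVec P Q Y) with hf
    have hz : f (bas k r m .z) = bas k r m .z := hfb .z
    have he : ∀ i, f (bas k r m (.e i)) = bas k r m (.e i) := fun i => hfb (.a i)
    have he' : ∀ i, f (bas k r m (.e' i)) = bas k r m (.e' i) := fun i => hfb (.a' i)
    have hw : ∀ i, f (bas k r m (.w i)) = bas k r m (.w i) := fun i => hfb (.c i)
    have hw' : ∀ i, f (bas k r m (.w' i)) = bas k r m (.w' i) := fun i => hfb (.c' i)
    clear_value f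
    have QP : ∀ i j, zForm lam kap (Q i) (P j) = if i = j then 1 else 0 := by
      intro i j
      rw [zForm_etaSpace (h.memQ i)]
      simp_rw [mul_comm (Q i _)]
      rw [← zForm_etaSpace (h.memP j) (lam := lam) (kap := kap), h.PQ]
      simp only [eq_comm]
    have YP : ∀ i j, zForm lam kap (Y i) (P j) = 0 := by
      intro i j
      rw [zForm_etaSpace (h.memY i)]
      simp_rw [mul_comm (Y i _)]
      rw [← zForm_etaSpace (h.memP j) (lam := lam) (kap := kap), h.PY]
    have YQ : ∀ i j, zForm lam kap (Y i) (Q j) = 0 := by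
      intro i j
      rw [zForm_etaSpace (h.memY i)]
      simp_rw [mul_comm (Y i _)]
      rw [← zForm_etaSpace (h.memQ j) (lam := lam) (kap := kap), h.QY]
    have ePP := fun i j => bracket_etaSpace (lam := lam) (kap := kap) (h.memP i) (h.memP j)
    have ePQ := fun i j => bracket_etaSpace (lam := lam) (kap := kap) (h.memP i) (h.memQ j)
    have ePY := fun i j => bracket_etaSpace (lam := lam) (kap := kap) (h.memP i) (h.memY j)
    have eQP := fun i j => bracket_etaSpace (lam := lam) (kap := kap) (h.memQ i) (h.memP j)
    have eQQ := fun i j => bracket_etaSpace (lam := lam) (kap := kap) (h.memQ i) (h.memQ j)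
    have eQY := fun i j => bracket_etaSpace (lam := lam) (kap := kap) (h.memQ i) (h.memY j)
    have eYP := fun i j => bracket_etaSpace (lam := lam) (kap := kap) (h.memY i) (h.memP j)
    have eYQ := fun i j => bracket_etaSpace (lam := lam) (kap := kap) (h.memY i) (h.memQ j)
    have eYY := fun i j => bracket_etaSpace (lam := lam) (kap := kap) (h.memY i) (h.memY j)
    have lP := fun i => bracket_bas_etaSpace lam kap (h.memP i)
    have lQ := fun i => bracket_bas_etaSpace lam kap (h.memQ i)
    have lY := fun i => bracket_bas_etaSpace lam kap (h.memY i)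
    have rP := fun i => bracket_etaSpace_bas lam kap (h.memP i)
    have rQ := fun i => bracket_etaSpace_bas lam kap (h.memQ i)
    have rY := fun i => bracket_etaSpace_bas lam kap (h.memY i)
    cases a <;> cases b <;>
      simp only [table1, apply_ite f, map_zero, map_smul, hz, he, he', hw, hw', etaVec,
        bracket_bas, table, ePP, ePQ, ePY, eQP, eQQ, eQY, eYP, eYQ, eYY, h.PP, h.QQ, h.PQ, QP,
        h.PY, h.QY, YP, YQ, h.YY, ite_smul, one_smul, zero_smul, lP, lQ, lY, rP, rQ, rY]

/-- The images of the basis vectors under an automorphism which rotates the pairs. -/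
def rotVec (a b : Fin k ⊕ Fin r → ℂ) : Idx k r m → Space k r m
  | .e i => a (.inl i) • bas k r m (.e i) + b (.inl i) • bas k r m (.e' i)
  | .e' i => (-b (.inl i)) • bas k r m (.e i) + a (.inl i) • bas k r m (.e' i)
  | .w i => a (.inr i) • bas k r m (.w i) + b (.inr i) • bas k r m (.w' i)
  | .w' i => (-b (.inr i)) • bas k r m (.w i) + a (.inr i) • bas k r m (.w' i)
  | c => bas k r m c

/-- A rotation has determinant 1 and is orthogonal, so it preserves the alternating form on `⟨e_i,
ê_i⟩` and the symmetric one on `⟨w_j, ŵ_j⟩`; it also commutes with `ad u`. -/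
theorem exists_aut_rot (hkr : 1 ≤ k + r) (lam : Fin k → ℂˣ) (kap : Fin r → ℂˣ)
    {a b : Fin k ⊕ Fin r → ℂ} (hab : ∀ j, a j ^ 2 + b j ^ 2 = 1) :
    ∃ φ ∈ (heis k r m lam kap).aut, ∀ c, φ (bas k r m c) = rotVec a b c := by
  have hs : ∀ i : Idx k r m, bas k r m i ∈ degSpan (bas k r m) Idx.par i.par :=
    fun i => basis_mem_degSpan _ _ rfl
  refine exists_aut hkr lam kap (bas k r m) (rotVec a b) Idx.par hs ?_ ?_ ?_
  · intro c
    cases c with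
    | z => exact hs _
    | u => exact hs _
    | e i => exact add_mem (smul_mem _ _ (hs (.e i))) (smul_mem _ _ (hs (.e' i)))
    | e' i => exact add_mem (smul_mem _ _ (hs (.e i))) (smul_mem _ _ (hs (.e' i)))
    | w i => exact add_mem (smul_mem _ _ (hs (.w i))) (smul_mem _ _ (hs (.w' i)))
    | w' i => exact add_mem (smul_mem _ _ (hs (.w i))) (smul_mem _ _ (hs (.w' i)))
    | eta i => exact hs _
  · rw [Module.Basis.constr_basis]
    exact (bas k r m).ne_zero _
  · intro c c'
    rw [bracket_bas]
    set f := (bas k r m).constr ℂ (rotVec a b) with hf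
    have hfb : ∀ a', f (bas k r m a') = rotVec a b a' := fun a => (bas k r m).constr_basis ℂ _ a
    clear_value f
    cases c <;> cases c' <;>
      simp only [table, apply_ite f, map_zero, map_smul, hfb, rotVec, map_add,
        LinearMap.add_apply, LinearMap.smul_apply, bracket_bas] <;>
      (try split_ifs) <;> (try subst_vars) <;>
      (try simp only [smul_zero, add_zero, zero_add]) <;>
      (try module) <;> (match_scalars; grind)

end

end

section

/-! ### The classification -/

/-- The image of `Γ₀` under `φ` refines `Γ`, so fineness makes their components equal. The lift is
needed because `IsFine` tests refinements by groups in the universe of `G`. -/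
theorem equivalent_of_adapted {A : Type*} [AddCommGroup A] [Module ℂ A] {S : Superalgebra A}
    {G : Type u} [AddCommGroup G] {H : Type} [AddCommGroup H] {Γ : Grading S G} (hΓ : Γ.IsFine)
    {Γ₀ : Grading S H} {ι : Type*} {b : Module.Basis ι ℂ A} (h₀ : Γ₀.IsLineGrading b)
    {φ : A ≃ₗ[ℂ] A} (hφ : φ ∈ S.aut) (hb : ∀ a, ∃ g, φ (b a) ∈ Γ.comp g) :
    Γ.Equivalent Γ₀ := by
  let Γ' : Grading S (ULift.{u} H) := (Γ₀.transport φ hφ).ulift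
  have hc : Γ'.components = Submodule.map (φ : A →ₗ[ℂ] A) '' Γ₀.components :=
    (Grading.components_ulift _).trans (Γ₀.components_transport φ hφ)
  have h' : Γ'.IsLineGrading (b.map φ) := by
    rw [Grading.IsLineGrading, hc, h₀, ← Set.range_comp]
    congr 1
    funext a
    simp only [Function.comp_apply, Submodule.map_span, Set.image_singleton, LinearEquiv.coe_coe,
      Module.Basis.map_apply]
  have e : Γ'.components = Γ.components :=
    hΓ _ Γ' (Grading.refines_of_basis h' fun a => by rw [Module.Basis.map_apply]; exact hb a)
  refine Grading.Equivalent.symm ⟨φ, (Grading.isEquivalence_iff _ _ _).2 ⟨hφ, ?_⟩⟩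
  rw [← hc, e]

variable {k r m s : ℕ}

theorem single_eq_single {M : Type*} [Zero M] {n : ℕ} {c : M} (hc : c ≠ 0) (i j : Fin n) :
    (Pi.single i c : Fin n → M) = Pi.single j c ↔ i = j := by
  refine ⟨fun h => ?_, fun h => by rw [h]⟩
  by_contra hne
  have := congrFun h i
  rw [Pi.single_eq_same, Pi.single_eq_of_ne hne] at this
  exact hc this

theorem single_one_ne_single {n : ℕ} (i j : Fin n) :
    (Pi.single i 1 : Fin n → ℤ) ≠ Pi.single j (-1) := by
  intro h
  have := congrFun h i
  simp only [Pi.single_eq_same, Pi.single_apply] at this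
  split_ifs at this
  norm_num at this

theorem deg1_injective {t : ℕ} : Function.Injective (deg1 (k := k) (r := r) (s := s) (t := t)) := by
  have h2 : (1 : ZMod 2) ≠ 0 := by decide
  have h02 : (0 : ZMod 4) ≠ 2 := by decide
  have h20 : (2 : ZMod 4) ≠ 0 := by decide
  have h13 : (1 : ZMod 4) ≠ 3 := by decide
  have h31 : (3 : ZMod 4) ≠ 1 := by decide
  have hn : (-1 : ℤ) ≠ 0 := by decide
  have h1 : (1 : ℤ) ≠ 0 := by decide
  intro a b
  cases a <;> cases b <;>
    simp [deg1, h02, h20, h13, h31, single_one_ne_single, (single_one_ne_single _ _).symm,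
      single_eq_single hn, single_eq_single h1, single_eq_single h2, Pi.single_eq_zero_iff]

theorem deg2_injective {t : ℕ} : Function.Injective (deg2 (k := k) (r := r) (s := s) (t := t)) := by
  have h2 : (1 : ZMod 2) ≠ 0 := by decide
  have hn : (-1 : ℤ) ≠ 0 := by decide
  have h1 : (1 : ℤ) ≠ 0 := by decide
  intro a b
  cases a <;> cases b <;>
    simp [deg2, single_one_ne_single, (single_one_ne_single _ _).symm,
      single_eq_single hn, single_eq_single h1, single_eq_single h2, Pi.single_eq_zero_iff]

theorem gamma1_isLineGrading (hs : 2 * s ≤ m - 2 * r) (lam : Fin k → ℂˣ) (kap : Fin r → ℂˣ) :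
    (gamma1 hs lam kap).IsLineGrading (basis1 hs) :=
  Grading.isLineGrading_ofBasis _ _ _ _ deg1_injective

theorem gamma2_isLineGrading (hs : 2 * s ≤ m - 2 * r) (lam : Fin k → ℂˣ) (kap : Fin r → ℂˣ) :
    (gamma2 hs lam kap).IsLineGrading (basis2 hs) :=
  Grading.isLineGrading_ofBasis _ _ _ _ deg2_injective

section

variable {lam : Fin k → ℂˣ} {kap : Fin r → ℂˣ}
  (hlam : ∀ i j, i ≠ j → ¬ IsOfFinOrder (lam i / lam j))
  (hkap : ∀ i j, i ≠ j → ¬ IsOfFinOrder (kap i / kap j))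

-- The dichotomy between the two families: `d = 0` leads to `vec2`, `d ≠ 0` to `vec1`.
include hlam hkap in
theorem exists_adapted_of_u_mem (hkr : 1 ≤ k + r) {G : Type*} [AddCommGroup G]
    (Γ : Grading (heis k r m lam kap) G) {d : G} (hd : bas k r m .u ∈ Γ.comp d) :
    ∃ (s : ℕ) (hs : 2 * s ≤ m - 2 * r),
      (∃ φ ∈ (heis k r m lam kap).aut, ∀ a, ∃ g, φ (vec1 hs a) ∈ Γ.comp g) ∨
      ∃ φ ∈ (heis k r m lam kap).aut, ∀ a, ∃ g, φ (vec2 hs a) ∈ Γ.comp g := by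
  obtain ⟨s, t, hst, P, Q, Y, h⟩ := exists_hyperbolicSystem_eta Γ hkr hd
  obtain rfl : t = m - 2 * r - 2 * s := by omega
  have hs : 2 * s ≤ m - 2 * r := by omega
  obtain ⟨gz, hgz⟩ := exists_z_mem Γ hkr
  obtain ⟨ψ, hψ, e⟩ := exists_aut_eta hkr hs h
  have eu : ψ (bas k r m .u) = bas k r m .u := e .u
  have ez : ψ (bas k r m .z) = bas k r m .z := e .z
  have ee : ∀ i, ψ (bas k r m (.e i)) = bas k r m (.e i) := fun i => e (.a i)
  have ee' : ∀ i, ψ (bas k r m (.e' i)) = bas k r m (.e' i) := fun i => e (.a' i)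
  have ew : ∀ i, ψ (bas k r m (.w i)) = bas k r m (.w i) := fun i => e (.c i)
  have ew' : ∀ i, ψ (bas k r m (.w' i)) = bas k r m (.w' i) := fun i => e (.c' i)
  have ep : ∀ i, ψ (pVec hs i) = P i := fun i => e (.p i)
  have eq : ∀ i, ψ (qVec hs i) = Q i := fun i => e (.q i)
  have ey : ∀ i, ψ (yVec hs i) = Y i := fun i => e (.y i)
  refine ⟨s, hs, ?_⟩
  by_cases hd0 : d = 0
  · subst hd0
    right
    refine ⟨ψ, hψ, fun a => ?_⟩
    -- The two square roots of `-1` give the two members of each pair of `vec2`, up to scale.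
    have hI := homogeneous_eigenvector hlam hkap hkr hd (hε := I_mul_I)
    have hI' := homogeneous_eigenvector hlam hkap hkr hd (hε := show -I * -I = -1 by simp)
    simp only [one_smul, neg_smul, ← sub_eq_add_neg] at hI hI'
    cases a <;> simp only [vec2, map_smul, map_add, map_sub, eu, ez, ee, ee', ew, ew', ep, eq, ey]
    · exact ⟨gz, hgz⟩
    · exact ⟨0, hd⟩
    · exact (hI (.inl _)).imp fun g hg => smul_mem _ _ hg
    · exact (hI' (.inl _)).imp fun g hg => smul_mem _ _ hg
    · exact (hI (.inr _)).imp fun g hg => smul_mem _ _ hg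
    · exact (hI' (.inr _)).imp fun g hg => smul_mem _ _ hg
    · exact h.homP _
    · exact h.homQ _
    · exact h.homY _
  · left
    choose a b hab h1 h2 using homogeneous_rotation hlam hkap hkr hd hd0
    obtain ⟨ρ, hρ, f⟩ := exists_aut_rot (m := m) hkr lam kap hab
    refine ⟨ψ * ρ, mul_mem hψ hρ, fun c => ?_⟩
    cases c <;> simp only [LinearEquiv.mul_apply, vec1, pVec, qVec, yVec, map_smul, map_add,
      map_sub, f, rotVec, eu, ez, ee, ee', ew, ew']
    · exact ⟨gz, hgz⟩
    · exact ⟨d, hd⟩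
    · exact h1 (.inl _)
    · exact h2 (.inl _)
    · exact h1 (.inr _)
    · exact h2 (.inr _)
    · rw [← map_smul, ← map_add, ← map_smul]
      exact (ep _).symm ▸ h.homP _
    · rw [← map_smul, ← map_sub, ← map_smul]
      exact (eq _).symm ▸ h.homQ _
    · exact (ey _).symm ▸ h.homY _

-- The grading is pulled back along an automorphism sending `u` to a homogeneous element, and the
-- adapted basis is carried over again.
include hlam hkap in
theorem exists_adapted (hkr : 1 ≤ k + r) {G : Type*} [AddCommGroup G]
    (Γ : Grading (heis k r m lam kap) G) :
    ∃ (s : ℕ) (hs : 2 * s ≤ m - 2 * r),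
      (∃ φ ∈ (heis k r m lam kap).aut, ∀ a, ∃ g, φ (vec1 hs a) ∈ Γ.comp g) ∨
      ∃ φ ∈ (heis k r m lam kap).aut, ∀ a, ∃ g, φ (vec2 hs a) ∈ Γ.comp g := by
  obtain ⟨d, x, hxd, hu, hx⟩ := exists_homogeneous_u Γ
  obtain ⟨φ, hφ, e⟩ := exists_aut_u hkr lam kap x hu hx
  have hd : bas k r m .u ∈ (Γ.transport φ⁻¹ (inv_mem hφ)).comp d := by
    refine ⟨x, hxd, ?_⟩
    rw [← e]
    exact φ.symm_apply_apply _
  have key : ∀ g y, y ∈ (Γ.transport φ⁻¹ (inv_mem hφ)).comp g → φ y ∈ Γ.comp g := by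
    rintro g _ ⟨x, hx, rfl⟩
    rw [LinearEquiv.coe_coe, show φ (φ⁻¹ x) = x from φ.apply_symm_apply x]
    exact hx
  obtain ⟨s, hs, ⟨ψ, hψ, h⟩ | ⟨ψ, hψ, h⟩⟩ := exists_adapted_of_u_mem hlam hkap hkr _ hd
  · exact ⟨s, hs, .inl ⟨φ * ψ, mul_mem hφ hψ, fun a => (h a).imp fun g hg => key g _ hg⟩⟩
  · exact ⟨s, hs, .inr ⟨φ * ψ, mul_mem hφ hψ, fun a => (h a).imp fun g hg => key g _ hg⟩⟩

include hlam hkap in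
theorem isFine_iff (hkr : 1 ≤ k + r) {G : Type u} [AddCommGroup G]
    (Γ : Grading (heis k r m lam kap) G) :
    Γ.IsFine ↔ ∃ (s : ℕ) (hs : 2 * s ≤ m - 2 * r),
      Γ.Equivalent (gamma1 hs lam kap) ∨ Γ.Equivalent (gamma2 hs lam kap) := by
  constructor
  · intro hΓ
    obtain ⟨s, hs, ⟨φ, hφ, h⟩ | ⟨φ, hφ, h⟩⟩ := exists_adapted hlam hkap hkr Γ
    · refine ⟨s, hs, .inl ?_⟩
      exact equivalent_of_adapted hΓ (gamma1_isLineGrading hs lam kap) hφ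
        fun a => by rw [basis1_apply]; exact h a
    · refine ⟨s, hs, .inr ?_⟩
      exact equivalent_of_adapted hΓ (gamma2_isLineGrading hs lam kap) hφ
        fun a => by rw [basis2_apply]; exact h a
  · rintro ⟨s, hs, h | h⟩
    · exact Γ.isFine_of_isAtom
        (Grading.isAtom_of_equivalent h.symm (gamma1_isLineGrading hs lam kap).isAtom)
    · exact Γ.isFine_of_isAtom
        (Grading.isAtom_of_equivalent h.symm (gamma2_isLineGrading hs lam kap).isAtom)

end

end

section

/-! ### Signed permutations of the labels -/

theorem mul_eq_one_iff_zmod (x y : Multiplicative (ZMod 2)) : x * y = 1 ↔ (x = 1 ↔ y = 1) := by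
  revert x y
  decide

/-- Choose the first alternative if the sign is trivial. -/
def pick {α : Type*} (x : Multiplicative (ZMod 2)) (a b : α) : α := if x = 1 then a else b

variable {k r d s t : ℕ}

/-- The label obtained from another one by a signed permutation. -/
def permIdxFun (ι : Fin k ⊕ Fin r → Fin d) (x : SignedPerm d s t) : Idx2 k r s t → Idx2 k r s t
  | .z => .z
  | .u => .u
  | .a i => pick (x.left (.inl (ι (.inl i)))) (.a i) (.a' i)
  | .a' i => pick (x.left (.inl (ι (.inl i)))) (.a' i) (.a i)
  | .c j => pick (x.left (.inl (ι (.inr j)))) (.c j) (.c' j)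
  | .c' j => pick (x.left (.inl (ι (.inr j)))) (.c' j) (.c j)
  | .p i => pick (x.left (.inr (x.right.1 i))) (.p (x.right.1 i)) (.q (x.right.1 i))
  | .q i => pick (x.left (.inr (x.right.1 i))) (.q (x.right.1 i)) (.p (x.right.1 i))
  | .y h => .y (x.right.2 h)

theorem permHom_inl (g : Equiv.Perm (Fin s) × Equiv.Perm (Fin t))
    (f : Fin d ⊕ Fin s → Multiplicative (ZMod 2)) (i : Fin d) :
    permHom d s t g f (.inl i) = f (.inl i) := rfl

theorem permHom_inr (g : Equiv.Perm (Fin s) × Equiv.Perm (Fin t))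
    (f : Fin d ⊕ Fin s → Multiplicative (ZMod 2)) (i : Fin s) :
    permHom d s t g f (.inr (g.1 i)) = f (.inr i) := by
  change f (.inr (g.1.symm (g.1 i))) = _
  rw [Equiv.symm_apply_apply]

/-- The action of signed permutations on the labels; the signs of the pairs `a_i, a'_i` and
`c_j, c'_j` are governed by the map `ι`. -/
def permIdx (ι : Fin k ⊕ Fin r → Fin d) : SignedPerm d s t →* Equiv.Perm (Idx2 k r s t) :=
  MonoidHom.toHomPerm
    { toFun := permIdxFun ι
      map_one' := by
        funext a
        change _ = a
        cases a <;> simp [permIdxFun, pick]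
      map_mul' := by
        intro x y
        funext a
        change _ = permIdxFun ι x (permIdxFun ι y a)
        cases a <;>
          simp only [permIdxFun, pick, SemidirectProduct.mul_left, SemidirectProduct.mul_right,
            Pi.mul_apply, permHom_inl, mul_eq_one_iff_zmod, Prod.fst_mul, Prod.snd_mul,
            Equiv.Perm.mul_apply, permHom_inr] <;>
          split_ifs <;> simp_all }

theorem permIdx_apply (ι : Fin k ⊕ Fin r → Fin d) (x : SignedPerm d s t) (a : Idx2 k r s t) :
    permIdx ι x a = permIdxFun ι x a := rfl

/-- Surjectivity of `ι` ensures that every sign in `Fin d` is visible on some pair. -/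
theorem permIdx_injective {ι : Fin k ⊕ Fin r → Fin d} (hι : Function.Surjective ι) :
    Function.Injective (permIdx (s := s) (t := t) ι) := by
  rw [injective_iff_map_eq_one]
  intro x hx
  have h : ∀ a, permIdxFun ι x a = a := fun a => congrArg (fun f : Equiv.Perm _ => f a) hx
  have hp : ∀ i, x.right.1 i = i ∧ x.left (.inr i) = 1 := by
    intro i
    have := h (.p i)
    simp only [permIdxFun, pick] at this
    split_ifs at this with h1
    injection this with h2
    exact ⟨h2, by rwa [h2] at h1⟩
  have hl : ∀ j, x.left (.inl j) = 1 := by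
    intro j
    obtain ⟨j, rfl⟩ := hι j
    cases j with
    | inl i =>
      have := h (.a i)
      simp only [permIdxFun, pick] at this
      split_ifs at this with h1
      exact h1
    | inr i =>
      have := h (.c i)
      simp only [permIdxFun, pick] at this
      split_ifs at this with h1
      exact h1
  refine SemidirectProduct.ext ?_ (Prod.ext ?_ ?_)
  · funext j
    cases j with
    | inl j => exact hl j
    | inr j => exact (hp j).2
  · exact Equiv.ext fun i => (hp i).1
  · refine Equiv.ext fun i => ?_
    have := h (.y i)
    simp only [permIdxFun] at this
    injection this

/-- The labels of the basis vectors in the span of the `η_t`. -/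
def Idx2.IsEta : Idx2 k r s t → Prop
  | .p _ => True
  | .q _ => True
  | .y _ => True
  | _ => False

/-- The label which pairs nontrivially with a label in the span of the `η_t`. -/
def Idx2.dual : Idx2 k r s t → Idx2 k r s t
  | .p i => .q i
  | .q i => .p i
  | b => b

/-- The first label of each pair. -/
def fst2 : Fin k ⊕ Fin r → Idx2 k r s t
  | .inl i => .a i
  | .inr j => .c j

/-- The second label of each pair. -/
def snd2 : Fin k ⊕ Fin r → Idx2 k r s t
  | .inl i => .a' i
  | .inr j => .c' j

/-- Among the `η`-labels, the `y` are exactly the fixed points of the duality. -/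
theorem exists_map_y_eq {s' t' : ℕ} {σ : Idx2 k r s t → Idx2 k r s' t'}
    (hη : ∀ a, a.IsEta → (σ a).IsEta) (hdual : ∀ a, a.IsEta → σ a.dual = (σ a).dual)
    (h : Fin t) : ∃ h', σ (.y h) = .y h' := by
  have h1 := hη (.y h) trivial
  have h2 := hdual (.y h) trivial
  rw [show (Idx2.y h : Idx2 k r s t).dual = .y h from rfl] at h2
  cases e : σ (.y h) <;> rw [e] at h1 h2 <;> simp_all [Idx2.IsEta, Idx2.dual]

theorem card_y_le {s' t' : ℕ} {σ : Idx2 k r s t → Idx2 k r s' t'} (hσ : Function.Injective σ)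
    (hη : ∀ a, a.IsEta → (σ a).IsEta) (hdual : ∀ a, a.IsEta → σ a.dual = (σ a).dual) :
    t ≤ t' := by
  choose f hf using exists_map_y_eq hη hdual
  have : Function.Injective f := by
    intro i j hij
    have := hσ ((hf i).trans ((congrArg Idx2.y hij).trans (hf j).symm))
    injection this
  simpa using Fintype.card_le_of_injective f this

/-- A permutation of the `η`-labels commuting with the duality permutes the `y` and acts on the
pairs `{p_i, q_i}` by a signed permutation. -/
theorem mem_range_permIdx {ι : Fin k ⊕ Fin r → Fin d} {σ : Equiv.Perm (Idx2 k r s t)}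
    (hz : σ .z = .z) (hu : σ .u = .u) (hη : ∀ a, a.IsEta → (σ a).IsEta)
    (hdual : ∀ a, a.IsEta → σ a.dual = (σ a).dual) {ε : Fin d → Multiplicative (ZMod 2)}
    (hfst : ∀ j, σ (fst2 j) = pick (ε (ι j)) (fst2 j) (snd2 j))
    (hsnd : ∀ j, σ (snd2 j) = pick (ε (ι j)) (snd2 j) (fst2 j)) :
    σ ∈ (permIdx ι).range := by
  choose f hf using exists_map_y_eq hη hdual
  have hfi : Function.Injective f := by
    intro i j hij
    have := σ.injective ((hf i).trans ((congrArg Idx2.y hij).trans (hf j).symm))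
    injection this
  have hq : ∀ i, σ (.q i) = (σ (.p i)).dual := fun i => hdual (.p i) trivial
  have hp : ∀ i, ∃ j, σ (.p i) = .p j ∨ σ (.p i) = .q j := by
    intro i
    have h1 := hη (.p i) trivial
    cases e : σ (.p i) with
    | p j => exact ⟨j, .inl rfl⟩
    | q j => exact ⟨j, .inr rfl⟩
    | y j =>
      -- If `p i` went to a self-dual label, so would `q i`, against injectivity.
      have h2 := hq i
      rw [e] at h2
      have := σ.injective (h2.trans e.symm)
      simp at this
    | _ => rw [e] at h1; exact h1.elim
  choose g hg using hp
  have hgi : Function.Injective g := by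
    intro i j hij
    have key : σ (.p i) = σ (.p j) ∨ σ (.p i) = (σ (.p j)).dual := by
      rcases hg i with h1 | h1 <;> rcases hg j with h2 | h2 <;> rw [h1, h2, hij] <;>
        simp [Idx2.dual]
    rcases key with h | h
    · have := σ.injective h
      injection this
    · rw [← hq] at h
      have := σ.injective h
      simp at this
  let π : Equiv.Perm (Fin s) := Equiv.ofBijective g (Finite.injective_iff_bijective.1 hgi)
  let ρ : Equiv.Perm (Fin t) := Equiv.ofBijective f (Finite.injective_iff_bijective.1 hfi)
  classical
  -- In the semidirect product the permutation acts before the sign, so signs are indexed by the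
  -- image; hence `π.symm j`.
  let δ : Fin s → Multiplicative (ZMod 2) := fun j =>
    if σ (.p (π.symm j)) = .p j then 1 else Multiplicative.ofAdd 1
  have hδ : ∀ i, σ (.p i) = pick (δ (g i)) (.p (g i)) (.q (g i)) := by
    intro i
    have e : π.symm (g i) = i := π.symm_apply_apply i
    simp only [δ, e, pick]
    rcases hg i with h | h <;> rw [h] <;> simp
  refine ⟨⟨Sum.elim ε δ, (π, ρ)⟩, ?_⟩
  ext a
  rw [permIdx_apply]
  cases a with
  | z => exact hz.symm
  | u => exact hu.symm
  | a i => exact (hfst (.inl i)).symm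
  | a' i => exact (hsnd (.inl i)).symm
  | c i => exact (hfst (.inr i)).symm
  | c' i => exact (hsnd (.inr i)).symm
  | p i => exact (hδ i).symm
  | q i =>
    rw [hq, hδ]
    change pick (δ (g i)) _ _ = _
    simp only [pick]
    split_ifs <;> rfl
  | y i => exact (hf i).symm

end

section

/-! ### Adapted bases -/

variable {k r m s t : ℕ}

/-- The formal properties shared by the bases of `Γ₁^s` and `Γ₂^s`. -/
structure Adapted (lam : Fin k → ℂˣ) (kap : Fin r → ℂˣ)
    (b : Module.Basis (Idx2 k r s t) ℂ (Space k r m)) : Prop where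
  z : b .z = bas k r m .z
  u : b .u = bas k r m .u
  u_coord : ∀ a, a ≠ .u → b a .u = 0
  par : ∀ a, b a ∈ degSpan (bas k r m) Idx.par a.par
  eta_mem : ∀ a : Idx2 k r s t, a.IsEta → b a ∈ etaSpace k r m
  eta : ∀ a a' : Idx2 k r s t, a.IsEta → a'.IsEta →
    bracket lam kap (b a) (b a') = if a' = a.dual then bas k r m .z else 0
  fst : ∀ j, adU lam kap (adU lam kap (b (fst2 j))) = -(pairScale lam kap j : ℂ) ^ 2 • b (fst2 j)
  snd : ∀ j, adU lam kap (adU lam kap (b (snd2 j))) = -(pairScale lam kap j : ℂ) ^ 2 • b (snd2 j)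

theorem idx2_cases (a : Idx2 k r s t) :
    (∃ j, a = fst2 j) ∨ (∃ j, a = snd2 j) ∨ a = .z ∨ a = .u ∨ a.IsEta := by
  cases a with
  | z => simp
  | u => simp
  | a i => exact .inl ⟨.inl i, rfl⟩
  | a' i => exact .inr (.inl ⟨.inl i, rfl⟩)
  | c i => exact .inl ⟨.inr i, rfl⟩
  | c' i => exact .inr (.inl ⟨.inr i, rfl⟩)
  | _ => simp [Idx2.IsEta]

theorem fst2_ne_snd2 (j j' : Fin k ⊕ Fin r) : (fst2 j : Idx2 k r s t) ≠ snd2 j' := by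
  cases j <;> cases j' <;> simp [fst2, snd2]

section

variable {lam : Fin k → ℂˣ} {kap : Fin r → ℂˣ}

theorem adU_basis1_fst (hs : 2 * s ≤ m - 2 * r) (j : Fin k ⊕ Fin r) :
    adU lam kap (basis1 hs (fst2 j)) = (pairScale lam kap j : ℂ) • basis1 hs (snd2 j) := by
  rw [basis1_apply, basis1_apply]
  refine (bracket_vec1 hs lam kap .u (fst2 j)).trans ?_
  cases j <;> rfl

theorem adU_basis1_snd (hs : 2 * s ≤ m - 2 * r) (j : Fin k ⊕ Fin r) :
    adU lam kap (basis1 hs (snd2 j)) = -(pairScale lam kap j : ℂ) • basis1 hs (fst2 j) := by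
  rw [basis1_apply, basis1_apply]
  refine (bracket_vec1 hs lam kap .u (snd2 j)).trans ?_
  cases j <;> rfl

theorem adU_basis2_fst (hs : 2 * s ≤ m - 2 * r) (j : Fin k ⊕ Fin r) :
    adU lam kap (basis2 hs (fst2 j)) = (-I * pairScale lam kap j : ℂ) • basis2 hs (fst2 j) := by
  rw [basis2_apply]
  refine (bracket_vec2 hs lam kap .u (fst2 j)).trans ?_
  cases j <;> rfl

theorem adU_basis2_snd (hs : 2 * s ≤ m - 2 * r) (j : Fin k ⊕ Fin r) :
    adU lam kap (basis2 hs (snd2 j)) = (I * pairScale lam kap j : ℂ) • basis2 hs (snd2 j) := by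
  rw [basis2_apply]
  refine (bracket_vec2 hs lam kap .u (snd2 j)).trans ?_
  cases j <;> rfl

theorem adapted_basis1 (hs : 2 * s ≤ m - 2 * r) : Adapted lam kap (basis1 (k := k) hs) where
  z := basis1_apply hs _
  u := basis1_apply hs _
  u_coord a ha := by
    rw [basis1_apply]
    cases a <;> simp_all [vec1, pVec, qVec, yVec]
  par a := by
    rw [basis1_apply]
    exact vec1_par hs a
  eta_mem a ha := by
    rw [basis1_apply, mem_etaSpace]
    intro c hc
    cases a <;> simp_all [vec1, pVec, qVec, yVec, Idx2.IsEta]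
  eta a a' ha ha' := by
    rw [basis1_apply, basis1_apply, bracket_vec1]
    cases a <;> cases a' <;> simp_all [table1, Idx2.IsEta, Idx2.dual, eq_comm]
  fst j := by
    rw [adU_basis1_fst, map_smul, adU_basis1_snd, smul_smul]
    congr 1
    ring
  snd j := by
    rw [adU_basis1_snd, map_smul, adU_basis1_fst, smul_smul]
    congr 1
    ring

theorem adapted_basis2 (hs : 2 * s ≤ m - 2 * r) : Adapted lam kap (basis2 (k := k) hs) where
  z := basis2_apply hs _
  u := basis2_apply hs _
  u_coord a ha := by
    rw [basis2_apply]
    cases a <;> simp_all [vec2, pVec, qVec, yVec]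
  par a := by
    rw [basis2_apply]
    exact vec2_par hs a
  eta_mem a ha := by
    rw [basis2_apply, mem_etaSpace]
    intro c hc
    cases a <;> simp_all [vec2, pVec, qVec, yVec, Idx2.IsEta]
  eta a a' ha ha' := by
    rw [basis2_apply, basis2_apply, bracket_vec2]
    cases a <;> cases a' <;> simp_all [table2, Idx2.IsEta, Idx2.dual, eq_comm]
  fst j := by
    rw [adU_basis2_fst, map_smul, adU_basis2_fst, smul_smul]
    congr 1
    linear_combination (pairScale lam kap j : ℂ) ^ 2 * I_sq
  snd j := by
    rw [adU_basis2_snd, map_smul, adU_basis2_snd, smul_smul]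
    congr 1
    linear_combination (pairScale lam kap j : ℂ) ^ 2 * I_sq

/-! ### Automorphisms -/

theorem aut_bracket {φ : Space k r m ≃ₗ[ℂ] Space k r m} (hφ : φ ∈ (heis k r m lam kap).aut)
    (x y : Space k r m) : φ (bracket lam kap x y) = bracket lam kap (φ x) (φ y) := hφ.1 x y

theorem aut_parity {φ : Space k r m ≃ₗ[ℂ] Space k r m} (hφ : φ ∈ (heis k r m lam kap).aut)
    {p : ZMod 2} {x : Space k r m} (hx : x ∈ degSpan (bas k r m) Idx.par p) :
    φ x ∈ degSpan (bas k r m) Idx.par p := by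
  have h : φ x ∈ (degSpan (bas k r m) Idx.par p).map (φ : Space k r m →ₗ[ℂ] Space k r m) :=
    ⟨x, hx, rfl⟩
  rwa [show (degSpan (bas k r m) Idx.par p).map (φ : Space k r m →ₗ[ℂ] Space k r m) =
    degSpan (bas k r m) Idx.par p from hφ.2 p] at h

theorem bracket_z_left (y : Space k r m) : bracket lam kap (bas k r m .z) y = 0 := by
  refine LinearMap.congr_fun (f := bracket lam kap (bas k r m .z)) (g := 0) ?_ y
  refine (bas k r m).ext fun a => ?_
  rw [bracket_bas]
  cases a <;> rfl

theorem bracket_z_right (y : Space k r m) : bracket lam kap y (bas k r m .z) = 0 := by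
  refine LinearMap.congr_fun (f := (bracket lam kap).flip (bas k r m .z)) (g := 0) ?_ y
  refine (bas k r m).ext fun a => ?_
  rw [LinearMap.flip_apply, bracket_bas]
  cases a <;> rfl

/-- The first bracket lands in the hyperplane of zero `u`-coordinate, the second in `ℂ z`, the third
vanishes. -/
theorem ad_pow_three_eq_zero {x : Space k r m} (hx : x .u = 0) (y : Space k r m) :
    bracket lam kap x (bracket lam kap x (bracket lam kap x y)) = 0 := by
  rw [bracket_of_u_eq_zero lam kap hx (bracket_u lam kap x y), map_smul, bracket_z_right,
    smul_zero]

theorem nonempty_pair (hkr : 1 ≤ k + r) : Nonempty (Fin k ⊕ Fin r) := by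
  rw [← Fintype.card_pos_iff, Fintype.card_sum, Fintype.card_fin, Fintype.card_fin]
  omega

theorem bracket_fst_coord (j : Fin k ⊕ Fin r) (x y : Space k r m) (hy : y .u = 0) :
    bracket lam kap x y (pairFst j) = -(pairScale lam kap j * x .u * y (pairSnd j)) := by
  cases j <;> simp [pairFst, pairSnd, bracket_e, bracket_w, pairScale, hy] <;> ring

theorem bracket_snd_coord (j : Fin k ⊕ Fin r) (x y : Space k r m) (hy : y .u = 0) :
    bracket lam kap x y (pairSnd j) = pairScale lam kap j * x .u * y (pairFst j) := by
  cases j <;> simp [pairFst, pairSnd, bracket_e', bracket_w', pairScale, hy] <;> ring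

/-- The hyperplane of zero `u`-coordinate is characteristic: its elements have `ad³ = 0`, whereas an
element with nonzero `u`-coordinate keeps rotating the pairs. -/
theorem aut_u_coord_of_eq_zero (hkr : 1 ≤ k + r) {φ : Space k r m ≃ₗ[ℂ] Space k r m}
    (hφ : φ ∈ (heis k r m lam kap).aut) {x : Space k r m} (hx : x .u = 0) : φ x .u = 0 := by
  obtain ⟨j⟩ := nonempty_pair hkr
  by_contra h
  have h1 : ∀ y, bracket lam kap (φ x) (bracket lam kap (φ x) (bracket lam kap (φ x) y)) = 0 := by
    intro y
    obtain ⟨y, rfl⟩ := φ.surjective y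
    rw [← aut_bracket hφ, ← aut_bracket hφ, ← aut_bracket hφ, ad_pow_three_eq_zero hx, map_zero]
  have h2 := congrFun (h1 (bas k r m (pairFst j))) (pairSnd j)
  have h3 : (bas k r m (pairFst j) : Space k r m) .u = 0 := by
    cases j <;> simp [pairFst]
  rw [bracket_snd_coord j _ _ (bracket_u _ _ _ _), bracket_fst_coord j _ _ (bracket_u _ _ _ _),
    bracket_snd_coord j _ _ h3] at h2
  simp [h] at h2

end

/-! ### Rigidity of the relabellings induced by equivalences. -/

section

variable {lam : Fin k → ℂˣ} {kap : Fin r → ℂˣ} {s' t' : ℕ}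
  {b : Module.Basis (Idx2 k r s t) ℂ (Space k r m)}
  {b' : Module.Basis (Idx2 k r s' t') ℂ (Space k r m)}
  (hb : Adapted lam kap b) (hb' : Adapted lam kap b') (hkr : 1 ≤ k + r)
  {φ : Space k r m ≃ₗ[ℂ] Space k r m} (hφ : φ ∈ (heis k r m lam kap).aut)
  {σ : Idx2 k r s t ≃ Idx2 k r s' t'} (hσ : ∀ a, ∃ c : ℂ, c ≠ 0 ∧ φ (b a) = c • b' (σ a))

include hb hb' hkr hφ hσ

/-- `u` is the only label outside an invariant hyperplane. -/
theorem map_u_eq : σ .u = .u := by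
  obtain ⟨a, ha⟩ := σ.surjective .u
  by_contra hne
  have hau : a ≠ .u := by
    rintro rfl
    exact hne ha
  obtain ⟨c, hc, e⟩ := hσ a
  have h := aut_u_coord_of_eq_zero hkr hφ (hb.u_coord a hau)
  rw [e, ha, hb'.u] at h
  simp [hc] at h

theorem map_z_eq : σ .z = .z := by
  have h1 := map_u_eq hb hb' hkr hφ hσ
  obtain ⟨c, hc, e⟩ := hσ .z
  have hne : σ .z ≠ .u := by
    rw [← h1]
    exact fun h => by simpa using σ.injective h
  have h2 := eq_smul_z lam kap (b' (σ .z)) (hb'.u_coord _ hne) fun y _ => by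
    obtain ⟨y, rfl⟩ := φ.surjective y
    have : c • bracket lam kap (b' (σ .z)) (φ y) = 0 := by
      rw [← LinearMap.smul_apply, ← map_smul, ← e, ← aut_bracket hφ, hb.z, bracket_z_left, map_zero]
    rw [(smul_eq_zero.1 this).resolve_left hc]
    rfl
  rw [← hb'.z] at h2
  exact Grading.index_unique one_ne_zero (by rw [one_smul]; exact h2)

theorem exists_smul_u : ∃ c : ℂ, c ≠ 0 ∧ φ (bas k r m .u) = c • bas k r m .u := by
  obtain ⟨c, hc, e⟩ := hσ .u
  rw [map_u_eq hb hb' hkr hφ hσ, hb.u, hb'.u] at e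
  exact ⟨c, hc, e⟩

omit hb hb' hkr hσ in
theorem map_adU {c : ℂ} (hc : φ (bas k r m .u) = c • bas k r m .u) (x : Space k r m) :
    φ (adU lam kap x) = c • adU lam kap (φ x) := by
  rw [adU, aut_bracket hφ, hc, map_smul, LinearMap.smul_apply]

omit hkr in
theorem par_map (a : Idx2 k r s t) : (σ a).par = a.par := by
  obtain ⟨c, hc, e⟩ := hσ a
  have h1 := aut_parity hφ (hb.par a)
  rw [e, smul_mem_iff _ hc] at h1
  by_contra hne
  have h2 := (Grading.ofParity (heis k r m lam kap)).proj_of_mem_ne (hb'.par (σ a)) hne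
  have h3 := (Grading.ofParity (heis k r m lam kap)).proj_of_mem h1
  exact b'.ne_zero _ (h3.symm.trans h2)

variable (hlam : ∀ i j, i ≠ j → ¬ IsOfFinOrder (lam i / lam j))
  (hkap : ∀ i j, i ≠ j → ¬ IsOfFinOrder (kap i / kap j))

-- `φ` turns `(ad u)²` into `c² (ad u)²`, so eigenvalues are compared up to `c²`. A nonzero one
-- cannot land on `z`, `u` or an `η`-label, where `ad u` vanishes.
omit hb hkr in
theorem exists_pair_of_sq {c : ℂ} (hc : φ (bas k r m .u) = c • bas k r m .u) {a : Idx2 k r s t}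
    {μ : ℂ} (hμ : μ ≠ 0)
    (ha : adU lam kap (adU lam kap (b a)) = -μ ^ 2 • b a) :
    ∃ j', (σ a = fst2 j' ∨ σ a = snd2 j') ∧ μ ^ 2 = c ^ 2 * (pairScale lam kap j' : ℂ) ^ 2 := by
  obtain ⟨c', hc', e⟩ := hσ a
  have h1 := congrArg φ ha
  rw [map_adU hφ hc, map_adU hφ hc, map_smul, map_smul, e, map_smul, map_smul, smul_smul,
    smul_smul, smul_smul] at h1
  have hne : adU lam kap (adU lam kap (b' (σ a))) ≠ 0 := by
    intro h
    rw [h, smul_zero] at h1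
    refine smul_ne_zero (mul_ne_zero ?_ hc') (b'.ne_zero _) h1.symm
    simpa using hμ
  have hν : ∀ ν : ℂ, adU lam kap (adU lam kap (b' (σ a))) = -ν ^ 2 • b' (σ a) →
      μ ^ 2 = c ^ 2 * ν ^ 2 := by
    intro ν h
    rw [h, smul_smul, ← sub_eq_zero, ← sub_smul] at h1
    have := (smul_eq_zero.1 h1).resolve_right (b'.ne_zero _)
    apply mul_right_cancel₀ hc'
    linear_combination this
  rcases idx2_cases (σ a) with ⟨j', h⟩ | ⟨j', h⟩ | h | h | h
  · exact ⟨j', .inl h, hν _ (h ▸ hb'.fst j')⟩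
  · exact ⟨j', .inr h, hν _ (h ▸ hb'.snd j')⟩
  · exfalso
    apply hne
    rw [h, hb'.z, adU, bracket_z_right, map_zero]
  · exfalso
    apply hne
    rw [h, hb'.u, adU, bracket_bas]
    simp [table]
  · exfalso
    apply hne
    rw [adU, bracket_bas_eta (fun t => rfl) (hb'.eta_mem _ h), map_zero]

include hlam hkap in
/-- The essential rigidity: equivalences act on `u` by a sign and preserve each pair. -/
theorem pair_rigidity {c : ℂ} (hc : φ (bas k r m .u) = c • bas k r m .u) : c ^ 2 = 1 ∧
    (∀ j, σ (fst2 j) = fst2 j ∨ σ (fst2 j) = snd2 j) ∧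
    ∀ j, σ (snd2 j) = fst2 j ∨ σ (snd2 j) = snd2 j := by
  have hc0 : c ≠ 0 := by
    rintro rfl
    rw [zero_smul] at hc
    exact (bas k r m).ne_zero _ (φ.map_eq_zero_iff.1 hc)
  have hpar1 : ∀ j, (fst2 j : Idx2 k r s t).par = pairPar j := by rintro (j | j) <;> rfl
  have hpar2 : ∀ j, (snd2 j : Idx2 k r s t).par = pairPar j := by rintro (j | j) <;> rfl
  have hpar1' : ∀ j, (fst2 j : Idx2 k r s' t').par = pairPar j := by rintro (j | j) <;> rfl
  have hpar2' : ∀ j, (snd2 j : Idx2 k r s' t').par = pairPar j := by rintro (j | j) <;> rfl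
  have hsq : ∀ (a : Idx2 k r s t) (j : Fin k ⊕ Fin r), a.par = pairPar j →
      adU lam kap (adU lam kap (b a)) = -(pairScale lam kap j : ℂ) ^ 2 • b a →
      ∃ j', pairPar j' = pairPar j ∧ (σ a = fst2 j' ∨ σ a = snd2 j') ∧
        (pairScale lam kap j : ℂ) ^ 2 = c ^ 2 * (pairScale lam kap j' : ℂ) ^ 2 := by
    intro a j hp h
    obtain ⟨j', h1, h2⟩ := exists_pair_of_sq hb' hφ hσ hc (Units.ne_zero _) h
    refine ⟨j', ?_, h1, h2⟩
    rw [← hp, ← par_map hb hb' hφ hσ a]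
    rcases h1 with h1 | h1 <;> rw [h1]
    · exact (hpar1' j').symm
    · exact (hpar2' j').symm
  choose τ hτp hτ hτsq using fun j => hsq (fst2 j) j (hpar1 j) (hb.fst j)
  obtain ⟨j₀⟩ := nonempty_pair hkr
  -- Along the orbit of a pair under `τ`, each step costs a factor `c²`.
  have hit : ∀ n : ℕ, (pairScale lam kap j₀ : ℂ) ^ 2 =
      (c ^ 2) ^ n * (pairScale lam kap (τ^[n] j₀) : ℂ) ^ 2 := by
    intro n
    induction n with
    | zero => simp
    | succ n ih =>
      rw [ih, Function.iterate_succ_apply', hτsq (τ^[n] j₀)]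
      ring
  -- There are finitely many pairs, so the orbit returns and `c²` is a root of unity.
  have hN : ∃ N : ℕ, 0 < N ∧ (c ^ 2) ^ N = 1 := by
    obtain ⟨n, n', hne, e⟩ := Finite.exists_ne_map_eq_of_infinite fun n : ℕ => τ^[n] j₀
    wlog hlt : n < n' generalizing n n'
    · exact this n' n hne.symm e.symm (by omega)
    refine ⟨n' - n, by omega, ?_⟩
    have h := (hit n).symm.trans (hit n')
    rw [e] at h
    have hne0 : (pairScale lam kap (τ^[n'] j₀) : ℂ) ^ 2 ≠ 0 := by simp
    have h := mul_right_cancel₀ hne0 h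
    have hn : (c ^ 2) ^ n ≠ 0 := pow_ne_zero _ (pow_ne_zero _ hc0)
    apply mul_left_cancel₀ hn
    rw [← pow_add, mul_one, h]
    congr 1
    omega
  obtain ⟨N, hN, hcN⟩ := hN
  -- Raising to the power `N` removes `c²`, and distinct pairs of equal parity have distinct `N`-th
  -- powers.
  have huniq : ∀ j j', pairPar j' = pairPar j →
      (pairScale lam kap j : ℂ) ^ 2 = c ^ 2 * (pairScale lam kap j' : ℂ) ^ 2 → j' = j := by
    intro j j' hp h
    by_contra hne
    refine neg_sq_pow_ne hlam hkap hne hp hN ?_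
    rw [h, ← mul_neg, mul_pow, hcN, one_mul]
  have hτ1 : ∀ j, τ j = j := fun j => huniq j (τ j) (hτp j) (hτsq j)
  refine ⟨?_, fun j => ?_, fun j => ?_⟩
  · have h := hτsq j₀
    rw [hτ1] at h
    have hne0 : (pairScale lam kap j₀ : ℂ) ^ 2 ≠ 0 := by simp
    exact (mul_right_cancel₀ hne0 ((one_mul _).trans h)).symm
  · have := hτ j
    rwa [hτ1] at this
  · obtain ⟨j', h1, h2, h3⟩ := hsq (snd2 j) j (hpar2 j) (hb.snd j)
    rw [huniq j j' h1 h3] at h2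
    exact h2

-- By injectivity of `σ`: the labels `z`, `u` and those of the pairs are already taken as images of
-- labels of the same kind.
include hlam hkap in
theorem isEta_map (a : Idx2 k r s t) (ha : a.IsEta) : (σ a).IsEta := by
  obtain ⟨c, hc0, hc⟩ := exists_smul_u hb hb' hkr hφ hσ
  obtain ⟨-, h1, h2⟩ := pair_rigidity hb hb' hkr hφ hσ hlam hkap hc
  have hpair : ∀ j, a ≠ fst2 j ∧ a ≠ snd2 j := by
    intro j
    constructor <;> rintro rfl <;> cases j <;> exact ha
  have key : ∀ j, ∃ a₁ a₂ : Idx2 k r s t, a ≠ a₁ ∧ a ≠ a₂ ∧ σ a₁ = fst2 j ∧ σ a₂ = snd2 j := by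
    intro j
    rcases h1 j with e1 | e1 <;> rcases h2 j with e2 | e2
    · exact absurd (σ.injective (e1.trans e2.symm)) (fst2_ne_snd2 j j)
    · exact ⟨_, _, (hpair j).1, (hpair j).2, e1, e2⟩
    · exact ⟨_, _, (hpair j).2, (hpair j).1, e2, e1⟩
    · exact absurd (σ.injective (e1.trans e2.symm)) (fst2_ne_snd2 j j)
  rcases idx2_cases (σ a) with ⟨j, h⟩ | ⟨j, h⟩ | h | h | h
  · obtain ⟨a₁, a₂, n1, n2, e1, e2⟩ := key j
    exact absurd (σ.injective (h.trans e1.symm)) n1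
  · obtain ⟨a₁, a₂, n1, n2, e1, e2⟩ := key j
    exact absurd (σ.injective (h.trans e2.symm)) n2
  · have := σ.injective (h.trans (map_z_eq hb hb' hkr hφ hσ).symm)
    rw [this] at ha
    exact ha.elim
  · have := σ.injective (h.trans (map_u_eq hb hb' hkr hφ hσ).symm)
    rw [this] at ha
    exact ha.elim
  · exact h

omit hb hb' hkr hφ hσ in
theorem isEta_dual {a : Idx2 k r s t} (ha : a.IsEta) : a.dual.IsEta := by
  cases a <;> exact ha

-- The dual of an `η`-label is the only `η`-label with which it has a nonzero bracket, a property
-- that `φ` preserves.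
include hlam hkap in
theorem map_dual (a : Idx2 k r s t) (ha : a.IsEta) : σ a.dual = (σ a).dual := by
  obtain ⟨c, hc, e⟩ := hσ a
  obtain ⟨c', hc', e'⟩ := hσ a.dual
  have h := hb.eta a a.dual ha (isEta_dual ha)
  rw [if_pos rfl] at h
  have h1 := congrArg φ h
  rw [aut_bracket hφ, e, e', map_smul, map_smul, LinearMap.smul_apply,
    hb'.eta _ _ (isEta_map hb hb' hkr hφ hσ hlam hkap a ha)
      (isEta_map hb hb' hkr hφ hσ hlam hkap _ (isEta_dual ha))] at h1
  by_contra hne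
  rw [if_neg hne, smul_zero, smul_zero] at h1
  exact (bas k r m).ne_zero _ (φ.map_eq_zero_iff.1 h1.symm)

end

end

section

/-! ### Inequivalence of the listed gradings -/

variable {k r m : ℕ}

section

variable {lam : Fin k → ℂˣ} {kap : Fin r → ℂˣ} (hkr : 1 ≤ k + r)
  (hlam : ∀ i j, i ≠ j → ¬ IsOfFinOrder (lam i / lam j))
  (hkap : ∀ i j, i ≠ j → ¬ IsOfFinOrder (kap i / kap j))

include hkr hlam hkap

/-- The number of self-dual `η`-labels is an invariant of the grading. -/
theorem card_eq_of_equivalent {s s' t t' : ℕ} {G H : Type*} [AddCommGroup G] [AddCommGroup H]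
    {Γ : Grading (heis k r m lam kap) G} {Γ' : Grading (heis k r m lam kap) H}
    {b : Module.Basis (Idx2 k r s t) ℂ (Space k r m)}
    {b' : Module.Basis (Idx2 k r s' t') ℂ (Space k r m)}
    (hb : Adapted lam kap b) (hb' : Adapted lam kap b')
    (h : Γ.IsLineGrading b) (h' : Γ'.IsLineGrading b') (he : Γ.Equivalent Γ') : t = t' := by
  apply le_antisymm
  · obtain ⟨φ, hφ⟩ := he
    obtain ⟨hφ, σ, hσ⟩ := (h.isEquivalence_iff h' φ).1 hφ
    exact card_y_le σ.injective (isEta_map hb hb' hkr hφ hσ hlam hkap)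
      (map_dual hb hb' hkr hφ hσ hlam hkap)
  · obtain ⟨φ, hφ⟩ := he.symm
    obtain ⟨hφ, σ, hσ⟩ := (h'.isEquivalence_iff h φ).1 hφ
    exact card_y_le σ.injective (isEta_map hb' hb hkr hφ hσ hlam hkap)
      (map_dual hb' hb hkr hφ hσ hlam hkap)

theorem gamma1_equivalent_gamma1 {s s' : ℕ} {hs : 2 * s ≤ m - 2 * r} {hs' : 2 * s' ≤ m - 2 * r}
    (h : (gamma1 hs lam kap).Equivalent (gamma1 hs' lam kap)) : s = s' := by
  have := card_eq_of_equivalent hkr hlam hkap (adapted_basis1 hs) (adapted_basis1 hs')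
    (gamma1_isLineGrading hs lam kap) (gamma1_isLineGrading hs' lam kap) h
  omega

theorem gamma2_equivalent_gamma2 {s s' : ℕ} {hs : 2 * s ≤ m - 2 * r} {hs' : 2 * s' ≤ m - 2 * r}
    (h : (gamma2 hs lam kap).Equivalent (gamma2 hs' lam kap)) : s = s' := by
  have := card_eq_of_equivalent hkr hlam hkap (adapted_basis2 hs) (adapted_basis2 hs')
    (gamma2_isLineGrading hs lam kap) (gamma2_isLineGrading hs' lam kap) h
  omega

/-- An equivalence rescales `u`, so it respects whether `ad u` exchanges the two lines of a pair, as
for `basis1`, or preserves them, as for `basis2`. -/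
theorem gamma1_not_equivalent_gamma2 {s s' : ℕ} (hs : 2 * s ≤ m - 2 * r)
    (hs' : 2 * s' ≤ m - 2 * r) :
    ¬ (gamma1 hs lam kap).Equivalent (gamma2 hs' lam kap) := by
  rintro ⟨φ, hφ⟩
  obtain ⟨hφ, σ, hσ⟩ := ((gamma1_isLineGrading hs lam kap).isEquivalence_iff
    (gamma2_isLineGrading hs' lam kap) φ).1 hφ
  have hb := adapted_basis1 (lam := lam) (kap := kap) hs
  have hb' := adapted_basis2 (lam := lam) (kap := kap) hs'
  obtain ⟨c, hc0, hc⟩ := exists_smul_u hb hb' hkr hφ hσ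
  obtain ⟨-, h1, -⟩ := pair_rigidity hb hb' hkr hφ hσ hlam hkap hc
  obtain ⟨j⟩ := nonempty_pair hkr
  obtain ⟨c₁, hc₁, e₁⟩ := hσ (fst2 j)
  obtain ⟨c₂, hc₂, e₂⟩ := hσ (snd2 j)
  have e := map_adU hφ hc (basis1 hs (fst2 j))
  rw [adU_basis1_fst, map_smul, e₁, e₂, map_smul] at e
  have hμ : (pairScale lam kap j : ℂ) ≠ 0 := Units.ne_zero _
  have hne : (fst2 j : Idx2 k r s (m - 2 * r - 2 * s)) ≠ snd2 j := fst2_ne_snd2 j j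
  rcases h1 j with h | h
  · rw [h, adU_basis2_fst, ← h, smul_smul, smul_smul, smul_smul] at e
    exact hne (σ.injective (Grading.index_unique (mul_ne_zero hμ hc₂) e).symm)
  · rw [h, adU_basis2_snd, ← h, smul_smul, smul_smul, smul_smul] at e
    exact hne (σ.injective (Grading.index_unique (mul_ne_zero hμ hc₂) e).symm)

end

/-! ### The Weyl groups -/

/-- The sign attached to an element of `Z_2`. -/
def sgn (x : Multiplicative (ZMod 2)) : ℂ := if x = 1 then 1 else -1

theorem sgn_ne_zero (x : Multiplicative (ZMod 2)) : sgn x ≠ 0 := by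
  unfold sgn
  split_ifs <;> simp

variable {s : ℕ}

/-- The scalars of an automorphism inducing a given signed permutation on `Γ₁^s`. -/
def scale1 {d t : ℕ} (ι : Fin k ⊕ Fin r → Fin d) (x : SignedPerm d s t) : Idx2 k r s t → ℂ
  | .a' i => sgn (x.left (.inl (ι (.inl i))))
  | .c' j => sgn (x.left (.inl (ι (.inr j))))
  | _ => 1

/-- The scalars of an automorphism inducing a given signed permutation on `Γ₂^s`. -/
def scale2 {t : ℕ} (x : SignedPerm 1 s t) : Idx2 k r s t → ℂ
  | .u => sgn (x.left (.inl 0))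
  | .a' _ => sgn (x.left (.inl 0))
  | _ => 1

theorem permIdxFun_par {d t : ℕ} (ι : Fin k ⊕ Fin r → Fin d) (x : SignedPerm d s t)
    (a : Idx2 k r s t) : (permIdxFun ι x a).par = a.par := by
  cases a <;> simp only [permIdxFun, pick] <;> (try split_ifs) <;> rfl

section

variable (lam : Fin k → ℂˣ) (kap : Fin r → ℂˣ)

-- A flip is the quarter turn `e ↦ ê ↦ -e`, likewise on `w`. It fixes `u` and commutes with `ad u`,
-- so each pair may be flipped independently.
set_option maxHeartbeats 1000000 in
theorem exists_aut_perm1 (hkr : 1 ≤ k + r) (hs : 2 * s ≤ m - 2 * r) {d : ℕ}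
    (ι : Fin k ⊕ Fin r → Fin d) (x : SignedPerm d s (m - 2 * r - 2 * s)) :
    ∃ φ ∈ (heis k r m lam kap).aut, ∀ a,
      φ (basis1 hs a) = scale1 ι x a • basis1 hs (permIdxFun ι x a) := by
  refine exists_aut hkr lam kap (basis1 hs) _ Idx2.par ?_ ?_ ?_ ?_
  · exact fun a => (adapted_basis1 (lam := lam) (kap := kap) hs).par a
  · intro a
    rw [← permIdxFun_par ι x a]
    exact smul_mem _ _ ((adapted_basis1 (lam := lam) (kap := kap) hs).par _)
  all_goals
    set f := (basis1 hs).constr ℂ fun a => scale1 ι x a • basis1 (k := k) hs (permIdxFun ι x a)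
    have hf : ∀ a, f (vec1 hs a) = scale1 ι x a • vec1 hs (permIdxFun ι x a) := by
      intro a
      rw [← basis1_apply, ← basis1_apply, Module.Basis.constr_basis]
    clear_value f
    have hz : f (bas k r m .z) = bas k r m .z := (hf .z).trans (one_smul ℂ _)
  · rw [hz]
    exact (bas k r m).ne_zero _
  · have he : ∀ i, f (bas k r m (.e i)) = _ := fun i => hf (.a i)
    have he' : ∀ i, f (bas k r m (.e' i)) = _ := fun i => hf (.a' i)
    have hw : ∀ i, f (bas k r m (.w i)) = _ := fun i => hf (.c i)
    have hw' : ∀ i, f (bas k r m (.w' i)) = _ := fun i => hf (.c' i)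
    intro a b
    simp only [basis1_apply, map_smul, LinearMap.smul_apply, bracket_vec1]
    cases a <;> cases b <;>
      simp only [table1, apply_ite f, map_zero, map_smul, hz, he, he', hw, hw', permIdxFun,
        scale1, pick, sgn, one_smul, smul_zero] <;>
      clear hz he he' hw hw' hf <;> (try split_ifs) <;> simp_all [vec1] <;>
      (rintro rfl; contradiction)

/-- Flipping a pair exchanges opposite eigenvalues of `ad u`; this is compensated by `u ↦ -u`,
provided that all pairs flip together. The sign on `a'` keeps the alternating bracket. -/
theorem exists_aut_perm2 (hkr : 1 ≤ k + r) (hs : 2 * s ≤ m - 2 * r)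
    (x : SignedPerm 1 s (m - 2 * r - 2 * s)) :
    ∃ φ ∈ (heis k r m lam kap).aut, ∀ a,
      φ (basis2 hs a) = scale2 x a • basis2 hs (permIdxFun (fun _ => 0) x a) := by
  refine exists_aut hkr lam kap (basis2 hs) _ Idx2.par ?_ ?_ ?_ ?_
  · exact fun a => (adapted_basis2 (lam := lam) (kap := kap) hs).par a
  · intro a
    rw [← permIdxFun_par (fun _ => 0) x a]
    exact smul_mem _ _ ((adapted_basis2 (lam := lam) (kap := kap) hs).par _)
  all_goals
    set f := (basis2 hs).constr ℂ fun a =>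
      scale2 x a • basis2 (k := k) hs (permIdxFun (fun _ => 0) x a)
    have hf : ∀ a, f (vec2 hs a) = scale2 x a • vec2 hs (permIdxFun (fun _ => 0) x a) := by
      intro a
      rw [← basis2_apply, ← basis2_apply, Module.Basis.constr_basis]
    clear_value f
    have hz : f (bas k r m .z) = bas k r m .z := (hf .z).trans (one_smul ℂ _)
  · rw [hz]
    exact (bas k r m).ne_zero _
  · intro a b
    simp only [basis2_apply, map_smul, LinearMap.smul_apply, bracket_vec2]
    cases a <;> cases b <;>
      simp only [table2, apply_ite f, map_zero, map_smul, hz, hf, permIdxFun,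
        scale2, pick, sgn, one_smul, smul_zero] <;>
      clear hz hf <;> (try split_ifs) <;> simp_all <;>
      (rintro rfl; contradiction)

variable {lam kap} (hkr : 1 ≤ k + r)
  (hlam : ∀ i j, i ≠ j → ¬ IsOfFinOrder (lam i / lam j))
  (hkap : ∀ i j, i ≠ j → ¬ IsOfFinOrder (kap i / kap j))

include hkr hlam hkap

/-- `ι` records which pairs share a sign: `hreal` realises all such signed permutations, `hcoh` says
that flips obey this pattern, and rigidity supplies the rest. -/
theorem range_perm_eq {d t : ℕ} {G : Type*} [AddCommGroup G]
    {Γ : Grading (heis k r m lam kap) G} {b : Module.Basis (Idx2 k r s t) ℂ (Space k r m)}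
    (hb : Adapted lam kap b) (h : Γ.IsLineGrading b) (ι : Fin k ⊕ Fin r → Fin d)
    (hreal : ∀ x : SignedPerm d s t, ∃ φ ∈ (heis k r m lam kap).aut, ∃ c : Idx2 k r s t → ℂ,
      (∀ a, c a ≠ 0) ∧ ∀ a, φ (b a) = c a • b (permIdxFun ι x a))
    (hcoh : ∀ φ : Γ.aut, ∃ ε : Fin d → Multiplicative (ZMod 2),
      ∀ j, h.perm φ (fst2 j) = fst2 j ↔ ε (ι j) = 1) :
    h.perm.range = (permIdx (s := s) (t := t) ι).range := by
  apply le_antisymm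
  · rintro _ ⟨φ, rfl⟩
    have hφ : (φ : Space k r m ≃ₗ[ℂ] Space k r m) ∈ (heis k r m lam kap).aut := φ.2.1
    have hσ := h.perm_spec φ
    obtain ⟨c, hc0, hc⟩ := exists_smul_u hb hb hkr hφ hσ
    obtain ⟨-, h1, h2⟩ := pair_rigidity hb hb hkr hφ hσ hlam hkap hc
    obtain ⟨ε, hε⟩ := hcoh φ
    refine mem_range_permIdx (map_z_eq hb hb hkr hφ hσ) (map_u_eq hb hb hkr hφ hσ)
      (isEta_map hb hb hkr hφ hσ hlam hkap) (map_dual hb hb hkr hφ hσ hlam hkap) (ε := ε) ?_ ?_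
    · intro j
      simp only [pick]
      split_ifs with e
      · exact (hε j).2 e
      · exact (h1 j).resolve_left fun h => e ((hε j).1 h)
    · intro j
      simp only [pick]
      split_ifs with e
      · refine (h2 j).resolve_left fun h => ?_
        exact fst2_ne_snd2 j j ((h.trans ((hε j).2 e).symm |> (Equiv.injective _)).symm)
      · refine (h2 j).resolve_right fun h => ?_
        have := (h1 j).resolve_left fun h => e ((hε j).1 h)
        exact fst2_ne_snd2 j j (Equiv.injective _ (this.trans h.symm))
  · rintro _ ⟨x, rfl⟩
    obtain ⟨φ, hφ, c, hc, e⟩ := hreal x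
    have hmem : φ ∈ Γ.aut := (h.isEquivalence_iff h φ).2
      ⟨hφ, permIdx ι x, fun a => ⟨c a, hc a, e a⟩⟩
    refine ⟨⟨φ, hmem⟩, Equiv.ext fun a => ?_⟩
    exact h.perm_eq ⟨φ, hmem⟩ (e a)

theorem weyl_gamma1 (hs : 2 * s ≤ m - 2 * r) : Nonempty ((gamma1 hs lam kap).WeylGroup ≃*
    SignedPerm (k + r) s (m - 2 * r - 2 * s)) := by
  classical
  have h := gamma1_isLineGrading hs lam kap
  refine ⟨h.weylEquiv (permIdx finSumFinEquiv) (permIdx_injective finSumFinEquiv.surjective)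
    (range_perm_eq hkr hlam hkap (adapted_basis1 hs) h _ ?_ ?_)⟩
  · intro x
    obtain ⟨φ, hφ, e⟩ := exists_aut_perm1 lam kap hkr hs finSumFinEquiv x
    refine ⟨φ, hφ, _, fun a => ?_, e⟩
    cases a <;> simp [scale1, sgn_ne_zero]
  · intro φ
    refine ⟨fun i => if h.perm φ (fst2 (finSumFinEquiv.symm i)) = fst2 (finSumFinEquiv.symm i)
      then 1 else Multiplicative.ofAdd 1, fun j => ?_⟩
    simp only [Equiv.symm_apply_apply]
    split_ifs with e <;> simp [e]

theorem weyl_gamma2 (hs : 2 * s ≤ m - 2 * r) : Nonempty ((gamma2 hs lam kap).WeylGroup ≃*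
    SignedPerm 1 s (m - 2 * r - 2 * s)) := by
  classical
  have h := gamma2_isLineGrading hs lam kap
  have hb := adapted_basis2 (lam := lam) (kap := kap) hs
  obtain ⟨j₀⟩ := nonempty_pair hkr
  refine ⟨h.weylEquiv (permIdx fun _ => 0) (permIdx_injective fun i =>
    ⟨j₀, Subsingleton.elim _ _⟩) (range_perm_eq hkr hlam hkap hb h _ ?_ ?_)⟩
  · intro x
    obtain ⟨φ, hφ, e⟩ := exists_aut_perm2 lam kap hkr hs x
    refine ⟨φ, hφ, _, fun a => ?_, e⟩
    cases a <;> simp [scale2, sgn_ne_zero]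
  · intro φ
    have hφ : (φ : Space k r m ≃ₗ[ℂ] Space k r m) ∈ (heis k r m lam kap).aut := φ.2.1
    have hσ := h.perm_spec φ
    obtain ⟨c, hc0, hc⟩ := exists_smul_u hb hb hkr hφ hσ
    obtain ⟨-, h1, -⟩ := pair_rigidity hb hb hkr hφ hσ hlam hkap hc
    -- The lines of a pair carry opposite eigenvalues of `ad u`, so whether it is flipped depends
    -- only on the scalar `c` by which `φ` acts on `u`.
    have key : ∀ j, h.perm φ (fst2 j) = fst2 j ↔ c = 1 := by
      intro j
      obtain ⟨c', hc', e'⟩ := hσ (fst2 j)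
      have e := map_adU hφ hc (basis2 hs (fst2 j))
      rw [adU_basis2_fst, map_smul, e', map_smul] at e
      have hμ : (pairScale lam kap j : ℂ) ≠ 0 := Units.ne_zero _
      have hI := I_ne_zero
      have hne := (basis2 (k := k) hs).ne_zero (h.perm φ (fst2 j))
      rcases h1 j with h2 | h2
      · refine ⟨fun _ => ?_, fun _ => h2⟩
        rw [h2] at e hne
        rw [adU_basis2_fst, smul_smul, smul_smul, smul_smul, ← sub_eq_zero, ← sub_smul] at e
        have := (smul_eq_zero.1 e).resolve_right hne
        have h3 : (I * (pairScale lam kap j : ℂ) * c') * (c - 1) = 0 := by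
          linear_combination this
        exact sub_eq_zero.1 ((mul_eq_zero.1 h3).resolve_left (by simp [hc']))
      · refine ⟨fun h3 => absurd (h3.symm.trans h2) (fst2_ne_snd2 j j), fun h3 => ?_⟩
        rw [h2] at e hne
        rw [adU_basis2_snd, smul_smul, smul_smul, smul_smul, ← sub_eq_zero, ← sub_smul,
          h3] at e
        have := (smul_eq_zero.1 e).resolve_right hne
        have h4 : (I * (pairScale lam kap j : ℂ) * c') * 2 = 0 := by
          linear_combination -this
        simp [hc'] at h4
    refine ⟨fun _ => if c = 1 then 1 else Multiplicative.ofAdd 1, fun j => ?_⟩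
    rw [key]
    split_ifs with e <;> simp [e]

end

end

section

/-! ### Tori -/

section

variable {A : Type*} [AddCommGroup A] [Module ℂ A]

theorem exists_units_sq (x : ℂˣ) : ∃ y : ℂˣ, y * y = x := by
  obtain ⟨y, hy⟩ := IsAlgClosed.exists_pow_nat_eq (x : ℂ) (n := 2) two_pos
  have hy0 : y ≠ 0 := by
    rintro rfl
    simp [eq_comm] at hy
  exact ⟨Units.mk0 y hy0, Units.ext (by simpa [sq] using hy)⟩

/-- Every element of a torus is the square of an element commuting with the torus. -/
theorem IsTorus.exists_sq {T : Subgroup (A ≃ₗ[ℂ] A)} (hT : IsTorus T) {φ : A ≃ₗ[ℂ] A}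
    (hφ : φ ∈ T) : ∃ ψ ∈ T, (∀ x, ψ (ψ x) = φ x) ∧ ∀ δ ∈ T, ∀ x, ψ (δ x) = δ (ψ x) := by
  obtain ⟨d, χ, -, rfl, -⟩ := hT
  obtain ⟨t, rfl⟩ := hφ
  choose r hr using exists_units_sq
  refine ⟨χ fun i => r (t i), ⟨_, rfl⟩, fun x => ?_, ?_⟩
  · rw [← LinearEquiv.mul_apply, ← map_mul]
    congr 2
    exact funext fun i => hr (t i)
  · rintro _ ⟨t', rfl⟩ x
    rw [← LinearEquiv.mul_apply, ← map_mul, mul_comm, map_mul, LinearEquiv.mul_apply]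

variable {ι D : Type*} [Fintype D]

/-- The automorphisms scaling the basis vectors by Laurent monomials. -/
def monomialHom (b : Module.Basis ι ℂ A) (wt : ι → D → ℤ) : (D → ℂˣ) →* (A ≃ₗ[ℂ] A) :=
  (LinearMap.GeneralLinearGroup.generalLinearEquiv ℂ A).toMonoidHom.comp
    (MonoidHom.toHomUnits
      { toFun := fun t => b.constr ℂ fun a => ((∏ i, t i ^ wt a i : ℂˣ) : ℂ) • b a
        map_one' := b.ext fun a => by simp
        map_mul' := fun t t' => b.ext fun a => by
          simp [mul_zpow, Finset.prod_mul_distrib, smul_smul, mul_comm] })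

theorem monomialHom_apply (b : Module.Basis ι ℂ A) (wt : ι → D → ℤ) (t : D → ℂˣ) (a : ι) :
    monomialHom b wt t (b a) = ((∏ i, t i ^ wt a i : ℂˣ) : ℂ) • b a :=
  b.constr_basis ℂ _ a

theorem isTorus_monomialHom [Fintype ι] (b : Module.Basis ι ℂ A) (wt : ι → D → ℤ)
    (hwt : ∀ t : D → ℂˣ, (∀ a, ∏ i, t i ^ wt a i = 1) → t = 1) :
    IsTorus (monomialHom b wt).range := by
  classical
  let e := Fintype.equivFin D
  let ρ : (Fin (Fintype.card D) → ℂˣ) →* (D → ℂˣ) :=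
    { toFun := fun t => t ∘ e, map_one' := rfl, map_mul' := fun _ _ => rfl }
  have hρ : Function.Bijective ρ := e.bijective.comp_right
  refine ⟨Fintype.card D, (monomialHom b wt).comp ρ, ?_, ?_, ?_⟩
  · refine Function.Injective.comp (g := monomialHom b wt) ?_ hρ.1
    rw [injective_iff_map_eq_one]
    refine fun t ht => hwt t fun a => Units.ext ?_
    have h := monomialHom_apply b wt t a
    rw [ht, LinearEquiv.coe_one, id, ← sub_eq_zero] at h
    nth_rw 1 [← one_smul ℂ (b a)] at h
    rw [← sub_smul] at h
    exact (sub_eq_zero.1 ((smul_eq_zero.1 h).resolve_right (b.ne_zero a))).symm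
  · rw [MonoidHom.range_comp, MonoidHom.range_eq_top.2 hρ.2, ← MonoidHom.range_eq_map]
  · intro x f
    refine ⟨∑ a, Finsupp.single (fun i => wt a (e.symm i)) (b.repr x a * f (b a)), fun t => ?_⟩
    have hx : (monomialHom b wt).comp ρ t x =
        ∑ a, b.repr x a • ((∏ i, ρ t i ^ wt a i : ℂˣ) : ℂ) • b a := by
      conv_lhs => rw [← b.sum_repr x, map_sum]
      refine Finset.sum_congr rfl fun a _ => ?_
      rw [map_smul, MonoidHom.comp_apply, monomialHom_apply]
    rw [hx, map_sum, ← Finsupp.sum_finsetSum_index (by simp) (by intros; ring)]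
    refine Finset.sum_congr rfl fun a _ => ?_
    rw [Finsupp.sum_single_index (by simp), map_smul, map_smul, smul_eq_mul, smul_eq_mul]
    have : ∏ i, ρ t i ^ wt a i = ∏ i, t i ^ wt a (e.symm i) :=
      Fintype.prod_equiv e _ _ fun i => by simp [ρ]
    rw [this]
    ring

end

/-! ### Diagonal automorphisms -/

section

variable {A : Type*} [AddCommGroup A] [Module ℂ A] {S : Superalgebra A} {ι G : Type*}
  [AddCommGroup G]

theorem mem_diag_ofBasis (b : Module.Basis ι ℂ A) (deg : ι → G)
    (hpar : ∀ i, ∃ p, b i ∈ S.parity p)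
    (hmul : ∀ i j, S.mul (b i) (b j) ∈ degSpan b deg (deg i + deg j)) {φ : A ≃ₗ[ℂ] A}
    (hφ : φ ∈ S.aut) (χ : AddChar G ℂ) (h : ∀ a, φ (b a) = χ (deg a) • b a) :
    φ ∈ (Grading.ofBasis b deg hpar hmul).diag := by
  refine ⟨hφ, fun g => ⟨χ g, fun x hx => ?_⟩⟩
  refine span_induction ?_ (by simp) ?_ ?_ hx
  · rintro _ ⟨a, rfl, rfl⟩
    exact h a
  · intro x y _ _ h1 h2
    rw [map_add, h1, h2, smul_add]
  · intro c x _ h1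
    rw [map_smul, h1, smul_comm]

/-- A map commuting with a diagonal one preserves an eigenline. -/
theorem exists_smul_of_commute (b : Module.Basis ι ℂ A) {a : ι} {ψ : A ≃ₗ[ℂ] A}
    (h : ∀ a', a' ≠ a → ∃ (δ : A ≃ₗ[ℂ] A) (c : ι → ℂ), (∀ i, δ (b i) = c i • b i) ∧
      (∀ x, ψ (δ x) = δ (ψ x)) ∧ c a ≠ c a') : ∃ c : ℂ, c ≠ 0 ∧ ψ (b a) = c • b a := by
  classical
  have hcoord : ∀ a', a' ≠ a → b.repr (ψ (b a)) a' = 0 := by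
    intro a' ha
    obtain ⟨δ, c, hδ, hcomm, hne⟩ := h a' ha
    have h1 := hcomm (b a)
    rw [hδ, map_smul] at h1
    have h2 : ∀ x, b.repr (δ x) a' = c a' * b.repr x a' := by
      intro x
      have : b.coord a' ∘ₗ (δ : A →ₗ[ℂ] A) = c a' • b.coord a' := by
        refine b.ext fun i => ?_
        by_cases hi : i = a'
        · simp [hδ, hi]
        · simp [hδ, hi]
      exact LinearMap.congr_fun this x
    have h3 := congrArg (fun x => b.repr x a') h1
    simp only [map_smul, Finsupp.smul_apply, smul_eq_mul, h2] at h3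
    exact (mul_eq_zero.1 (show (c a - c a') * b.repr (ψ (b a)) a' = 0 by
      linear_combination h3)).resolve_left (sub_ne_zero.2 hne)
  have e : ψ (b a) = b.repr (ψ (b a)) a • b a := by
    apply b.repr.injective
    ext a'
    by_cases ha : a' = a
    · simp [ha]
    · simp [hcoord a' ha, Ne.symm ha]
  refine ⟨_, fun h0 => ?_, e⟩
  rw [h0, zero_smul] at e
  exact b.ne_zero a (ψ.map_eq_zero_iff.1 e)

end

/-! ### Characters of the grading groups and obstructions to torality. -/

variable {k r m s : ℕ} {lam : Fin k → ℂˣ} {kap : Fin r → ℂˣ} (hkr : 1 ≤ k + r)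

include hkr

/-- A character of the grading group induces an automorphism. -/
theorem exists_aut_char {ι G : Type*} [AddCommGroup G] (b : Module.Basis ι ℂ (Space k r m))
    (p : ι → ZMod 2) (hp : ∀ a, b a ∈ degSpan (bas k r m) Idx.par (p a)) (deg : ι → G)
    (hmul : ∀ i j, bracket lam kap (b i) (b j) ∈ degSpan b deg (deg i + deg j)) {i₀ : ι}
    (hz : b i₀ = bas k r m .z) (χ : AddChar G ℂ) :
    ∃ φ ∈ (heis k r m lam kap).aut, ∀ a, φ (b a) = χ (deg a) • b a := by
  refine exists_aut hkr lam kap b (fun a => χ (deg a) • b a) p hp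
    (fun a => smul_mem _ _ (hp a)) ?_ fun a a' => ?_
  · rw [← hz, Module.Basis.constr_basis]
    exact smul_ne_zero (χ.val_isUnit _).ne_zero (b.ne_zero _)
  · have key : ∀ g, ∀ x ∈ degSpan b deg g,
        b.constr ℂ (fun a => χ (deg a) • b a) x = χ g • x := by
      intro g x hx
      refine span_induction ?_ (by simp) ?_ ?_ hx
      · rintro _ ⟨a, rfl, rfl⟩
        exact b.constr_basis ℂ _ a
      · intro x y _ _ h1 h2
        rw [map_add, h1, h2, smul_add]
      · intro c x _ h1
        rw [map_smul, h1, smul_comm]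
    rw [key _ _ (hmul a a'), χ.map_add_eq_mul, map_smul, map_smul, LinearMap.smul_apply,
      smul_smul, mul_comm]

theorem exists_diag_gamma1 (hs : 2 * s ≤ m - 2 * r) (χ : AddChar (ℤ × ZMod 4 × (Fin k → ZMod 2) ×
      (Fin r → ZMod 2) × (Fin s → ℤ) × (Fin (m - 2 * r - 2 * s) → ZMod 2)) ℂ) :
    ∃ φ ∈ (gamma1 hs lam kap).diag, ∀ a, φ (basis1 hs a) = χ (deg1 a) • basis1 hs a := by
  obtain ⟨φ, hφ, h⟩ := exists_aut_char (lam := lam) (kap := kap) hkr (basis1 hs) Idx2.par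
    (adapted_basis1 (lam := lam) (kap := kap) hs).par deg1 (fun a b => by
      rw [basis1_apply, basis1_apply]
      exact (bracket_vec1 hs lam kap a b).symm ▸ table1_mem hs lam kap a b)
    (basis1_apply hs .z) χ
  exact ⟨φ, mem_diag_ofBasis _ _ _ _ hφ χ h, h⟩

theorem exists_diag_gamma2 (hs : 2 * s ≤ m - 2 * r) (χ : AddChar (ℤ × (Fin k → ℤ) ×
      (Fin r → ℤ) × (Fin s → ℤ) × (Fin (m - 2 * r - 2 * s) → ZMod 2)) ℂ) :
    ∃ φ ∈ (gamma2 hs lam kap).diag, ∀ a, φ (basis2 hs a) = χ (deg2 a) • basis2 hs a := by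
  obtain ⟨φ, hφ, h⟩ := exists_aut_char (lam := lam) (kap := kap) hkr (basis2 hs) Idx2.par
    (adapted_basis2 (lam := lam) (kap := kap) hs).par deg2 (fun a b => by
      rw [basis2_apply, basis2_apply]
      exact (bracket_vec2 hs lam kap a b).symm ▸ table2_mem hs lam kap a b)
    (basis2_apply hs .z) χ
  exact ⟨φ, mem_diag_ofBasis _ _ _ _ hφ χ h, h⟩

omit hkr in
/-- The character `x ↦ (-1)^{x_i}`. -/
def signChar {n : ℕ} (i : Fin n) : AddChar (Fin n → ZMod 2) ℂ :=
  (AddChar.zmodChar 2 (ζ := (-1 : ℂ)) (by norm_num)).compAddMonoidHom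
    (Pi.evalAddMonoidHom (fun _ => ZMod 2) i)

omit hkr in
theorem signChar_single {n : ℕ} (i x : Fin n) :
    signChar i (Pi.single x 1) = if x = i then -1 else 1 := by
  change (-1 : ℂ) ^ ZMod.val ((Pi.single x 1 : Fin n → ZMod 2) i) = _
  by_cases hx : x = i
  · subst hx
    rw [Pi.single_eq_same, if_pos rfl, ZMod.val_one, pow_one]
  · rw [Pi.single_eq_of_ne (Ne.symm hx), if_neg hx, ZMod.val_zero, pow_zero]

omit hkr in
theorem exists_pairChar {t : ℕ} (j : Fin k ⊕ Fin r) :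
    ∃ χ : AddChar (ℤ × ZMod 4 × (Fin k → ZMod 2) × (Fin r → ZMod 2) × (Fin s → ℤ) ×
      (Fin t → ZMod 2)) ℂ, ∀ a, χ (deg1 a) = if a = fst2 j ∨ a = snd2 j then -1 else 1 := by
  cases j with
  | inl i =>
    refine ⟨(signChar i).compAddMonoidHom
      ((AddMonoidHom.fst _ _).comp ((AddMonoidHom.snd _ _).comp (AddMonoidHom.snd _ _))),
      fun a => ?_⟩
    cases a with
    | a x => exact (signChar_single i x).trans (by simp [fst2, snd2])
    | a' x => exact (signChar_single i x).trans (by simp [fst2, snd2])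
    | _ => exact (signChar i).map_zero_eq_one.trans (by simp [fst2, snd2])
  | inr i =>
    refine ⟨(signChar i).compAddMonoidHom
      ((AddMonoidHom.fst _ _).comp ((AddMonoidHom.snd _ _).comp
        ((AddMonoidHom.snd _ _).comp (AddMonoidHom.snd _ _)))), fun a => ?_⟩
    cases a with
    | c x => exact (signChar_single i x).trans (by simp [fst2, snd2])
    | c' x => exact (signChar_single i x).trans (by simp [fst2, snd2])
    | _ => exact (signChar i).map_zero_eq_one.trans (by simp [fst2, snd2])

/-- The order-4 character `χ₁` gives a diagonal `φ` with `u ↦ -u`. A square root `ψ` commuting with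
the diagonal group scales `u` by some `c` with `c² = -1`. But `ψ` also preserves the line of a pair
vector, an eigenvector of `(ad u)²`, and this forces `c² = 1`. -/
theorem gamma1_not_isToral (hs : 2 * s ≤ m - 2 * r) : ¬ (gamma1 hs lam kap).IsToral := by
  rintro ⟨T, hT, htorus, hdiag⟩
  have hsep : ∀ χ : AddChar (ℤ × ZMod 4 × (Fin k → ZMod 2) × (Fin r → ZMod 2) × (Fin s → ℤ) ×
      (Fin (m - 2 * r - 2 * s) → ZMod 2)) ℂ, ∃ δ ∈ T, ∀ a, δ (basis1 hs a) = χ (deg1 a) • basis1 hs a := by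
    intro χ
    obtain ⟨δ, hδ, h⟩ := exists_diag_gamma1 (lam := lam) (kap := kap) hkr hs χ
    exact ⟨δ, hdiag hδ, h⟩
  let χ₁ : AddChar (ℤ × ZMod 4 × (Fin k → ZMod 2) × (Fin r → ZMod 2) × (Fin s → ℤ) ×
      (Fin (m - 2 * r - 2 * s) → ZMod 2)) ℂ :=
    (AddChar.zmodChar 4 (ζ := I) I_pow_four).compAddMonoidHom
      ((AddMonoidHom.fst _ _).comp (AddMonoidHom.snd _ _))
  -- It isolates `u`, the only basis vector whose `ℤ`-degree is 0.
  let χ₂ : AddChar (ℤ × ZMod 4 × (Fin k → ZMod 2) × (Fin r → ZMod 2) × (Fin s → ℤ) ×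
      (Fin (m - 2 * r - 2 * s) → ZMod 2)) ℂ :=
    { toFun := fun g => 2 ^ g.1
      map_zero_eq_one' := by simp
      map_add_eq_mul' := fun g h => by simp [zpow_add₀] }
  obtain ⟨φ, hφ, e⟩ := hsep χ₁
  obtain ⟨ψ, hψ, hsq, hcomm⟩ := htorus.exists_sq hφ
  obtain ⟨j⟩ := nonempty_pair hkr
  have h₁ : ∀ g, χ₁ g = I ^ (g.2.1 : ZMod 4).val := fun g => rfl
  have v2 : (2 : ZMod 4).val = 2 := rfl
  have v3 : (3 : ZMod 4).val = 3 := rfl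
  have v1 : (1 : ZMod 4).val = 1 := rfl
  have hIne : I ≠ -I := by
    intro h
    have := congrArg Complex.im h
    norm_num at this
  have hχfs : χ₁ (deg1 (fst2 j)) ≠ χ₁ (deg1 (snd2 j)) := by
    cases j <;> simp only [h₁, fst2, snd2, deg1, v1, v2, v3, ZMod.val_zero, pow_zero, I_sq,
      pow_one, I_pow_three]
    · norm_num
    · exact hIne
  have hu : ∃ c : ℂ, c ≠ 0 ∧ ψ (basis1 hs .u) = c • basis1 hs .u := by
    refine exists_smul_of_commute _ fun a' ha' => ?_
    obtain ⟨δ, hδ, h⟩ := hsep χ₂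
    refine ⟨δ, _, h, hcomm δ hδ, ?_⟩
    cases a' <;> simp_all [χ₂, deg1] <;> norm_num
  obtain ⟨χ₃, hχ₃⟩ := exists_pairChar (k := k) (r := r) (s := s) (t := m - 2 * r - 2 * s) j
  obtain ⟨δ₃, hδ₃, h₃⟩ := hsep χ₃
  have hf : ∃ c : ℂ, c ≠ 0 ∧ ψ (basis1 hs (fst2 j)) = c • basis1 hs (fst2 j) := by
    refine exists_smul_of_commute _ fun a' ha' => ?_
    -- The pair character cannot tell the two members of the pair apart, but `χ₁` does.
    by_cases h : a' = snd2 j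
    · exact ⟨φ, _, e, hcomm φ hφ, h ▸ hχfs⟩
    · refine ⟨δ₃, _, h₃, hcomm _ hδ₃, ?_⟩
      rw [hχ₃, hχ₃, if_pos (.inl rfl), if_neg (not_or_intro ha' h)]
      norm_num
  obtain ⟨c, hc, ec⟩ := hu
  obtain ⟨c', hc', ec'⟩ := hf
  have hcc : c * c = -1 := by
    have h := hsq (basis1 hs .u)
    rw [ec, map_smul, ec, e, smul_smul, ← sub_eq_zero, ← sub_smul] at h
    have := (smul_eq_zero.1 h).resolve_right ((basis1 (k := k) hs).ne_zero _)
    simp only [h₁, deg1, v2, I_sq] at this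
    linear_combination this
  have hbr : ∀ x, ψ (adU lam kap x) = c • adU lam kap (ψ x) := by
    intro x
    rw [(adapted_basis1 (lam := lam) (kap := kap) hs).u] at ec
    refine (aut_bracket (hT hψ) _ _).trans ?_
    rw [ec, map_smul]
    rfl
  have h := hbr (adU lam kap (basis1 hs (fst2 j)))
  rw [(adapted_basis1 (lam := lam) (kap := kap) hs).fst, map_smul, hbr, ec', map_smul, map_smul,
    map_smul, (adapted_basis1 (lam := lam) (kap := kap) hs).fst, ← sub_eq_zero] at h
  simp only [smul_smul, ← sub_smul] at h
  have h0 := (smul_eq_zero.1 h).resolve_right ((basis1 (k := k) hs).ne_zero _)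
  have : (c' * (pairScale lam kap j : ℂ) ^ 2) * 2 = 0 := by
    linear_combination -h0 + (c' * (pairScale lam kap j : ℂ) ^ 2) * hcc
  simp [hc'] at this

/-- Take the diagonal map changing the sign of a single `y`. A square root commuting with all such
sign changes scales each `y_h` by some `c_h`, and `[y_h, y_h] = z` makes `c_h²` independent of `h`;
yet it is `-1` for the chosen label and 1 for another. -/
theorem gamma2_not_isToral (hs : 2 * s ≤ m - 2 * r) (ht : 2 ≤ m - 2 * r - 2 * s) :
    ¬ (gamma2 hs lam kap).IsToral := by
  rintro ⟨T, hT, htorus, hdiag⟩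
  have hsep : ∀ h : Fin (m - 2 * r - 2 * s), ∃ δ ∈ T, ∀ a, δ (basis2 hs a) =
      (if a = .y h then -1 else 1 : ℂ) • basis2 hs a := by
    intro i
    obtain ⟨δ, hδ, h⟩ := exists_diag_gamma2 (lam := lam) (kap := kap) hkr hs
      ((signChar i).compAddMonoidHom ((AddMonoidHom.snd _ _).comp
        ((AddMonoidHom.snd _ _).comp ((AddMonoidHom.snd _ _).comp (AddMonoidHom.snd _ _)))))
    refine ⟨δ, hdiag hδ, fun a => ?_⟩
    rw [h]
    congr 1
    cases a with
    | y x => exact (signChar_single i x).trans (by simp)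
    | _ => exact (signChar i).map_zero_eq_one.trans (by simp)
  obtain ⟨φ, hφ, e⟩ := hsep ⟨0, by omega⟩
  obtain ⟨ψ, hψ, hsq, hcomm⟩ := htorus.exists_sq hφ
  have hy : ∀ h, ∃ c : ℂ, c ≠ 0 ∧ ψ (basis2 hs (.y h)) = c • basis2 hs (.y h) := by
    intro i
    obtain ⟨δ, hδ, h⟩ := hsep i
    refine exists_smul_of_commute _ fun a ha => ⟨δ, _, h, hcomm _ hδ, ?_⟩
    rw [if_pos rfl, if_neg ha]
    norm_num
  choose c hc ec using hy
  have hz : ∀ h, ψ (bas k r m .z) = (c h * c h) • bas k r m .z := by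
    intro i
    have h := (adapted_basis2 (lam := lam) (kap := kap) hs).eta (.y i) (.y i) trivial trivial
    rw [if_pos (show Idx2.y i = (Idx2.y i).dual from rfl)] at h
    rw [← h, aut_bracket (hT hψ), ec, map_smul, map_smul, LinearMap.smul_apply, smul_smul]
  have hsq' : ∀ h, c h * c h = if (Idx2.y h : Idx2 k r s _) = .y ⟨0, by omega⟩ then -1 else 1 := by
    intro i
    have h := hsq (basis2 hs (.y i))
    rw [ec, map_smul, ec, e, smul_smul, ← sub_eq_zero, ← sub_smul] at h
    exact sub_eq_zero.1 ((smul_eq_zero.1 h).resolve_right ((basis2 (k := k) hs).ne_zero _))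
  have h0 := hz ⟨0, by omega⟩
  rw [hz ⟨1, by omega⟩, hsq', hsq', if_pos rfl, if_neg (by simp), ← sub_eq_zero, ← sub_smul] at h0
  have := (smul_eq_zero.1 h0).resolve_right ((bas k r m).ne_zero _)
  norm_num at this

end

section

/-! ### The toral grading -/

variable {k r m s t : ℕ}

/-- The weights of the maximal torus containing the diagonal group of `Γ₂^s`, when the basis
contains at most one vector `y_h`. -/
def toralWeight : Idx2 k r s t → Option ((Fin k ⊕ Fin r) ⊕ Fin s) → ℤ
  -- For `t = 1` the coordinate `none` is the scalar of `y`, whose square is that of `z`; for `t =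
  -- 0` it is the scalar of `z`.
  | .z => Pi.single none (t + 1)
  | .u => 0
  | .a i => Pi.single (some (.inl (.inl i))) 1
  | .a' i => Pi.single none (t + 1) - Pi.single (some (.inl (.inl i))) 1
  | .c i => Pi.single (some (.inl (.inr i))) 1
  | .c' i => Pi.single none (t + 1) - Pi.single (some (.inl (.inr i))) 1
  | .p i => Pi.single (some (.inr i)) 1
  | .q i => Pi.single none (t + 1) - Pi.single (some (.inr i)) 1
  | .y _ => Pi.single none 1

theorem prod_zpow_single {D M : Type*} [Fintype D] [DecidableEq D] [CommGroup M] (x : D → M)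
    (i : D) (n : ℤ) : ∏ j, x j ^ (Pi.single i n : D → ℤ) j = x i ^ n := by
  rw [Finset.prod_eq_single i (fun j _ hj => by rw [Pi.single_eq_of_ne hj, zpow_zero]) (by simp),
    Pi.single_eq_same]

theorem prod_zpow_sub {D M : Type*} [Fintype D] [CommGroup M] (x : D → M) (v w : D → ℤ) :
    ∏ j, x j ^ (v - w) j = (∏ j, x j ^ v j) / ∏ j, x j ^ w j := by
  simp only [Pi.sub_apply, zpow_sub, Finset.prod_mul_distrib, Finset.prod_inv_distrib,
    div_eq_mul_inv]

/-- The monomial attached to a toral weight. -/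
def toralMonomial (x : Option ((Fin k ⊕ Fin r) ⊕ Fin s) → ℂˣ) : Idx2 k r s t → ℂˣ
  | .z => x none ^ (t + 1)
  | .u => 1
  | .a i => x (some (.inl (.inl i)))
  | .a' i => x none ^ (t + 1) / x (some (.inl (.inl i)))
  | .c i => x (some (.inl (.inr i)))
  | .c' i => x none ^ (t + 1) / x (some (.inl (.inr i)))
  | .p i => x (some (.inr i))
  | .q i => x none ^ (t + 1) / x (some (.inr i))
  | .y _ => x none

theorem prod_zpow_toralWeight (x : Option ((Fin k ⊕ Fin r) ⊕ Fin s) → ℂˣ) (a : Idx2 k r s t) :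
    ∏ j, x j ^ toralWeight a j = toralMonomial x a := by
  have h : ((t : ℤ) + 1) = ((t + 1 : ℕ) : ℤ) := by norm_num
  cases a <;> simp only [toralWeight, toralMonomial, prod_zpow_sub, prod_zpow_single, h, zpow_one,
    zpow_natCast, Pi.zero_apply, zpow_zero, Finset.prod_const_one]

variable {lam : Fin k → ℂˣ} {kap : Fin r → ℂˣ} (hkr : 1 ≤ k + r)

include hkr

theorem exists_aut_diag2 (hs : 2 * s ≤ m - 2 * r) (c : Idx2 k r s (m - 2 * r - 2 * s) → ℂ)
    (hcz : c .z ≠ 0) (hcu : c .u = 1) (hca : ∀ i, c (.a i) * c (.a' i) = c .z)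
    (hcc : ∀ i, c (.c i) * c (.c' i) = c .z) (hcp : ∀ i, c (.p i) * c (.q i) = c .z)
    (hcy : ∀ h, c (.y h) * c (.y h) = c .z) :
    ∃ φ ∈ (heis k r m lam kap).aut, ∀ a, φ (basis2 hs a) = c a • basis2 hs a := by
  have hpar := (adapted_basis2 (lam := lam) (kap := kap) hs).par
  refine exists_aut hkr lam kap (basis2 hs) _ Idx2.par hpar (fun a => smul_mem _ _ (hpar a)) ?_ ?_
  all_goals
    set f := (basis2 hs).constr ℂ fun a => c a • basis2 (k := k) hs a
    have hf : ∀ a, f (vec2 hs a) = c a • vec2 hs a := by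
      intro a
      rw [← basis2_apply, Module.Basis.constr_basis]
    clear_value f
    have hz : f (bas k r m .z) = c .z • bas k r m .z := hf .z
  · rw [hz]
    exact smul_ne_zero hcz ((bas k r m).ne_zero _)
  · intro a b
    simp only [basis2_apply, map_smul, LinearMap.smul_apply, bracket_vec2, smul_smul]
    cases a <;> cases b <;> simp only [table2, map_zero, smul_zero, apply_ite f, map_smul, hz, hf,
      smul_smul, hcu, one_mul, mul_one, mul_comm] <;> (try split_ifs) <;>
      (try subst_vars) <;> (try simp only [smul_zero, smul_smul, hca, hcc, hcp, hcy, mul_comm])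

theorem range_monomialHom_le_aut (hs : 2 * s ≤ m - 2 * r) (ht : m - 2 * r - 2 * s ≤ 1) :
    (monomialHom (basis2 (k := k) hs) toralWeight).range ≤ (heis k r m lam kap).aut := by
  rintro _ ⟨x, rfl⟩
  obtain ⟨φ, hφ, e⟩ := exists_aut_diag2 (lam := lam) (kap := kap) hkr hs
    (fun a => (toralMonomial x a : ℂ)) (Units.ne_zero _) rfl
    (fun i => by rw [← Units.val_mul]; exact congrArg _ (mul_div_cancel _ _))
    (fun i => by rw [← Units.val_mul]; exact congrArg _ (mul_div_cancel _ _))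
    (fun i => by rw [← Units.val_mul]; exact congrArg _ (mul_div_cancel _ _))
    (fun h => by
      have h2 : m - 2 * r - 2 * s + 1 = 2 := by
        have := h.2
        omega
      simp only [toralMonomial]
      rw [← Units.val_mul, h2, pow_two])
  suffices monomialHom (basis2 (k := k) hs) toralWeight x = φ from this ▸ hφ
  refine (basis2 hs).ext' fun a => ?_
  rw [monomialHom_apply, prod_zpow_toralWeight, e]

/-- Every nonzero bracket of basis vectors yields a multiplicative relation; the scalar of `u` is 1
because `ad u` has an eigenvector with nonzero eigenvalue. -/
theorem exists_scalars_of_mem_diag (hs : 2 * s ≤ m - 2 * r) {φ : Space k r m ≃ₗ[ℂ] Space k r m}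
    (hφ : φ ∈ (gamma2 hs lam kap).diag) : ∃ c : Idx2 k r s (m - 2 * r - 2 * s) → ℂˣ,
      (∀ a, φ (basis2 hs a) = (c a : ℂ) • basis2 hs a) ∧ c .u = 1 ∧
      (∀ j, c (fst2 j) * c (snd2 j) = c .z) ∧ (∀ i, c (.p i) * c (.q i) = c .z) ∧
      ∀ h, c (.y h) * c (.y h) = c .z := by
  obtain ⟨hφ, hscal⟩ := hφ
  have h : ∀ a, ∃ c : ℂˣ, φ (basis2 hs a) = (c : ℂ) • basis2 hs a := by
    intro a
    obtain ⟨c, hc⟩ := hscal (deg2 a)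
    have e := hc _ (basis_mem_degSpan (basis2 hs) deg2 rfl)
    refine ⟨Units.mk0 c fun h0 => ?_, e⟩
    rw [h0, zero_smul] at e
    exact (basis2 (k := k) hs).ne_zero a (φ.map_eq_zero_iff.1 e)
  choose c hc using h
  have hc' : ∀ a, φ (vec2 hs a) = (c a : ℂ) • vec2 hs a := fun a => by
    rw [← basis2_apply, hc]
  have hmul : ∀ a a' a'' : Idx2 k r s (m - 2 * r - 2 * s), ∀ μ : ℂ, μ ≠ 0 →
      bracket lam kap (vec2 hs a) (vec2 hs a') = μ • vec2 hs a'' → c a * c a' = c a'' := by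
    intro a a' a'' μ hμ e
    have e' := congrArg φ e
    rw [aut_bracket hφ, map_smul, hc', hc', hc', map_smul, map_smul, LinearMap.smul_apply, e,
      ← sub_eq_zero] at e'
    simp only [smul_smul, ← sub_smul] at e'
    rw [← basis2_apply] at e'
    have h0 := (smul_eq_zero.1 e').resolve_right ((basis2 (k := k) hs).ne_zero _)
    refine Units.ext (mul_left_cancel₀ hμ ?_)
    rw [Units.val_mul]
    linear_combination h0
  have hmul' : ∀ a a' : Idx2 k r s (m - 2 * r - 2 * s),
      bracket lam kap (vec2 hs a) (vec2 hs a') = bas k r m .z → c a * c a' = c .z :=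
    fun a a' e => hmul a a' .z 1 one_ne_zero (e.trans (one_smul ℂ _).symm)
  refine ⟨c, hc, ?_, fun j => ?_, fun i => hmul' _ _ ?_, fun h => hmul' _ _ ?_⟩
  · obtain ⟨j⟩ := nonempty_pair hkr
    refine mul_eq_right.1 (hmul .u (fst2 j) (fst2 j) (-I * pairScale lam kap j) ?_ ?_)
    · simp
    · exact (bracket_vec2 hs lam kap .u (fst2 j)).trans (by cases j <;> rfl)
  · cases j with
    | inl i =>
      exact hmul _ _ .z (-(lam i : ℂ)) (by simp)
        ((bracket_vec2 hs lam kap _ _).trans (if_pos rfl))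
    | inr i => exact hmul' _ _ ((bracket_vec2 hs lam kap _ _).trans (if_pos rfl))
  · exact (bracket_vec2 hs lam kap _ _).trans (if_pos rfl)
  · exact (bracket_vec2 hs lam kap _ _).trans (if_pos rfl)

/-- With at most one `y`, the relations among diagonal scalars are solved by free parameters: one
for each pair and each `p`, and one for `y`, or for `z` if there is no `y`. -/
theorem gamma2_isToral_of_le (hs : 2 * s ≤ m - 2 * r) (ht : m - 2 * r - 2 * s ≤ 1) :
    (gamma2 hs lam kap).IsToral := by
  refine ⟨_, range_monomialHom_le_aut hkr hs ht, isTorus_monomialHom _ _ ?_, fun φ hφ => ?_⟩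
  · intro x hx
    simp only [prod_zpow_toralWeight] at hx
    funext i
    rcases i with _ | (i | i) | i
    · rcases Nat.le_one_iff_eq_zero_or_eq_one.1 ht with h | h
      · have := hx .z
        simpa only [toralMonomial, h, zero_add, pow_one, Pi.one_apply] using this
      · exact hx (.y ⟨0, by omega⟩)
    · exact hx (.a i)
    · exact hx (.c i)
    · exact hx (.p i)
  · obtain ⟨c, hc, hu, hj, hp, hy⟩ := exists_scalars_of_mem_diag hkr hs hφ
    obtain ⟨w, hw, hwy⟩ : ∃ w : ℂˣ, w ^ (m - 2 * r - 2 * s + 1) = c .z ∧ ∀ h, w = c (.y h) := by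
      rcases Nat.le_one_iff_eq_zero_or_eq_one.1 ht with h | h
      · exact ⟨c .z, (congrArg (c .z ^ ·) (congrArg (· + 1) h)).trans (pow_one _), fun i => absurd i.2 (by omega)⟩
      · refine ⟨c (.y ⟨0, by omega⟩), (congrArg (c (.y ⟨0, by omega⟩) ^ ·)
          (congrArg (· + 1) h)).trans ((pow_two _).trans (hy _)), fun i => ?_⟩
        congr 2
        exact Fin.ext (by have := i.2; simp only; omega)
    let x : Option ((Fin k ⊕ Fin r) ⊕ Fin s) → ℂˣ
      | none => w
      | some (.inl j) => c (fst2 j)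
      | some (.inr i) => c (.p i)
    refine ⟨x, (basis2 hs).ext' fun a => ?_⟩
    rw [monomialHom_apply, prod_zpow_toralWeight, hc]
    congr 2
    cases a with
    | z => exact hw
    | u => exact hu.symm
    | a i => rfl
    | a' i => exact div_eq_iff_eq_mul'.2 (hw.trans (hj (.inl i)).symm)
    | c i => rfl
    | c' i => exact div_eq_iff_eq_mul'.2 (hw.trans (hj (.inr i)).symm)
    | p i => rfl
    | q i => exact div_eq_iff_eq_mul'.2 (hw.trans (hp i).symm)
    | y i => exact hwy i

theorem gamma2_isToral_iff (hs : 2 * s ≤ m - 2 * r) :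
    (gamma2 hs lam kap).IsToral ↔ s = m / 2 - r := by
  constructor
  · intro h
    by_contra hne
    exact gamma2_not_isToral hkr hs (by omega) h
  · intro h
    exact gamma2_isToral_of_le hkr hs (by omega)

end

section

/-! ### The number of fine gradings -/

variable {k r m : ℕ}

/-- A grading into lines, as a fine grading in an arbitrary universe. -/
def Grading.IsLineGrading.toFine {A : Type*} [AddCommGroup A] [Module ℂ A] {S : Superalgebra A}
    {G : Type} [AddCommGroup G] {Γ : Grading S G} {ι : Type*} {b : Module.Basis ι ℂ A}
    (h : Γ.IsLineGrading b) : FineGrading.{u} S where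
  G := ULift.{u} G
  grading := Grading.ulift.{u} Γ
  fine := Grading.isFine_of_isAtom _ ((Grading.components_ulift.{u} Γ).symm ▸ h.isAtom)

theorem Grading.ulift_equivalent {A : Type*} [AddCommGroup A] [Module ℂ A] {S : Superalgebra A}
    {G : Type*} [AddCommGroup G] (Γ : Grading S G) : (Grading.ulift.{u} Γ).Equivalent Γ :=
  Grading.equivalent_of_components_eq (Grading.components_ulift.{u} Γ)

variable (lam : Fin k → ℂˣ) (kap : Fin r → ℂˣ)

/-- The listed fine gradings, in an arbitrary universe. -/
def listed (x : Bool × Fin ((m - 2 * r) / 2 + 1)) : FineGrading.{u} (heis k r m lam kap) :=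
  bif x.1 then (gamma1_isLineGrading (s := x.2) (by omega) lam kap).toFine
  else (gamma2_isLineGrading (s := x.2) (by omega) lam kap).toFine

theorem listed_true (i : Fin ((m - 2 * r) / 2 + 1)) :
    (listed.{u} lam kap (true, i)).grading.Equivalent
      (gamma1 (s := i) (by omega) lam kap) :=
  Grading.ulift_equivalent.{u} (gamma1 (s := i) (by omega) lam kap)

theorem listed_false (i : Fin ((m - 2 * r) / 2 + 1)) :
    (listed.{u} lam kap (false, i)).grading.Equivalent
      (gamma2 (s := i) (by omega) lam kap) :=
  Grading.ulift_equivalent.{u} (gamma2 (s := i) (by omega) lam kap)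

variable {lam kap}

/-- `listed` gives two gradings for each of the `(m - 2 * r) / 2 + 1` values of `s`; the parity of
`m` enters through the rounded division. -/
theorem card_fineGradings (hr : 2 * r ≤ m) (hkr : 1 ≤ k + r)
    (hlam : ∀ i j, i ≠ j → ¬ IsOfFinOrder (lam i / lam j))
    (hkap : ∀ i j, i ≠ j → ¬ IsOfFinOrder (kap i / kap j)) :
    Nat.card (Quotient (fineSetoid.{u} (heis k r m lam kap))) =
      if Even m then m - 2 * r + 2 else m - 2 * r + 1 := by
  have hbij : Function.Bijective fun x => (⟦listed.{u} (m := m) lam kap x⟧ :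
      Quotient (fineSetoid.{u} (heis k r m lam kap))) := by
    constructor
    · rintro ⟨c, i⟩ ⟨c', i'⟩ h
      have h : (listed.{u} lam kap (c, i)).grading.Equivalent
        (listed.{u} lam kap (c', i')).grading := Quotient.exact h
      have hf := listed_false.{u} (m := m) lam kap
      have ht := listed_true.{u} (m := m) lam kap
      rcases c with _ | _ <;> rcases c' with _ | _
      · rw [Fin.ext (gamma2_equivalent_gamma2 hkr hlam hkap (((hf i).symm.trans h).trans (hf i')))]
      · exact absurd (((hf i).symm.trans h).trans (ht i')).symm
          (gamma1_not_equivalent_gamma2 hkr hlam hkap _ _)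
      · exact absurd (((ht i).symm.trans h).trans (hf i'))
          (gamma1_not_equivalent_gamma2 hkr hlam hkap _ _)
      · rw [Fin.ext (gamma1_equivalent_gamma1 hkr hlam hkap (((ht i).symm.trans h).trans (ht i')))]
    · refine Quotient.ind fun Γ => ?_
      obtain ⟨s, hs, h | h⟩ := (isFine_iff hlam hkap hkr Γ.grading).1 Γ.fine
      · exact ⟨(true, ⟨s, by omega⟩), Quotient.sound
          ((listed_true lam kap ⟨s, _⟩).trans h.symm)⟩
      · exact ⟨(false, ⟨s, by omega⟩), Quotient.sound
          ((listed_false lam kap ⟨s, _⟩).trans h.symm)⟩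
  rw [← Nat.card_eq_of_bijective _ hbij, Nat.card_eq_fintype_card, Fintype.card_prod,
    Fintype.card_bool, Fintype.card_fin]
  split_ifs with h
  · obtain ⟨c, rfl⟩ := h
    omega
  · obtain ⟨c, rfl⟩ := Nat.not_even_iff_odd.1 h
    omega

end

end TwistedHeisenberg

end

theorem mainTheorem1 (k r m : ℕ) (hr : 2 * r ≤ m) (hkr : 1 ≤ k + r)
    (lam : Fin k → ℂˣ) (kap : Fin r → ℂˣ)
    (hlam : ∀ i j, i ≠ j → ¬ IsOfFinOrder (lam i / lam j))
    (hkap : ∀ i j, i ≠ j → ¬ IsOfFinOrder (kap i / kap j)) :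
    -- the fine gradings are, up to equivalence, exactly the listed ones
    (∀ (G : Type u) [AddCommGroup G]
      (Γ : TwistedHeisenberg.Grading (TwistedHeisenberg.heis k r m lam kap) G),
      Γ.IsFine ↔ ∃ (s : ℕ) (hs : 2 * s ≤ m - 2 * r),
        Γ.Equivalent (TwistedHeisenberg.gamma1 hs lam kap) ∨
        Γ.Equivalent (TwistedHeisenberg.gamma2 hs lam kap)) ∧
    -- the listed gradings are pairwise inequivalent
    (∀ (s s' : ℕ) (hs : 2 * s ≤ m - 2 * r) (hs' : 2 * s' ≤ m - 2 * r),
      ((TwistedHeisenberg.gamma1 hs lam kap).Equivalent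
          (TwistedHeisenberg.gamma1 hs' lam kap) → s = s') ∧
      ((TwistedHeisenberg.gamma2 hs lam kap).Equivalent
          (TwistedHeisenberg.gamma2 hs' lam kap) → s = s') ∧
      ¬ (TwistedHeisenberg.gamma1 hs lam kap).Equivalent
          (TwistedHeisenberg.gamma2 hs' lam kap)) ∧
    -- the number of fine gradings up to equivalence
    Nat.card (Quotient (TwistedHeisenberg.fineSetoid.{u}
        (TwistedHeisenberg.heis k r m lam kap))) =
      (if Even m then m - 2 * r + 2 else m - 2 * r + 1) ∧
    -- torality and Weyl groups
    (∀ (s : ℕ) (hs : 2 * s ≤ m - 2 * r),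
      ¬ (TwistedHeisenberg.gamma1 hs lam kap).IsToral ∧
      ((TwistedHeisenberg.gamma2 hs lam kap).IsToral ↔ s = m / 2 - r) ∧
      Nonempty ((TwistedHeisenberg.gamma1 hs lam kap).WeylGroup ≃*
        TwistedHeisenberg.SignedPerm (k + r) s (m - 2 * r - 2 * s)) ∧
      Nonempty ((TwistedHeisenberg.gamma2 hs lam kap).WeylGroup ≃*
        TwistedHeisenberg.SignedPerm 1 s (m - 2 * r - 2 * s))) :=
  ⟨fun _ _ Γ => TwistedHeisenberg.isFine_iff hlam hkap hkr Γ,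
    fun _ _ _ _ => ⟨TwistedHeisenberg.gamma1_equivalent_gamma1 hkr hlam hkap,
      TwistedHeisenberg.gamma2_equivalent_gamma2 hkr hlam hkap,
      TwistedHeisenberg.gamma1_not_equivalent_gamma2 hkr hlam hkap _ _⟩,
    TwistedHeisenberg.card_fineGradings hr hkr hlam hkap,
    fun _ hs => ⟨TwistedHeisenberg.gamma1_not_isToral hkr hs,
      TwistedHeisenberg.gamma2_isToral_iff hkr hs,
      TwistedHeisenberg.weyl_gamma1 hkr hlam hkap hs,
      TwistedHeisenberg.weyl_gamma2 hkr hlam hkap hs⟩⟩
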